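/- Work over $\mathbb C$. Let $m\ge 6$ and let $V_m$ be the $m$-dimensional vector space with coordinates $x_1,x_2,x_3,y_1,y_2,y_3,z_1,\dots,z_{m-6}$ and the quadratic form $x_1y_1+x_2y_2+x_3y_3+z_1^2+\cdots+z_{m-6}^2$; let $\mathcal Q^{m-2}\subset\mathbb P(V_m)$ be the quadric it defines, $SO_m$ its special orthogonal group, and for $m\ge 8$ let $\mathcal Q^{m-8}=\{z_1^2+\cdots+z_{m-6}^2=0\}\subset\mathbb P^{m-7}$. Embed $SL_3\subset SO_m$ by letting $A$ act as $A$ on the $x$-coordinates, as $(A^{\intercal})^{-1}$ on the $y$-coordinates and trivially on the $z$-coordinates, and let $H_2\subset SL_3$ be the diagonal torus, with character lattice $M_2=(\mathbb Ze_1\oplus\mathbb Ze_2\oplus\mathbb Ze_3)/\mathbb Z(e_1+e_2+e_3)$. Let $G(1,\mathcal Q^{m-2})\subset\mathbb P(\bigwedge^2V_m)$ be the Grassmannian of lines contained in $\mathcal Q^{m-2}$, and let $L=\mathcal O(1)$ be its Plücker line bundle with the linearization induced by the action on $\bigwedge^2V_m$; the weight of a component $Y$ of the fixed locus of $H_2$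 on $G(1,\mathcal Q^{m-2})$ is the character by which $H_2$ acts on the fibres of $L$ over $Y$. Call a weight extremal if it is a vertex of the convex hull in $M_2\otimes\mathbb R$ of the weights of all fixed points. Then the irreducible components of the fixed locus are pairwise disjoint, each has a well-defined weight, and the complete list of them is the following. 1. For $m\ge 6$: for each pair $i\ne j$, exactly one component of weight $e_i-e_j$, and it is a point; these six weights are exactly the extremal weights. 2. For $m\ge 6$: for each of the six weights $\pm e_i$, a one-point component; for $m=6,7$ it is the only component of that weight. 3. For $m\ge 8$: for each of the six weights $\pm e_i$, the components of that weight other than the point in 2 are the components of a closed subset $S$, disjoint from that point, such that $(S,L|_S)\cong(\mathcal Q^{m-8},\mathcal O(1))$. In particular: (a) for $m=8$ they are two points; (b) for $m=9$ there is one, a conic: $(S,L|_S)\cong(\mathbb P^1,\mathcal O(2))$; (c) for $m=10$ there is one, with $(S,L|_S)\cong(\mathbb P^1\times\mathbb P^1,\mathcal O(1,1))$; (d) for $m\ge 11$ there is one, the irreducible quadric $S\cong\mathcal Q^{m-8}$ with $L|_S\cong\mathcal O(1)$. 4. For $m\ge 10$: the set of fixed points of weight $0$ is isomorphic to the Grassmannian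 of lines in $\mathcal Q^{m-8}$, and its components are the central components, i.e. those of weight $0$. For $m=10$ there are two of them, disjoint and each isomorphic to $\mathbb P^1$; for $m\ge 11$ there is exactly one, so this Grassmannian is irreducible. For $m<10$ there is no component of weight $0$. -/

import Mathlib

open scoped LinearAlgebra.Projectivization Topology TensorProduct

noncomputable section

namespace LinesOnQuadric

/-! ### Complex varieties as spaces with functions, and line bundles on them

Varieties are handled classically: a variety is a topological space (with the Zariski topology)
together with its sheaf of regular `ℂ`-valued functions, and a line bundle is a family of
one-dimensional vector spaces together with its sheaf of regular sections.  The two structures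
below only record these data; they are used for the concrete varieties and line bundles
constructed afterwards. -/

/-- The data of a space with `ℂ`-valued functions: a topological space and, for `U` open, the
functions that are regular on `U` (only the values on `U` matter). -/
structure FunctionSpace where
  Pt : Type
  top : TopologicalSpace Pt
  IsRegular : Set Pt → (Pt → ℂ) → Prop

/-- The data of a line bundle on `X`: the fibres and, for `U` open, the sections that are regular
on `U` (only the values on `U` matter). -/
structure LineBundle (X : FunctionSpace) where
  fiber : X.Pt → Type
  [addCommGroup : ∀ x, AddCommGroup (fiber x)]
  [module : ∀ x, Module ℂ (fiber x)]
  IsRegularSection : Set X.Pt → ((x : X.Pt) → fiber x) → Prop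

attribute [instance] LineBundle.addCommGroup LineBundle.module

/-- Isomorphisms of spaces with functions: homeomorphisms that identify the regular functions. -/
structure FunctionSpace.Iso (X Y : FunctionSpace) where
  toEquiv : X.Pt ≃ Y.Pt
  isOpen_iff : ∀ U : Set Y.Pt, IsOpen[Y.top] U ↔ IsOpen[X.top] (toEquiv ⁻¹' U)
  isRegular_iff : ∀ U : Set Y.Pt, IsOpen[Y.top] U → ∀ f : Y.Pt → ℂ,
    Y.IsRegular U f ↔ X.IsRegular (toEquiv ⁻¹' U) (f ∘ toEquiv)

/-- Isomorphisms of pairs `(X, L) ≅ (Y, M)`: an isomorphism `φ : X ≅ Y` together with an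
isomorphism of line bundles `φ^* M ≅ L`. -/
structure LineBundle.Iso {X Y : FunctionSpace} (L : LineBundle X) (M : LineBundle Y) where
  base : X.Iso Y
  onFiber : ∀ x : X.Pt, M.fiber (base.toEquiv x) ≃ₗ[ℂ] L.fiber x
  isRegularSection_iff : ∀ U : Set Y.Pt, IsOpen[Y.top] U → ∀ s : (y : Y.Pt) → M.fiber y,
    M.IsRegularSection U s ↔
      L.IsRegularSection (base.toEquiv ⁻¹' U) (fun x => onFiber x (s (base.toEquiv x)))

/-- A subset `Z` of `X` with the induced topology and the induced functions: those which are
locally restrictions of regular functions on open subsets of `X`.  For `X` a variety and `Z`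
closed, this is the closed subvariety `Z` (with its reduced structure). -/
abbrev FunctionSpace.restrict (X : FunctionSpace) (Z : Set X.Pt) : FunctionSpace where
  Pt := Z
  top := X.top.induced Subtype.val
  IsRegular U f := ∀ z ∈ U, ∃ (V : Set X.Pt) (g : X.Pt → ℂ), IsOpen[X.top] V ∧ (z : X.Pt) ∈ V ∧
    X.IsRegular V g ∧ ∀ z' ∈ U, (z' : X.Pt) ∈ V → f z' = g z'

/-- The restriction of a line bundle to a subset with the induced structure. -/
abbrev LineBundle.restrict {X : FunctionSpace} (L : LineBundle X) (Z : Set X.Pt) :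
    LineBundle (X.restrict Z) where
  fiber z := L.fiber (z : X.Pt)
  IsRegularSection U s := ∀ z ∈ U, ∃ (V : Set X.Pt) (g : (x : X.Pt) → L.fiber x),
    IsOpen[X.top] V ∧ (z : X.Pt) ∈ V ∧ L.IsRegularSection V g ∧
      ∀ z' ∈ U, (z' : X.Pt) ∈ V → s z' = g z'

/-- The irreducible components of a subset `S` (with the induced topology): its maximal
irreducible subsets. -/
def FunctionSpace.components (X : FunctionSpace) (S : Set X.Pt) : Set (Set X.Pt) :=
  {Y | Maximal (fun T => T ⊆ S ∧ @IsIrreducible X.Pt X.top T) Y}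

/-! ### Projective spaces and products of two projective spaces -/

section Projective

variable (E F : Type) [AddCommGroup E] [Module ℂ E] [AddCommGroup F] [Module ℂ F]

/-- The algebra of polynomial functions on a vector space, generated by the linear forms. -/
def polyFun : Subalgebra ℂ (E → ℂ) :=
  Algebra.adjoin ℂ (Set.range fun l : Module.Dual ℂ E => (l : E → ℂ))

variable {E F}

/-- Homogeneous polynomial functions of degree `d`. -/
def IsForm (d : ℕ) (f : E → ℂ) : Prop :=
  f ∈ polyFun E ∧ ∀ (c : ℂ) (v : E), f (c • v) = c ^ d * f v

/-- Bihomogeneous polynomial functions of bidegree `(a, b)`. -/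
def IsBiform (a b : ℕ) (f : E × F → ℂ) : Prop :=
  f ∈ polyFun (E × F) ∧
    ∀ (c d : ℂ) (v : E) (w : F), f (c • v, d • w) = c ^ a * d ^ b * f (v, w)

variable (E F)

/-- The projective space `ℙ(E)` of lines in `E` as a variety: the Zariski topology is generated by
the complements of hypersurfaces, and regular functions are locally quotients of two forms of the
same degree. -/
abbrev projSpace : FunctionSpace where
  Pt := ℙ ℂ E
  top := TopologicalSpace.generateFrom
    {U | ∃ (d : ℕ) (f : E → ℂ), IsForm d f ∧ U = {p | ∃ v ∈ p.submodule, v ≠ 0 ∧ f v ≠ 0}}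
  IsRegular U s := ∀ p ∈ U, ∃ (d : ℕ) (f g : E → ℂ), IsForm d f ∧ IsForm d g ∧
    (∀ v ∈ p.submodule, v ≠ 0 → g v ≠ 0) ∧
    ∀ q ∈ U, ∀ v ∈ q.submodule, v ≠ 0 → g v ≠ 0 → s q = f v / g v

/-- The fibre of `𝒪(d)` at a line `p ⊆ E`: the functions on `p` that are homogeneous of degree
`d`, i.e. the `d`-th power of the dual of `p`. -/
def homogFun (d : ℕ) (p : ℙ ℂ E) : Submodule ℂ (p.submodule → ℂ) where
  carrier := {h | ∀ (c : ℂ) (v : p.submodule), h (c • v) = c ^ d * h v}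
  zero_mem' := by intro c v; simp
  add_mem' := by intro h k hh hk c v; simp only [Pi.add_apply, hh c v, hk c v]; ring
  smul_mem' := by intro a h hh c v; simp only [Pi.smul_apply, smul_eq_mul, hh c v]; ring

/-- The line bundle `𝒪(d)` on `ℙ(E)`; regular sections are locally quotients of two forms whose
degrees differ by `d`. -/
abbrev bundleO (d : ℕ) : LineBundle (projSpace E) where
  fiber p := homogFun E d p
  IsRegularSection U s := ∀ p ∈ U, ∃ (e : ℕ) (f g : E → ℂ), IsForm (e + d) f ∧ IsForm e g ∧
    (∀ v ∈ p.submodule, v ≠ 0 → g v ≠ 0) ∧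
    ∀ q ∈ U, ∀ v : q.submodule, v ≠ 0 → g v ≠ 0 → (s q).1 v = f v / g v

/-- The product `ℙ(E) × ℙ(F)` as a variety, described by bihomogeneous polynomials. -/
abbrev projProd : FunctionSpace where
  Pt := ℙ ℂ E × ℙ ℂ F
  top := TopologicalSpace.generateFrom
    {U | ∃ (a b : ℕ) (f : E × F → ℂ), IsBiform a b f ∧
      U = {p | ∃ v ∈ p.1.submodule, ∃ w ∈ p.2.submodule, v ≠ 0 ∧ w ≠ 0 ∧ f (v, w) ≠ 0}}
  IsRegular U s := ∀ p ∈ U, ∃ (a b : ℕ) (f g : E × F → ℂ), IsBiform a b f ∧ IsBiform a b g ∧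
    (∀ v ∈ p.1.submodule, ∀ w ∈ p.2.submodule, v ≠ 0 → w ≠ 0 → g (v, w) ≠ 0) ∧
    ∀ q ∈ U, ∀ v ∈ q.1.submodule, ∀ w ∈ q.2.submodule, v ≠ 0 → w ≠ 0 → g (v, w) ≠ 0 →
      s q = f (v, w) / g (v, w)

/-- The fibre of `𝒪(a, b)` at a pair of lines. -/
def bihomogFun (a b : ℕ) (p : ℙ ℂ E × ℙ ℂ F) :
    Submodule ℂ (p.1.submodule × p.2.submodule → ℂ) where
  carrier := {h | ∀ (c d : ℂ) (v : p.1.submodule) (w : p.2.submodule),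
    h (c • v, d • w) = c ^ a * d ^ b * h (v, w)}
  zero_mem' := by intro c d v w; simp
  add_mem' := by intro h k hh hk c d v w; simp only [Pi.add_apply, hh c d v w, hk c d v w]; ring
  smul_mem' := by
    intro x h hh c d v w; simp only [Pi.smul_apply, smul_eq_mul, hh c d v w]; ring

/-- The line bundle `𝒪(a, b)` on `ℙ(E) × ℙ(F)`. -/
abbrev bundleOO (a b : ℕ) : LineBundle (projProd E F) where
  fiber p := bihomogFun E F a b p
  IsRegularSection U s := ∀ p ∈ U, ∃ (e e' : ℕ) (f g : E × F → ℂ),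
    IsBiform (e + a) (e' + b) f ∧ IsBiform e e' g ∧
    (∀ v ∈ p.1.submodule, ∀ w ∈ p.2.submodule, v ≠ 0 → w ≠ 0 → g (v, w) ≠ 0) ∧
    ∀ q ∈ U, ∀ (v : q.1.submodule) (w : q.2.submodule), v ≠ 0 → w ≠ 0 → g (v, w) ≠ 0 →
      (s q).1 (v, w) = f (v, w) / g (v, w)

variable {E}

/-- The hypersurface `{q = 0}` in `ℙ(E)`. -/
def quadric (q : E → ℂ) : Set (ℙ ℂ E) := {p | ∀ v ∈ p.submodule, q v = 0}

/-- The Grassmannian of lines in `ℙ(E)` that are contained in `Z ⊆ ℙ(E)`, in its Plücker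
embedding: the line `ℙ(W)` is sent to the point `⋀² W` of `ℙ(⋀² E)`. -/
def linesIn (Z : Set (ℙ ℂ E)) : Set (ℙ ℂ (⋀[ℂ]^2 E)) :=
  {ω | ∃ W : Submodule ℂ E, Module.finrank ℂ W = 2 ∧
    (∀ p : ℙ ℂ E, p.submodule ≤ W → p ∈ Z) ∧
    ω.submodule = LinearMap.range (exteriorPower.map 2 W.subtype)}

end Projective

/-- The projective line. -/
abbrev P1 : FunctionSpace := projSpace (Fin 2 → ℂ)

/-! ### The torus `H₂ ⊂ SL₃ ⊂ SO_m` and its lattice of characters -/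

/-- The two-dimensional torus `H₂`, as the group of triples `(t₁, t₂, t₃)` with `t₁t₂t₃ = 1`. -/
def H2 : Subgroup (Fin 3 → ℂˣ) where
  carrier := {t | ∏ i, t i = 1}
  one_mem' := by simp
  mul_mem' := by
    intro a b ha hb
    simp only [Set.mem_ofPred_eq, Pi.mul_apply, Finset.prod_mul_distrib] at *
    rw [ha, hb, one_mul]
  inv_mem' := by
    intro a ha
    simp only [Set.mem_ofPred_eq, Pi.inv_apply, Finset.prod_inv_distrib] at *
    rw [ha, inv_one]

theorem H2.prod_eq_one (t : H2) : ∏ i, (t : Fin 3 → ℂˣ) i = 1 := t.2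

theorem H2.det_diagonal (t : H2) :
    (Matrix.diagonal fun i => ((t : Fin 3 → ℂˣ) i : ℂ)).det = 1 := by
  rw [Matrix.det_diagonal, ← Units.coe_prod, H2.prod_eq_one, Units.val_one]

/-- `H₂` as the diagonal maximal torus of `SL₃`. -/
def torusToSL3 : H2 →* Matrix.SpecialLinearGroup (Fin 3) ℂ where
  toFun t := ⟨Matrix.diagonal fun i => ((t : Fin 3 → ℂˣ) i : ℂ), H2.det_diagonal t⟩
  map_one' := by ext i j; simp [Matrix.diagonal, Matrix.one_apply]
  map_mul' s t := by
    apply Subtype.ext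
    change Matrix.diagonal _ = Matrix.diagonal _ * Matrix.diagonal _
    rw [Matrix.diagonal_mul_diagonal]
    simp

/-- The lattice `M₂ = (ℤe₁ ⊕ ℤe₂ ⊕ ℤe₃) / ℤ(e₁ + e₂ + e₃)` of characters of `H₂`. -/
abbrev M2 : Type := (Fin 3 → ℤ) ⧸ AddSubgroup.zmultiples (fun _ : Fin 3 => (1 : ℤ))

/-- The class of the basis vector `eᵢ` in `M₂`. -/
def e (i : Fin 3) : M2 := QuotientAddGroup.mk (Pi.single i 1)

/-- The map `ℤ³ → ℂ^*`, `a ↦ t₁^{a₁} t₂^{a₂} t₃^{a₃}` (written additively on the target). -/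
def evalTriple (t : H2) : (Fin 3 → ℤ) →+ Additive ℂˣ where
  toFun a := Additive.ofMul (∏ i, (t : Fin 3 → ℂˣ) i ^ a i)
  map_zero' := by simp
  map_add' a b := by simp [zpow_add, Finset.prod_mul_distrib]

theorem zmultiples_le_ker (t : H2) :
    AddSubgroup.zmultiples (fun _ : Fin 3 => (1 : ℤ)) ≤ (evalTriple t).ker := by
  intro x hx
  obtain ⟨n, rfl⟩ := AddSubgroup.mem_zmultiples_iff.1 hx
  have h : evalTriple t (fun _ => 1) = 0 := by
    apply Additive.toMul.injective
    simpa [evalTriple] using H2.prod_eq_one t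
  rw [AddMonoidHom.mem_ker, map_zsmul, h, smul_zero]

/-- The value at `t ∈ H₂` of the character of `H₂` given by an element of `M₂`: the class of
`a ∈ ℤ³` gives the character `t ↦ t₁^{a₁} t₂^{a₂} t₃^{a₃}`. -/
def charVal (w : M2) (t : H2) : ℂˣ :=
  (QuotientAddGroup.lift _ (evalTriple t) (zmultiples_le_ker t) w).toMul

/-- Indices of the coordinates `xᵢ`, `yᵢ` (`i = 1, 2, 3`) and `zⱼ` (`j = 1, …, m - 6`). -/
abbrev Idx (m : ℕ) : Type := Fin 3 ⊕ Fin 3 ⊕ Fin (m - 6)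

/-- The standard representation `V_m = W₃ ⊕ W₃^* ⊕ V_{m-6}` (used for `m ≥ 6`). -/
abbrev V (m : ℕ) : Type := Idx m → ℂ

/-- The quadratic form `x₁y₁ + x₂y₂ + x₃y₃ + z₁² + ⋯ + z_{m-6}²`. -/
def qForm (m : ℕ) (v : V m) : ℂ :=
  ∑ i, v (.inl i) * v (.inr (.inl i)) + ∑ j, v (.inr (.inr j)) ^ 2

/-- The quadratic form `z₁² + ⋯ + z_k²`. -/
def sumSq (k : ℕ) (z : Fin k → ℂ) : ℂ := ∑ j, z j ^ 2

/-- The group `SO_m` of the quadratic form `qForm m`. -/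
def SO (m : ℕ) : Subgroup (Matrix.SpecialLinearGroup (Idx m) ℂ) where
  carrier := {g | ∀ v, qForm m (g.1.mulVec v) = qForm m v}
  one_mem' := by intro v; simp
  mul_mem' := by
    intro a b ha hb v
    rw [Matrix.SpecialLinearGroup.coe_mul, ← Matrix.mulVec_mulVec, ha, hb]
  inv_mem' := by
    intro a ha v
    have h := ha ((a⁻¹).1.mulVec v)
    rw [Matrix.mulVec_mulVec, ← Matrix.SpecialLinearGroup.coe_mul, mul_inv_cancel] at h
    simpa using h.symm

/-- The matrix of `A` acting on `V_m = W₃ ⊕ W₃^* ⊕ V_{m-6}`, trivially on `V_{m-6}`. -/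
def blockMatrix (m : ℕ) (A : Matrix.SpecialLinearGroup (Fin 3) ℂ) : Matrix (Idx m) (Idx m) ℂ :=
  Matrix.fromBlocks A.1 0 0 (Matrix.fromBlocks (A⁻¹).1.transpose 0 0 1)

theorem blockMatrix_det (m : ℕ) (A : Matrix.SpecialLinearGroup (Fin 3) ℂ) :
    (blockMatrix m A).det = 1 := by
  have h1 : A.1.det = 1 := A.2
  have h2 : (A⁻¹).1.det = 1 := (A⁻¹).2
  rw [blockMatrix, Matrix.det_fromBlocks_zero₂₁, Matrix.det_fromBlocks_zero₂₁,
    Matrix.det_transpose, h1, h2]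
  simp

theorem blockMatrix_qForm (m : ℕ) (A : Matrix.SpecialLinearGroup (Fin 3) ℂ) (v : V m) :
    qForm m ((blockMatrix m A).mulVec v) = qForm m v := by
  have key : ∀ x y : Fin 3 → ℂ,
      A.1.mulVec x ⬝ᵥ (A⁻¹).1.transpose.mulVec y = x ⬝ᵥ y := by
    intro x y
    rw [Matrix.mulVec_transpose, dotProduct_comm, ← Matrix.dotProduct_mulVec,
      Matrix.mulVec_mulVec, ← Matrix.SpecialLinearGroup.coe_mul, inv_mul_cancel,
      Matrix.SpecialLinearGroup.coe_one, Matrix.one_mulVec, dotProduct_comm]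
  have h := key (fun i => v (.inl i)) (fun i => v (.inr (.inl i)))
  simp only [dotProduct] at h
  have hx : ∀ i, (blockMatrix m A).mulVec v (.inl i) =
      A.1.mulVec (fun i => v (.inl i)) i := by
    intro i
    simp [blockMatrix, Matrix.mulVec, dotProduct, Fintype.sum_sum_type]
  have hy : ∀ i, (blockMatrix m A).mulVec v (.inr (.inl i)) =
      (A⁻¹).1.transpose.mulVec (fun i => v (.inr (.inl i))) i := by
    intro i
    simp [blockMatrix, Matrix.mulVec, dotProduct, Fintype.sum_sum_type]
  have hz : ∀ j, (blockMatrix m A).mulVec v (.inr (.inr j)) = v (.inr (.inr j)) := by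
    intro j
    simp [blockMatrix, Matrix.mulVec, dotProduct, Fintype.sum_sum_type, Matrix.one_apply]
  simp only [qForm, hx, hy, hz, h]

/-- The embedding `SL₃ ⊂ SO₆ × SO_{m-6} ⊂ SO_m`. -/
def SL3ToSO (m : ℕ) : Matrix.SpecialLinearGroup (Fin 3) ℂ →* SO m where
  toFun A := ⟨⟨blockMatrix m A, blockMatrix_det m A⟩, blockMatrix_qForm m A⟩
  map_one' := by
    apply Subtype.ext
    apply Subtype.ext
    simp [blockMatrix, Matrix.fromBlocks_one]
  map_mul' A B := by
    apply Subtype.ext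
    apply Subtype.ext
    change blockMatrix m (A * B) = blockMatrix m A * blockMatrix m B
    simp only [blockMatrix, Matrix.fromBlocks_multiply, mul_inv_rev,
      Matrix.SpecialLinearGroup.coe_mul, Matrix.transpose_mul]
    simp

/-! ### The action on the Grassmannian of lines and its fixed locus -/

/-- The linear action of `SO_m` on `⋀² V_m`. -/
def wedgeAction (m : ℕ) (g : SO m) : ⋀[ℂ]^2 (V m) →ₗ[ℂ] ⋀[ℂ]^2 (V m) :=
  exteriorPower.map 2 (Matrix.toLin' g.1.1)

/-- The action of `H₂ ⊂ SL₃ ⊂ SO_m` on `⋀² V_m`. -/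
def torusAction (m : ℕ) (t : H2) : ⋀[ℂ]^2 (V m) →ₗ[ℂ] ⋀[ℂ]^2 (V m) :=
  wedgeAction m (SL3ToSO m (torusToSL3 t))

/-- The Plücker space `ℙ(⋀² V_m)`. -/
abbrev pluckerSpace (m : ℕ) : FunctionSpace := projSpace (⋀[ℂ]^2 (V m))

/-- The Grassmannian of lines `G(1, 𝒬^{m-2})` in the quadric `𝒬^{m-2} = {qForm m = 0} ⊂ ℙ(V_m)`. -/
def G (m : ℕ) : Set (ℙ ℂ (⋀[ℂ]^2 (V m))) := linesIn (quadric (qForm m))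

/-- The fixed locus of `H₂` on `G(1, 𝒬^{m-2})`. -/
def fixedLocus (m : ℕ) : Set (ℙ ℂ (⋀[ℂ]^2 (V m))) :=
  {ω ∈ G m | ∀ t : H2, ω.submodule.map (torusAction m t) = ω.submodule}

/-- The fixed points of weight `w` for the line bundle `L = 𝒪(1)` with the linearization coming
from the action on `⋀² V_m`: the points `ω` where `H₂` acts on the fibre `L_ω` by the character
`w`.  The action on `L_ω` is `(t · h)(v) = h (t⁻¹ v)`. -/
def weightLocus (m : ℕ) (w : M2) : Set (ℙ ℂ (⋀[ℂ]^2 (V m))) :=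
  {ω ∈ fixedLocus m | ∀ (t : H2) (h : (bundleO (⋀[ℂ]^2 (V m)) 1).fiber ω)
    (v v' : ω.submodule), torusAction m t v' = v → h.1 v' = (charVal w t : ℂ) * h.1 v}

/-- The components of the fixed locus. -/
def fixedComponents (m : ℕ) : Set (Set (ℙ ℂ (⋀[ℂ]^2 (V m)))) :=
  (pluckerSpace m).components (fixedLocus m)

/-- The components of the fixed locus associated to the weight `w`. -/
def componentsOfWeight (m : ℕ) (w : M2) : Set (Set (ℙ ℂ (⋀[ℂ]^2 (V m)))) :=
  {Y ∈ fixedComponents m | Y ⊆ weightLocus m w}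

/-- A subset of `ℙ(⋀² V_m)` with its induced structure. -/
abbrev subvar (m : ℕ) (S : Set (ℙ ℂ (⋀[ℂ]^2 (V m)))) : FunctionSpace :=
  (pluckerSpace m).restrict S

/-- The restriction of the Plücker line bundle `L = 𝒪(1)` to a subset of `ℙ(⋀² V_m)`. -/
abbrev restrictL (m : ℕ) (S : Set (ℙ ℂ (⋀[ℂ]^2 (V m)))) : LineBundle (subvar m S) :=
  (bundleO (⋀[ℂ]^2 (V m)) 1).restrict S

/-- The quadric `𝒬^{m-8} = {z₁² + ⋯ + z_{m-6}² = 0}` in `ℙ(V_{m-6})` (used for `m ≥ 8`). -/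
abbrev smallQuadric (m : ℕ) : Set (ℙ ℂ (Fin (m - 6) → ℂ)) := quadric (sumSq (m - 6))

/-- The quadric `𝒬^{m-8}` as a variety. -/
abbrev smallQuadricVar (m : ℕ) : FunctionSpace :=
  (projSpace (Fin (m - 6) → ℂ)).restrict (smallQuadric m)

/-- The line bundle `𝒪(1)` on the quadric `𝒬^{m-8}`. -/
abbrev smallQuadricO1 (m : ℕ) : LineBundle (smallQuadricVar m) :=
  (bundleO (Fin (m - 6) → ℂ) 1).restrict (smallQuadric m)

/-- The Grassmannian of lines in the quadric `𝒬^{m-8}` as a variety. -/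
abbrev smallG (m : ℕ) : FunctionSpace :=
  (projSpace (⋀[ℂ]^2 (Fin (m - 6) → ℂ))).restrict (linesIn (smallQuadric m))

/-- The weights of the fixed points, as points of `M₂ ⊗ ℝ`. -/
def weightPoints (m : ℕ) : Set (ℝ ⊗[ℤ] M2) :=
  {x | ∃ w : M2, (weightLocus m w).Nonempty ∧ x = (1 : ℝ) ⊗ₜ[ℤ] w}

/-- A weight is extremal if it is a vertex of the polytope of fixed points, i.e. of the convex
hull of the weights of the fixed points. -/
def IsExtremalWeight (m : ℕ) (w : M2) : Prop :=
  (1 : ℝ) ⊗ₜ[ℤ] w ∈ (convexHull ℝ (weightPoints m)).extremePoints ℝ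

end LinesOnQuadric

end

open LinesOnQuadric

open scoped LinearAlgebra.Projectivization Topology TensorProduct

noncomputable section

namespace LinesOnQuadric

/-! Under H₂ the space V_m splits into the six lines spanned by the basis vectors of the xᵢ and yᵢ,
with the pairwise distinct nonzero weights eᵢ and -eᵢ, and the space of the zⱼ, of weight 0. A point
of `G m` is an isotropic plane W, and it is fixed exactly when W is stable, that is, when W is the
sum of its intersections with the weight spaces. So W is spanned by two basis vectors that are not
paired by the form, or by one basis vector and an isotropic vector in the zⱼ, or it is an isotropic
plane in the zⱼ (`fixedLocus_cases`). The single element (2, 3, 1/6) of H₂ already separates all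
characters, so it can replace the whole torus in this argument (`charVal_genericElt_injective`).

The fibre of L at W is the dual of ⋀²W, so the weight is minus the sum of the two weights on W. In
the first case this gives twelve points with distinct weights: a pair xᵢ, yⱼ gives a root, and a
pair of the same kind gives some eₖ or -eₖ because e₁ + e₂ + e₃ = 0. In the second case the weight
is again one of these six, and the plane depends linearly on the z-vector, which gives a copy of the
small quadric with L restricting to 𝒪(1). The third case gives weight 0 and the lines in the small
quadric.

The eigenspaces of the generic element on ⋀²V_m cut out closed, pairwise disjoint sets, one for each
weight. Hence the components of the fixed locus can be computed one weight at a time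
(`exists_weight_of_isIrreducible`, `componentsOfWeight_eq`). Within a weight ±eᵢ a Plücker
coordinate separates the isolated point from the quadric (`componentsOfWeight_wt`).

Irreducibility of quadrics and of their Grassmannians of lines is proved by joining any two points
by a rational curve inside the variety (`isIrreducible_of_curves`, `exists_curve_of_isotropic`). The
small cases are explicit: two points, the conic parametrised by squares, the Segre surface seen as
the singular 2×2 matrices (`sumSq_four`), and its two rulings (`centralLines_ten`).

Isomorphisms of varieties with line bundles are reduced to statements about forms: everything is
evaluated at chosen representatives of lines, and `FormModel.iso` absorbs the scalars by which these
representatives fail to match.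

The extremal weights are found with the linear forms aᵢ - aⱼ, each of which attains its maximum 2
only at eᵢ - eⱼ; all other weights are midpoints of two distinct weights. -/

/-! ### Spaces and line bundles presented by forms -/

/-- A presentation of a pair `(X, L)` by forms: the topology is generated by the complements of
the zero sets of forms, regular functions are local quotients of forms of the same degree, and in
a trivialisation `ev` of the fibres regular sections are local quotients of forms whose degrees
differ by `twist`. -/
structure FormModel (X : FunctionSpace) (L : LineBundle X) where
  Deg : Type
  [deg : AddCommMonoid Deg]
  twist : Deg
  form : Deg → (X.Pt → ℂ) → Prop
  form_one : form 0 (fun _ => 1)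
  form_mul : ∀ {d e f g}, form d f → form e g → form (d + e) (fun x => f x * g x)
  ev : ∀ x, L.fiber x ≃ₗ[ℂ] ℂ
  top_eq : X.top = TopologicalSpace.generateFrom {U | ∃ d f, form d f ∧ U = {x | f x ≠ 0}}
  regular_iff : ∀ U s, X.IsRegular U s ↔ ∀ x ∈ U, ∃ d f g, form d f ∧ form d g ∧ g x ≠ 0 ∧
    ∀ y ∈ U, g y ≠ 0 → s y = f y / g y
  section_iff : ∀ U s, L.IsRegularSection U s ↔ ∀ x ∈ U, ∃ d f g, form (d + twist) f ∧
    form d g ∧ g x ≠ 0 ∧ ∀ y ∈ U, g y ≠ 0 → ev y (s y) = f y / g y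

attribute [instance] FormModel.deg

namespace FormModel

variable {X Y : FunctionSpace} {L : LineBundle X} {L' : LineBundle Y}

theorem isOpen_form (M : FormModel X L) {d : M.Deg} {f : X.Pt → ℂ} (hf : M.form d f) :
    IsOpen[X.top] {x | f x ≠ 0} := by
  rw [M.top_eq]
  exact TopologicalSpace.isOpen_generateFrom_of_mem ⟨d, f, hf, rfl⟩

/-- Forms can be multiplied, so finite intersections of nonvanishing loci are again of this kind:
the nonvanishing loci are a basis of the topology and not only a subbasis. -/
theorem exists_form_of_isOpen (M : FormModel X L) {U : Set X.Pt} (hU : IsOpen[X.top] U)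
    {x : X.Pt} (hx : x ∈ U) : ∃ d f, M.form d f ∧ f x ≠ 0 ∧ ∀ y, f y ≠ 0 → y ∈ U := by
  rw [M.top_eq] at hU
  induction hU with
  | basic s hs =>
    obtain ⟨d, f, hf, rfl⟩ := hs
    exact ⟨d, f, hf, hx, fun y hy => hy⟩
  | univ => exact ⟨0, _, M.form_one, one_ne_zero, fun y _ => trivial⟩
  | inter s t _ _ ihs iht =>
    obtain ⟨d, f, hf, hfx, hfs⟩ := ihs hx.1
    obtain ⟨e, g, hg, hgx, hgt⟩ := iht hx.2
    exact ⟨_, _, M.form_mul hf hg, mul_ne_zero hfx hgx, fun y hy =>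
      ⟨hfs y (left_ne_zero_of_mul hy), hgt y (right_ne_zero_of_mul hy)⟩⟩
  | sUnion S _ ih =>
    obtain ⟨s, hs, hxs⟩ := hx
    obtain ⟨d, f, hf, hfx, hfs⟩ := ih s hs hxs
    exact ⟨d, f, hf, hfx, fun y hy => ⟨s, hs, hfs y hy⟩⟩

theorem isOpen_iff (M : FormModel X L) {U : Set X.Pt} :
    IsOpen[X.top] U ↔ ∀ x ∈ U, ∃ d f, M.form d f ∧ f x ≠ 0 ∧ ∀ y, f y ≠ 0 → y ∈ U := by
  refine ⟨fun hU x hx => M.exists_form_of_isOpen hU hx, fun h => ?_⟩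
  let := X.top
  refine isOpen_iff_forall_mem_open.2 fun x hx => ?_
  obtain ⟨d, f, hf, hfx, hfU⟩ := h x hx
  exact ⟨_, hfU, M.isOpen_form hf, hfx⟩

/-- The restriction of a presentation to a subset. -/
def restrict (M : FormModel X L) (Z : Set X.Pt) :
    FormModel (X.restrict Z) (L.restrict Z) where
  Deg := M.Deg
  twist := M.twist
  form d f := ∃ F, M.form d F ∧ f = fun z => F z.1
  form_one := ⟨_, M.form_one, rfl⟩
  form_mul := by
    rintro d e f g ⟨F, hF, rfl⟩ ⟨F', hF', rfl⟩
    exact ⟨_, M.form_mul hF hF', rfl⟩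
  ev z := M.ev z.1
  top_eq := by
    change TopologicalSpace.induced _ X.top = _
    rw [M.top_eq, induced_generateFrom_eq]
    congr 1
    ext U
    constructor
    · rintro ⟨_, ⟨d, F, hF, rfl⟩, rfl⟩
      exact ⟨d, _, ⟨F, hF, rfl⟩, rfl⟩
    · rintro ⟨d, _, ⟨F, hF, rfl⟩, rfl⟩
      exact ⟨_, ⟨d, F, hF, rfl⟩, rfl⟩
  regular_iff U s := by
    constructor
    · intro h x hx
      obtain ⟨W, t, hW, hxW, ht, hst⟩ := h x hx
      obtain ⟨d, f, g, hf, hg, hgx, hfg⟩ := (M.regular_iff W t).1 ht _ hxW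
      -- Numerator and denominator are multiplied by a form `k` whose nonvanishing locus lies in
      -- `W`. The quotient formula then holds wherever the new denominator is nonzero, without
      -- reference to `W`.
      obtain ⟨e, k, hk, hkx, hkW⟩ := M.exists_form_of_isOpen hW hxW
      refine ⟨d + e, _, _, ⟨_, M.form_mul hf hk, rfl⟩, ⟨_, M.form_mul hg hk, rfl⟩,
        mul_ne_zero hgx hkx, fun y hy hne => ?_⟩
      have h1 := left_ne_zero_of_mul hne
      have h2 := right_ne_zero_of_mul hne
      rw [hst y hy (hkW _ h2), hfg _ (hkW _ h2) h1, mul_div_mul_right _ _ h2]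
    · intro h x hx
      obtain ⟨d, _, _, ⟨f, hf, rfl⟩, ⟨g, hg, rfl⟩, hgx, hfg⟩ := h x hx
      refine ⟨{y | g y ≠ 0}, fun y => f y / g y, M.isOpen_form hg, hgx,
        (M.regular_iff _ _).2 fun y hy => ⟨d, f, g, hf, hg, hy, fun _ _ _ => rfl⟩,
        fun y hy hne => hfg y hy hne⟩
  section_iff U s := by
    constructor
    · intro h x hx
      obtain ⟨W, t, hW, hxW, ht, hst⟩ := h x hx
      obtain ⟨d, f, g, hf, hg, hgx, hfg⟩ := (M.section_iff W t).1 ht _ hxW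
      obtain ⟨e, k, hk, hkx, hkW⟩ := M.exists_form_of_isOpen hW hxW
      have hfk := M.form_mul hf hk
      rw [add_right_comm] at hfk
      refine ⟨d + e, _, _, ⟨_, hfk, rfl⟩, ⟨_, M.form_mul hg hk, rfl⟩,
        mul_ne_zero hgx hkx, fun y hy hne => ?_⟩
      have h1 := left_ne_zero_of_mul hne
      have h2 := right_ne_zero_of_mul hne
      rw [hst y hy (hkW _ h2), hfg _ (hkW _ h2) h1, mul_div_mul_right _ _ h2]
    · intro h x hx
      obtain ⟨d, _, _, ⟨f, hf, rfl⟩, ⟨g, hg, rfl⟩, hgx, hfg⟩ := h x hx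
      refine ⟨{y | g y ≠ 0}, fun y => (M.ev y).symm (f y / g y), M.isOpen_form hg, hgx,
        (M.section_iff _ _).2 fun y hy => ⟨d, f, g, hf, hg, hy, fun _ _ _ => by simp⟩,
        fun y hy hne => ?_⟩
      exact (M.ev y.1).injective ((hfg y hy hne).trans (LinearEquiv.apply_symm_apply _ _).symm)

/-- Two presented pairs are isomorphic if a bijection identifies forms up to rescaling: forms of
`X` pull back to forms of `Y`, and near every point forms of `Y` come from forms of `X`. -/
def iso (M : FormModel X L) (N : FormModel Y L') (φ : X.Pt ≃ Y.Pt)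
    (κ : M.Deg → Y.Pt → ℂ) (κ₁ : Y.Pt → ℂ) (τ : M.Deg → N.Deg)
    (hκ : ∀ d y, κ d y ≠ 0) (hκ₁ : ∀ y, κ₁ y ≠ 0)
    (hκκ : ∀ d y, κ (d + M.twist) y = κ d y * κ₁ y)
    (hτ : ∀ d, τ (d + M.twist) = τ d + N.twist)
    (pull : ∀ d f, M.form d f → N.form (τ d) fun y => κ d y * f (φ.symm y))
    (inv : ∀ y₀, ∃ (ψ : N.Deg → M.Deg) (μ : N.Deg → X.Pt → ℂ) (η : M.Deg) (u : X.Pt → ℂ),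
      (∀ d f, N.form d f → M.form (ψ d) fun x => μ d x * f (φ x)) ∧
      (∀ d, μ d (φ.symm y₀) ≠ 0) ∧ M.form η u ∧
      (∀ d, ψ (d + N.twist) = ψ d + η + M.twist) ∧
      ∀ d x, μ (d + N.twist) x * κ₁ (φ x) = u x * μ d x) :
    L.Iso L' where
  base :=
    { toEquiv := φ
      isOpen_iff := by
        intro U
        rw [M.isOpen_iff, N.isOpen_iff]
        constructor
        · intro h x hx
          obtain ⟨d, f, hf, hfx, hfU⟩ := h (φ x) hx
          obtain ⟨ψ, μ, η, u, h1, h2, -⟩ := inv (φ x)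
          refine ⟨_, _, h1 d f hf, mul_ne_zero ?_ hfx, fun y hy =>
            hfU _ (right_ne_zero_of_mul hy)⟩
          simpa using h2 d
        · intro h y hy
          obtain ⟨d, f, hf, hfx, hfU⟩ := h (φ.symm y) (by simpa using hy)
          refine ⟨_, _, pull d f hf, mul_ne_zero (hκ _ _) hfx, fun z hz => ?_⟩
          simpa using hfU _ (right_ne_zero_of_mul hz)
      isRegular_iff := by
        intro U _ s
        rw [M.regular_iff, N.regular_iff]
        constructor
        · intro h x hx
          obtain ⟨d, f, g, hf, hg, hgx, hfg⟩ := h (φ x) hx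
          obtain ⟨ψ, μ, η, u, h1, h2, -⟩ := inv (φ x)
          refine ⟨_, _, _, h1 d f hf, h1 d g hg, mul_ne_zero (by simpa using h2 d) hgx,
            fun y hy hne => ?_⟩
          rw [mul_div_mul_left _ _ (left_ne_zero_of_mul hne)]
          exact hfg _ hy (right_ne_zero_of_mul hne)
        · intro h y hy
          obtain ⟨d, f, g, hf, hg, hgx, hfg⟩ := h (φ.symm y) (by simpa using hy)
          refine ⟨_, _, _, pull d f hf, pull d g hg, mul_ne_zero (hκ _ _) hgx,
            fun z hz hne => ?_⟩
          rw [mul_div_mul_left _ _ (left_ne_zero_of_mul hne)]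
          simpa using hfg (φ.symm z) (by simpa using hz) (right_ne_zero_of_mul hne) }
  -- The trivialisations on the two sides refer to unrelated representatives; `κ₁` is the ratio
  -- between them.
  onFiber x := (N.ev (φ x)).trans
    ((LinearEquiv.smulOfNeZero ℂ ℂ (κ₁ (φ x))⁻¹ (inv_ne_zero (hκ₁ _))).trans (M.ev x).symm)
  isRegularSection_iff := by
    intro U _ s
    rw [M.section_iff, N.section_iff]
    have key : ∀ x, M.ev x (((N.ev (φ x)).trans ((LinearEquiv.smulOfNeZero ℂ ℂ (κ₁ (φ x))⁻¹
        (inv_ne_zero (hκ₁ _))).trans (M.ev x).symm)) (s (φ x))) =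
        (κ₁ (φ x))⁻¹ * N.ev (φ x) (s (φ x)) := by
      intro x
      simp only [LinearEquiv.trans_apply, LinearEquiv.apply_symm_apply]
      rfl
    constructor
    · intro h x hx
      obtain ⟨d, f, g, hf, hg, hgx, hfg⟩ := h (φ x) hx
      obtain ⟨ψ, μ, η, u, h1, h2, h3, h4, h5⟩ := inv (φ x)
      simp only [Equiv.symm_apply_apply] at h2
      have hu : u x ≠ 0 := by
        intro h0
        have := h5 d x
        rw [h0, zero_mul] at this
        exact mul_ne_zero (h2 _) (hκ₁ _) this
      -- The multipliers of numerator and denominator differ because their degrees differ by the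
      -- twist. The form `u` corrects this: by `h5` the factor `μ (d + twist) / (μ d * u)` equals
      -- `κ₁⁻¹`.
      refine ⟨ψ d + η, fun y => μ (d + N.twist) y * f (φ y), _, ?_, M.form_mul (h1 d g hg) h3,
        mul_ne_zero (mul_ne_zero (h2 d) hgx) hu, fun y hy hne => ?_⟩
      · rw [← h4]
        exact h1 _ f hf
      · have a1 := right_ne_zero_of_mul hne
        have a2 := right_ne_zero_of_mul (left_ne_zero_of_mul hne)
        have a3 := left_ne_zero_of_mul (left_ne_zero_of_mul hne)
        have a4 := hκ₁ (φ y)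
        refine (key y).trans ?_
        rw [hfg _ hy a2]
        field_simp
        linear_combination f (φ y) * (-h5 d y)
    · intro h y hy
      obtain ⟨d, f, g, hf, hg, hgx, hfg⟩ := h (φ.symm y) (by simpa using hy)
      refine ⟨τ d, fun z => κ (d + M.twist) z * f (φ.symm z), _, ?_, pull d g hg,
        mul_ne_zero (hκ _ _) hgx, fun z hz hne => ?_⟩
      · rw [← hτ]
        exact pull _ f hf
      · obtain ⟨x, rfl⟩ := φ.surjective z
        have a1 := left_ne_zero_of_mul hne
        have a2 := right_ne_zero_of_mul hne
        simp only [Equiv.symm_apply_apply] at a2 ⊢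
        have h6 := (key x).symm.trans (hfg x hz a2)
        rw [hκκ, mul_assoc, mul_div_mul_left _ _ a1, mul_div_assoc, ← h6,
          mul_inv_cancel_left₀ (hκ₁ _)]

end FormModel

/-! ### Forms -/

section Forms

variable {E F : Type} [AddCommGroup E] [Module ℂ E] [AddCommGroup F] [Module ℂ F]

theorem dual_mem_polyFun (l : Module.Dual ℂ E) : (l : E → ℂ) ∈ polyFun E :=
  Algebra.subset_adjoin ⟨l, rfl⟩

/-- Linear forms generate the polynomial functions, so it suffices that their pullbacks are
polynomial. -/
theorem comp_mem_polyFun {ν : E → F} (hν : ∀ l : Module.Dual ℂ F, (fun v => l (ν v)) ∈ polyFun E)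
    {f : F → ℂ} (hf : f ∈ polyFun F) : (fun v => f (ν v)) ∈ polyFun E := by
  induction hf using Algebra.adjoin_induction with
  | mem x hx =>
    obtain ⟨l, rfl⟩ := hx
    exact hν l
  | algebraMap r => exact (polyFun E).algebraMap_mem r
  | add x y _ _ hx hy => exact (polyFun E).add_mem hx hy
  | mul x y _ _ hx hy => exact (polyFun E).mul_mem hx hy

theorem linear_comp_mem_polyFun (φ : E →ₗ[ℂ] F) {f : F → ℂ} (hf : f ∈ polyFun F) :
    (fun v => f (φ v)) ∈ polyFun E :=
  comp_mem_polyFun (fun l => dual_mem_polyFun (l ∘ₗ φ)) hf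

theorem IsForm.one : IsForm 0 (fun _ : E => (1 : ℂ)) :=
  ⟨(polyFun E).one_mem, fun c v => by simp⟩

theorem IsForm.dual (l : Module.Dual ℂ E) : IsForm 1 (l : E → ℂ) :=
  ⟨dual_mem_polyFun l, fun c v => by simp⟩

theorem IsForm.mul {d e : ℕ} {f g : E → ℂ} (hf : IsForm d f) (hg : IsForm e g) :
    IsForm (d + e) (fun v => f v * g v) :=
  ⟨(polyFun E).mul_mem hf.1 hg.1, fun c v => by
    beta_reduce
    rw [hf.2, hg.2]
    ring⟩

theorem IsBiform.one : IsBiform 0 0 (fun _ : E × F => (1 : ℂ)) :=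
  ⟨(polyFun (E × F)).one_mem, fun c d v w => by simp⟩

theorem IsBiform.mul {a b a' b' : ℕ} {f g : E × F → ℂ} (hf : IsBiform a b f)
    (hg : IsBiform a' b' g) : IsBiform (a + a') (b + b') (fun v => f v * g v) :=
  ⟨(polyFun (E × F)).mul_mem hf.1 hg.1, fun c d v w => by
    beta_reduce
    rw [hf.2, hg.2]
    ring⟩

theorem rep_mem_submodule (p : ℙ ℂ E) : p.rep ∈ p.submodule := by
  rw [p.submodule_eq]
  exact Submodule.mem_span_singleton_self _

theorem exists_smul_rep {p : ℙ ℂ E} {v : E} (hv : v ∈ p.submodule) : ∃ c : ℂ, c • p.rep = v := by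
  rw [p.submodule_eq] at hv
  exact Submodule.mem_span_singleton.1 hv

theorem exists_smul_rep_of_ne_zero {p : ℙ ℂ E} {v : E} (hv : v ∈ p.submodule) (h0 : v ≠ 0) :
    ∃ c : ℂ, c ≠ 0 ∧ v = c • p.rep := by
  obtain ⟨c, rfl⟩ := exists_smul_rep hv
  exact ⟨c, fun h => h0 (by simp [h]), rfl⟩

/-- The coordinate on a line given by its chosen generator. -/
def repCoord (p : ℙ ℂ E) : p.submodule →ₗ[ℂ] ℂ :=
  ((LinearEquiv.toSpanNonzeroSingleton ℂ E p.rep p.rep_nonzero).symm.toLinearMap) ∘ₗ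
    (LinearEquiv.ofEq _ _ p.submodule_eq).toLinearMap

theorem repCoord_smul_rep (p : ℙ ℂ E) (v : p.submodule) : repCoord p v • p.rep = (v : E) := by
  have := (LinearEquiv.toSpanNonzeroSingleton ℂ E p.rep p.rep_nonzero).apply_symm_apply
    (LinearEquiv.ofEq _ _ p.submodule_eq v)
  exact congrArg Subtype.val this

theorem repCoord_rep (p : ℙ ℂ E) : repCoord p ⟨p.rep, rep_mem_submodule p⟩ = 1 := by
  have := repCoord_smul_rep p ⟨p.rep, rep_mem_submodule p⟩
  exact smul_left_injective ℂ p.rep_nonzero (this.trans (one_smul ℂ p.rep).symm)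

theorem eq_repCoord_smul (p : ℙ ℂ E) (v : p.submodule) :
    v = repCoord p v • (⟨p.rep, rep_mem_submodule p⟩ : p.submodule) :=
  Subtype.ext (repCoord_smul_rep p v).symm

theorem repCoord_ne_zero {p : ℙ ℂ E} {v : p.submodule} (hv : v ≠ 0) : repCoord p v ≠ 0 := by
  intro h
  apply hv
  rw [eq_repCoord_smul p v, h, zero_smul]

variable (E F)

/-- Evaluation of the fibre of `𝒪(d)` at the chosen generator of a line. -/
def evO (d : ℕ) (p : ℙ ℂ E) : homogFun E d p ≃ₗ[ℂ] ℂ where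
  toFun h := h.1 ⟨p.rep, rep_mem_submodule p⟩
  map_add' _ _ := rfl
  map_smul' _ _ := rfl
  invFun a := ⟨fun v => repCoord p v ^ d * a, fun c v => by
    beta_reduce
    rw [map_smul, smul_eq_mul, mul_pow, mul_assoc]⟩
  left_inv h := by
    apply Subtype.ext
    funext v
    conv_rhs => rw [eq_repCoord_smul p v]
    exact (h.2 _ _).symm
  right_inv a := by
    change repCoord p _ ^ d * a = a
    rw [repCoord_rep, one_pow, one_mul]

theorem evO_mul {d : ℕ} {p : ℙ ℂ E} (h : homogFun E d p) (v : p.submodule) :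
    h.1 v = repCoord p v ^ d * evO E d p h := by
  conv_lhs => rw [eq_repCoord_smul p v]
  exact h.2 _ _

/-- Evaluation of the fibre of `𝒪(a, b)` at the chosen generators. -/
def evOO (a b : ℕ) (p : ℙ ℂ E × ℙ ℂ F) : bihomogFun E F a b p ≃ₗ[ℂ] ℂ where
  toFun h := h.1 (⟨p.1.rep, rep_mem_submodule _⟩, ⟨p.2.rep, rep_mem_submodule _⟩)
  map_add' _ _ := rfl
  map_smul' _ _ := rfl
  invFun x := ⟨fun v => repCoord p.1 v.1 ^ a * repCoord p.2 v.2 ^ b * x, fun c d v w => by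
    simp only [map_smul, smul_eq_mul, mul_pow]
    ring⟩
  left_inv h := by
    apply Subtype.ext
    funext v
    conv_rhs => rw [← Prod.mk.eta (p := v), eq_repCoord_smul p.1 v.1, eq_repCoord_smul p.2 v.2]
    exact (h.2 _ _ _ _).symm
  right_inv x := by
    change repCoord p.1 _ ^ a * repCoord p.2 _ ^ b * x = x
    rw [repCoord_rep, repCoord_rep, one_pow, one_mul, one_pow, one_mul]

theorem evOO_mul {a b : ℕ} {p : ℙ ℂ E × ℙ ℂ F} (h : bihomogFun E F a b p) (v : p.1.submodule)
    (w : p.2.submodule) :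
    h.1 (v, w) = repCoord p.1 v ^ a * repCoord p.2 w ^ b * evOO E F a b p h := by
  conv_lhs => rw [eq_repCoord_smul p.1 v, eq_repCoord_smul p.2 w]
  exact h.2 _ _ _ _

variable {E F}

theorem IsForm.apply_eq {d : ℕ} {f : E → ℂ} (hf : IsForm d f) {p : ℙ ℂ E} (v : p.submodule) :
    f v = repCoord p v ^ d * f p.rep := by
  conv_lhs => rw [← repCoord_smul_rep p v]
  exact hf.2 _ _

theorem IsBiform.apply_eq {a b : ℕ} {f : E × F → ℂ} (hf : IsBiform a b f) {p : ℙ ℂ E × ℙ ℂ F}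
    (v : p.1.submodule) (w : p.2.submodule) :
    f (v, w) = repCoord p.1 v ^ a * repCoord p.2 w ^ b * f (p.1.rep, p.2.rep) := by
  conv_lhs => rw [← repCoord_smul_rep p.1 v, ← repCoord_smul_rep p.2 w]
  exact hf.2 _ _ _ _

variable (E F)

/-- The presentation of `(ℙ(E), 𝒪(d))` by homogeneous polynomials. -/
def modelO (a : ℕ) : FormModel (projSpace E) (bundleO E a) where
  Deg := ℕ
  twist := a
  form d f := ∃ F : E → ℂ, IsForm d F ∧ f = fun p => F p.rep
  form_one := ⟨_, IsForm.one, rfl⟩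
  form_mul := by
    rintro d e f g ⟨f, hf, rfl⟩ ⟨g, hg, rfl⟩
    exact ⟨_, hf.mul hg, rfl⟩
  ev := evO E a
  top_eq := by
    have key : ∀ (d : ℕ) (f : E → ℂ), IsForm d f →
        {p : ℙ ℂ E | ∃ v ∈ p.submodule, v ≠ 0 ∧ f v ≠ 0} = {p | f p.rep ≠ 0} := by
      intro d f hf
      ext p
      constructor
      · rintro ⟨v, hv, -, hfv⟩ h0
        rw [hf.apply_eq ⟨v, hv⟩, h0, mul_zero] at hfv
        exact hfv rfl
      · exact fun h => ⟨_, rep_mem_submodule p, p.rep_nonzero, h⟩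
    change TopologicalSpace.generateFrom _ = _
    congr 1
    ext U
    constructor
    · rintro ⟨d, f, hf, rfl⟩
      exact ⟨d, _, ⟨f, hf, rfl⟩, key d f hf⟩
    · rintro ⟨d, _, ⟨f, hf, rfl⟩, rfl⟩
      exact ⟨d, f, hf, (key d f hf).symm⟩
  regular_iff U s := by
    refine forall₂_congr fun p hp => ⟨?_, ?_⟩
    · rintro ⟨d, f, g, hf, hg, hgp, h⟩
      exact ⟨d, _, _, ⟨f, hf, rfl⟩, ⟨g, hg, rfl⟩, hgp _ (rep_mem_submodule p) p.rep_nonzero,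
        fun q hq hgq => h q hq _ (rep_mem_submodule q) q.rep_nonzero hgq⟩
    · rintro ⟨d, _, _, ⟨f, hf, rfl⟩, ⟨g, hg, rfl⟩, hgp, h⟩
      refine ⟨d, f, g, hf, hg, fun v hv h0 => ?_, fun q hq v hv h0 hgv => ?_⟩
      · rw [hg.apply_eq ⟨v, hv⟩]
        exact mul_ne_zero (pow_ne_zero _ (repCoord_ne_zero fun h => h0 (congrArg Subtype.val h)))
          hgp
      · rw [hg.apply_eq ⟨v, hv⟩] at hgv
        rw [hf.apply_eq ⟨v, hv⟩, hg.apply_eq ⟨v, hv⟩,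
          mul_div_mul_left _ _ (left_ne_zero_of_mul hgv)]
        exact h q hq (right_ne_zero_of_mul hgv)
  section_iff U s := by
    refine forall₂_congr fun p hp => ⟨?_, ?_⟩
    · rintro ⟨d, f, g, hf, hg, hgp, h⟩
      exact ⟨d, _, _, ⟨f, hf, rfl⟩, ⟨g, hg, rfl⟩, hgp _ (rep_mem_submodule p) p.rep_nonzero,
        fun q hq hgq => h q hq ⟨_, rep_mem_submodule q⟩
          (fun h => q.rep_nonzero (congrArg Subtype.val h)) hgq⟩
    · rintro ⟨d, _, _, ⟨f, hf, rfl⟩, ⟨g, hg, rfl⟩, hgp, h⟩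
      refine ⟨d, f, g, hf, hg, fun v hv h0 => ?_, fun q hq v h0 hgv => ?_⟩
      · rw [hg.apply_eq ⟨v, hv⟩]
        exact mul_ne_zero (pow_ne_zero _ (repCoord_ne_zero fun h => h0 (congrArg Subtype.val h)))
          hgp
      · rw [hg.apply_eq v] at hgv
        rw [evO_mul, h q hq (right_ne_zero_of_mul hgv), hf.apply_eq v, hg.apply_eq v, pow_add,
          mul_assoc, mul_div_mul_left _ _ (left_ne_zero_of_mul hgv), mul_div_assoc]

/-- The presentation of `(ℙ(E) × ℙ(F), 𝒪(a, b))` by bihomogeneous polynomials. -/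
def modelOO (a b : ℕ) : FormModel (projProd E F) (bundleOO E F a b) where
  Deg := ℕ × ℕ
  twist := (a, b)
  form d f := ∃ f' : E × F → ℂ, IsBiform d.1 d.2 f' ∧ f = fun p => f' (p.1.rep, p.2.rep)
  form_one := ⟨_, IsBiform.one, rfl⟩
  form_mul := by
    rintro d e f g ⟨f, hf, rfl⟩ ⟨g, hg, rfl⟩
    exact ⟨_, hf.mul hg, rfl⟩
  ev := evOO E F a b
  top_eq := by
    have key : ∀ (a b : ℕ) (f : E × F → ℂ), IsBiform a b f →
        {p : ℙ ℂ E × ℙ ℂ F | ∃ v ∈ p.1.submodule, ∃ w ∈ p.2.submodule,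
          v ≠ 0 ∧ w ≠ 0 ∧ f (v, w) ≠ 0} = {p | f (p.1.rep, p.2.rep) ≠ 0} := by
      intro a b f hf
      ext p
      constructor
      · rintro ⟨v, hv, w, hw, -, -, hfv⟩ h0
        rw [hf.apply_eq (p := p) ⟨v, hv⟩ ⟨w, hw⟩, h0, mul_zero] at hfv
        exact hfv rfl
      · exact fun h => ⟨_, rep_mem_submodule _, _, rep_mem_submodule _, p.1.rep_nonzero,
          p.2.rep_nonzero, h⟩
    change TopologicalSpace.generateFrom _ = _
    congr 1
    ext U
    constructor
    · rintro ⟨a, b, f, hf, rfl⟩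
      exact ⟨(a, b), _, ⟨f, hf, rfl⟩, key a b f hf⟩
    · rintro ⟨⟨a, b⟩, _, ⟨f, hf, rfl⟩, rfl⟩
      exact ⟨a, b, f, hf, (key a b f hf).symm⟩
  regular_iff U s := by
    refine forall₂_congr fun p hp => ⟨?_, ?_⟩
    · rintro ⟨a, b, f, g, hf, hg, hgp, h⟩
      exact ⟨(a, b), _, _, ⟨f, hf, rfl⟩, ⟨g, hg, rfl⟩,
        hgp _ (rep_mem_submodule _) _ (rep_mem_submodule _) p.1.rep_nonzero p.2.rep_nonzero,
        fun q hq hgq => h q hq _ (rep_mem_submodule _) _ (rep_mem_submodule _) q.1.rep_nonzero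
          q.2.rep_nonzero hgq⟩
    · rintro ⟨⟨a, b⟩, _, _, ⟨f, hf, rfl⟩, ⟨g, hg, rfl⟩, hgp, h⟩
      refine ⟨a, b, f, g, hf, hg, fun v hv w hw h0 h0' => ?_,
        fun q hq v hv w hw h0 h0' hgv => ?_⟩
      · rw [hg.apply_eq (p := p) ⟨v, hv⟩ ⟨w, hw⟩]
        exact mul_ne_zero (mul_ne_zero
          (pow_ne_zero _ (repCoord_ne_zero fun h => h0 (congrArg Subtype.val h)))
          (pow_ne_zero _ (repCoord_ne_zero fun h => h0' (congrArg Subtype.val h)))) hgp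
      · rw [hg.apply_eq (p := q) ⟨v, hv⟩ ⟨w, hw⟩] at hgv
        rw [hf.apply_eq (p := q) ⟨v, hv⟩ ⟨w, hw⟩, hg.apply_eq (p := q) ⟨v, hv⟩ ⟨w, hw⟩,
          mul_div_mul_left _ _ (left_ne_zero_of_mul hgv)]
        exact h q hq (right_ne_zero_of_mul hgv)
  section_iff U s := by
    refine forall₂_congr fun p hp => ⟨?_, ?_⟩
    · rintro ⟨a, b, f, g, hf, hg, hgp, h⟩
      exact ⟨(a, b), _, _, ⟨f, hf, rfl⟩, ⟨g, hg, rfl⟩,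
        hgp _ (rep_mem_submodule _) _ (rep_mem_submodule _) p.1.rep_nonzero p.2.rep_nonzero,
        fun q hq hgq => h q hq ⟨_, rep_mem_submodule _⟩ ⟨_, rep_mem_submodule _⟩
          (fun h => q.1.rep_nonzero (congrArg Subtype.val h))
          (fun h => q.2.rep_nonzero (congrArg Subtype.val h)) hgq⟩
    · rintro ⟨⟨e, e'⟩, _, _, ⟨f, hf, rfl⟩, ⟨g, hg, rfl⟩, hgp, h⟩
      refine ⟨e, e', f, g, hf, hg, fun v hv w hw h0 h0' => ?_, fun q hq v w h0 h0' hgv => ?_⟩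
      · rw [hg.apply_eq (p := p) ⟨v, hv⟩ ⟨w, hw⟩]
        exact mul_ne_zero (mul_ne_zero
          (pow_ne_zero _ (repCoord_ne_zero fun h => h0 (congrArg Subtype.val h)))
          (pow_ne_zero _ (repCoord_ne_zero fun h => h0' (congrArg Subtype.val h)))) hgp
      · rw [hg.apply_eq (p := q) v w] at hgv
        rw [evOO_mul, h q hq (right_ne_zero_of_mul hgv), hf.apply_eq (p := q) v w,
          hg.apply_eq (p := q) v w, ← mul_div_assoc, ← mul_div_mul_left _ _
            (left_ne_zero_of_mul hgv)]
        congr 1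
        simp only [Prod.fst_add, Prod.snd_add, pow_add]
        ring

end Forms

/-! ### Isomorphisms given by homogeneous parametrisations -/

section Param

variable {E E' F : Type} [AddCommGroup E] [Module ℂ E] [AddCommGroup E'] [Module ℂ E']
  [AddCommGroup F] [Module ℂ F]

/-- The composition of isomorphisms of pairs. -/
def LineBundle.Iso.trans {X Y Z : FunctionSpace} {L : LineBundle X} {M : LineBundle Y}
    {N : LineBundle Z} (α : L.Iso M) (β : M.Iso N) : L.Iso N where
  base :=
    { toEquiv := α.base.toEquiv.trans β.base.toEquiv
      isOpen_iff := fun U => (β.base.isOpen_iff U).trans (α.base.isOpen_iff _)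
      isRegular_iff := fun U hU f => (β.base.isRegular_iff U hU f).trans
        (α.base.isRegular_iff _ ((β.base.isOpen_iff U).1 hU) _) }
  onFiber x := (β.onFiber (α.base.toEquiv x)).trans (α.onFiber x)
  isRegularSection_iff U hU s := (β.isRegularSection_iff U hU s).trans
    (α.isRegularSection_iff _ ((β.base.isOpen_iff U).1 hU)
      fun y => β.onFiber y (s (β.base.toEquiv y)))

/-- A pair agrees with its restriction to the whole space. -/
def FormModel.restrictUniv {X : FunctionSpace} {L : LineBundle X} (M : FormModel X L) :
    (L.restrict Set.univ).Iso L :=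
  FormModel.iso (M.restrict Set.univ) M (Equiv.Set.univ X.Pt) (fun _ _ => 1) (fun _ => 1) id
    (fun _ _ => one_ne_zero) (fun _ => one_ne_zero) (fun _ _ => (mul_one 1).symm) (fun _ => rfl)
    (by
      rintro d _ ⟨f, hf, rfl⟩
      simpa using hf)
    (fun _ => ⟨id, fun _ _ => 1, (0 : M.Deg), fun _ => 1, fun d f hf => ⟨f, hf, by simp⟩,
      fun _ => one_ne_zero, ⟨_, M.form_one, rfl⟩, fun d => congrArg (· + M.twist) (add_zero d).symm,
      fun _ _ => rfl⟩)

theorem mk_eq_iff_submodule {v : E} (hv : v ≠ 0) {p : ℙ ℂ E} :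
    Projectivization.mk ℂ v hv = p ↔ p.submodule = Submodule.span ℂ {v} := by
  rw [← Projectivization.submodule_mk v hv, Projectivization.submodule_injective.eq_iff, eq_comm]

theorem IsForm.comp_hom {a d : ℕ} {ν : E → F}
    (hpoly : ∀ l : Module.Dual ℂ F, (fun v => l (ν v)) ∈ polyFun E)
    (hhom : ∀ (c : ℂ) (v : E), ν (c • v) = c ^ a • ν v) {f : F → ℂ} (hf : IsForm d f) :
    IsForm (a * d) fun v => f (ν v) :=
  ⟨comp_mem_polyFun hpoly hf.1, fun c v => by
    beta_reduce
    rw [hhom, hf.2, pow_mul]⟩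

theorem IsForm.comp_linear {d : ℕ} (σ : F →ₗ[ℂ] E) {f : E → ℂ} (hf : IsForm d f) :
    IsForm d fun v => f (σ v) :=
  ⟨linear_comp_mem_polyFun σ hf.1, fun c v => by
    beta_reduce
    rw [map_smul, hf.2]⟩

theorem IsForm.comp_bihom {d : ℕ} {ν : E × E' → F}
    (hpoly : ∀ l : Module.Dual ℂ F, (fun v => l (ν v)) ∈ polyFun (E × E'))
    (hhom : ∀ (c d : ℂ) (v : E) (w : E'), ν (c • v, d • w) = (c * d) • ν (v, w)) {f : F → ℂ}
    (hf : IsForm d f) : IsBiform d d fun v => f (ν v) :=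
  ⟨comp_mem_polyFun hpoly hf.1, fun k l v w => by
    beta_reduce
    rw [hhom, hf.2, mul_pow]⟩

theorem IsBiform.comp_linear {a b : ℕ} (σ : F →ₗ[ℂ] E × E') {f : E × E' → ℂ}
    (hf : IsBiform a b f) : IsForm (a + b) fun v => f (σ v) :=
  ⟨linear_comp_mem_polyFun σ hf.1, fun c v => by
    beta_reduce
    rw [map_smul]
    exact (hf.2 c c _ _).trans (by rw [← pow_add])⟩

/-- A homogeneous polynomial map `ν` of degree `b + 1` that is inverted, locally on `Z`, by linear
projections identifies `(Z, 𝒪(b + 1))` with `(S, 𝒪(1))`, where `S` is the image of `Z`. -/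
def powerIso (b : ℕ) (ν : E → F) (hpoly : ∀ l : Module.Dual ℂ F, (fun v => l (ν v)) ∈ polyFun E)
    (hhom : ∀ (c : ℂ) (v : E), ν (c • v) = c ^ (b + 1) • ν v) (Z : Set (ℙ ℂ E)) (S : Set (ℙ ℂ F))
    (φ : S ≃ Z) (hφ : ∀ x : S, x.1.submodule = Submodule.span ℂ {ν (φ x).1.rep})
    (inv : ∀ y ∈ Z, ∃ (σ : F →ₗ[ℂ] E) (l : E → ℂ) (u : F → ℂ), l y.rep ≠ 0 ∧ IsForm b u ∧
      ∀ z ∈ Z, σ (ν z.rep) = l z.rep • z.rep ∧ u (ν z.rep) = l z.rep ^ (b + 1)) :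
    ((bundleO F 1).restrict S).Iso ((bundleO E (b + 1)).restrict Z) := by
  -- The chosen representatives need not correspond under `ν`. The scalar `c x` records the
  -- discrepancy, and a form of degree `d` is rescaled by its `d`-th power.
  have hc : ∀ x : S, ∃ c : ℂ, c ≠ 0 ∧ ν (φ x).1.rep = c • x.1.rep := by
    intro x
    have h0 : ν (φ x).1.rep ≠ 0 := by
      intro h0
      have := hφ x
      rw [h0, Submodule.span_zero_singleton] at this
      exact x.1.rep_nonzero ((Submodule.mem_bot ℂ).1 (this ▸ rep_mem_submodule x.1))
    exact exists_smul_rep_of_ne_zero (by rw [hφ x]; exact Submodule.mem_span_singleton_self _) h0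
  choose c hc0 hc using hc
  refine FormModel.iso ((modelO F 1).restrict S) ((modelO E (b + 1)).restrict Z) φ
    (fun (d : ℕ) y => c (φ.symm y) ^ d) (fun y => c (φ.symm y))
    (fun d : ℕ => (b + 1) * d) (fun d y => pow_ne_zero _ (hc0 _)) (fun y => hc0 _)
    (fun d y => pow_succ _ _) (fun d => Nat.mul_succ _ _) ?_ ?_
  · rintro d _ ⟨_, ⟨f, hf, rfl⟩, rfl⟩
    refine ⟨_, ⟨_, hf.comp_hom hpoly hhom, rfl⟩, ?_⟩
    funext y
    have := hc (φ.symm y)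
    rw [φ.apply_symm_apply] at this
    rw [this, hf.2]
  · intro y₀
    obtain ⟨σ, l, u, hl, hu, hσ⟩ := inv y₀.1 y₀.2
    have hσ' : ∀ x : S, σ x.1.rep = (l (φ x).1.rep / c x) • (φ x).1.rep := by
      intro x
      have h1 := (hσ _ (φ x).2).1
      rw [hc, map_smul] at h1
      rw [div_eq_inv_mul, mul_smul, ← h1, inv_smul_smul₀ (hc0 x)]
    refine ⟨id, fun (d : ℕ) x => (l (φ x).1.rep / c x) ^ d, b,
      fun x => u x.1.rep, ?_, fun d => ?_, ⟨_, ⟨u, hu, rfl⟩, rfl⟩, fun d => ?_, fun d x => ?_⟩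
    · rintro d _ ⟨_, ⟨f, hf, rfl⟩, rfl⟩
      refine ⟨_, ⟨_, hf.comp_linear σ, rfl⟩, ?_⟩
      funext x
      rw [hσ', hf.2]
    · refine pow_ne_zero _ (div_ne_zero ?_ (hc0 _))
      simpa using hl
    · exact (Nat.add_assoc d b 1).symm
    · have h2 := (hσ _ (φ x).2).2
      have hcx := hc0 x
      -- Homogeneity of `u` gives `c ^ b * u x.rep = l ^ (b + 1)`, that is `(l / c) ^ (b + 1) * c =
      -- u x.rep`, which is the required compatibility with the twist.
      rw [hc, hu.2] at h2
      revert d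
      intro (d : ℕ)
      change (l (φ x).1.rep / c x) ^ (d + (b + 1)) * c (φ.symm (φ x)) =
        u x.1.rep * (l (φ x).1.rep / c x) ^ d
      rw [φ.symm_apply_apply, pow_add, div_pow _ _ (b + 1), ← h2, pow_succ]
      field_simp

/-- A bihomogeneous map `ν` of bidegree `(1, 1)` that is inverted, locally, by linear
projections identifies `(ℙ(E) × ℙ(E'), 𝒪(1, 1))` with `(S, 𝒪(1))`, where `S` is its image. -/
def segreIso (ν : E × E' → F) (hpoly : ∀ l : Module.Dual ℂ F, (fun v => l (ν v)) ∈ polyFun (E × E'))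
    (hhom : ∀ (c d : ℂ) (v : E) (w : E'), ν (c • v, d • w) = (c * d) • ν (v, w)) (S : Set (ℙ ℂ F))
    (φ : S ≃ ℙ ℂ E × ℙ ℂ E')
    (hφ : ∀ x : S, x.1.submodule = Submodule.span ℂ {ν ((φ x).1.rep, (φ x).2.rep)})
    (inv : ∀ y : ℙ ℂ E × ℙ ℂ E', ∃ (σ : F →ₗ[ℂ] E × E') (α : E → ℂ) (β : E' → ℂ)
      (u : Module.Dual ℂ F), α y.1.rep ≠ 0 ∧ β y.2.rep ≠ 0 ∧
      ∀ v w, σ (ν (v, w)) = (β w • v, α v • w) ∧ u (ν (v, w)) = α v * β w) :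
    ((bundleO F 1).restrict S).Iso (bundleOO E E' 1 1) := by
  have hc : ∀ x : S, ∃ c : ℂ, c ≠ 0 ∧ ν ((φ x).1.rep, (φ x).2.rep) = c • x.1.rep := by
    intro x
    have h0 : ν ((φ x).1.rep, (φ x).2.rep) ≠ 0 := by
      intro h0
      have := hφ x
      rw [h0, Submodule.span_zero_singleton] at this
      exact x.1.rep_nonzero ((Submodule.mem_bot ℂ).1 (this ▸ rep_mem_submodule x.1))
    exact exists_smul_rep_of_ne_zero (by rw [hφ x]; exact Submodule.mem_span_singleton_self _) h0
  choose c hc0 hc using hc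
  refine FormModel.iso ((modelO F 1).restrict S) (modelOO E E' 1 1) φ
    (fun (d : ℕ) y => c (φ.symm y) ^ d) (fun y => c (φ.symm y))
    (fun d : ℕ => (d, d)) (fun d y => pow_ne_zero _ (hc0 _))
    (fun y => hc0 _) (fun d y => pow_succ _ _) (fun d => rfl) ?_ ?_
  · rintro d _ ⟨_, ⟨f, hf, rfl⟩, rfl⟩
    refine ⟨_, hf.comp_bihom hpoly hhom, ?_⟩
    funext y
    have := hc (φ.symm y)
    rw [φ.apply_symm_apply] at this
    rw [this, hf.2]
  · intro y₀
    obtain ⟨σ, α, β, u, hα, hβ, hσ⟩ := inv y₀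
    -- A biform of bidegree (d, e) composed with `σ` therefore acquires the factor `(β / c) ^ d * (α
    -- / c) ^ e`.
    have hσ' : ∀ x : S, σ x.1.rep = ((β (φ x).2.rep / c x) • (φ x).1.rep,
        (α (φ x).1.rep / c x) • (φ x).2.rep) := by
      intro x
      have h1 := (hσ (φ x).1.rep (φ x).2.rep).1
      rw [hc, map_smul] at h1
      rw [div_eq_inv_mul, mul_smul, div_eq_inv_mul, mul_smul, ← Prod.smul_mk, ← h1,
        inv_smul_smul₀ (hc0 x)]
    refine ⟨fun d : ℕ × ℕ => d.1 + d.2,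
      fun (d : ℕ × ℕ) x => (β (φ x).2.rep / c x) ^ d.1 *
        (α (φ x).1.rep / c x) ^ d.2, (1 : ℕ),
      fun x => u x.1.rep, ?_, fun d => ?_, ⟨_, ⟨u, IsForm.dual u, rfl⟩, rfl⟩, ?_, ?_⟩
    · rintro d _ ⟨f, hf, rfl⟩
      refine ⟨_, ⟨_, hf.comp_linear σ, rfl⟩, ?_⟩
      funext x
      rw [hσ', hf.2]
    · refine mul_ne_zero (pow_ne_zero _ (div_ne_zero ?_ (hc0 _)))
        (pow_ne_zero _ (div_ne_zero ?_ (hc0 _)))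
      · simpa using hβ
      · simpa using hα
    · rintro ⟨d, e⟩
      change (d + 1) + (e + 1) = d + e + 1 + 1
      ring
    · rintro ⟨d, e⟩ x
      have h2 := (hσ (φ x).1.rep (φ x).2.rep).2
      have hcx := hc0 x
      rw [hc, map_smul, smul_eq_mul] at h2
      change (β (φ x).2.rep / c x) ^ (d + 1) * (α (φ x).1.rep / c x) ^ (e + 1) *
        c (φ.symm (φ x)) = u x.1.rep * ((β (φ x).2.rep / c x) ^ d * (α (φ x).1.rep / c x) ^ e)
      rw [φ.symm_apply_apply, pow_succ, pow_succ]
      generalize (β (φ x).2.rep / c x) ^ d = P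
      generalize (α (φ x).1.rep / c x) ^ e = Q
      field_simp
      linear_combination (-P * Q) * h2

end Param

/-! ### Irreducible components -/

section Components

variable {X : FunctionSpace}

theorem subset_of_mem_components {S Y : Set X.Pt} (h : Y ∈ X.components S) : Y ⊆ S :=
  h.1.1

theorem isIrreducible_of_mem_components {S Y : Set X.Pt} (h : Y ∈ X.components S) :
    @IsIrreducible X.Pt X.top Y :=
  h.1.2

theorem subset_of_components_subset {S Y T : Set X.Pt} (h : Y ∈ X.components S) (hT : T ⊆ S)
    (hTi : @IsIrreducible X.Pt X.top T) (hYT : Y ⊆ T) : T ⊆ Y :=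
  h.2 ⟨hT, hTi⟩ hYT

theorem components_of_isIrreducible {S : Set X.Pt} (hS : @IsIrreducible X.Pt X.top S) :
    X.components S = {S} := by
  ext Y
  constructor
  · intro h
    exact (subset_of_mem_components h).antisymm
      (subset_of_components_subset h le_rfl hS (subset_of_mem_components h))
  · rintro rfl
    exact ⟨⟨le_rfl, hS⟩, fun T hT _ => hT.1⟩

theorem components_empty : X.components ∅ = ∅ := by
  ext Y
  constructor
  · intro h
    exact absurd ((isIrreducible_of_mem_components h).1.mono (subset_of_mem_components h))
      Set.not_nonempty_empty
  · exact fun h => h.elim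

theorem components_singleton (x : X.Pt) : X.components {x} = {{x}} :=
  components_of_isIrreducible (@isIrreducible_singleton X.Pt X.top x)

theorem exists_subset_of_isIrreducible {ι : Type*} {I : Set ι} (hI : I.Finite)
    {C : ι → Set X.Pt} (hC : ∀ i ∈ I, IsClosed[X.top] (C i)) {T : Set X.Pt}
    (hT : @IsIrreducible X.Pt X.top T) (hTC : T ⊆ ⋃ i ∈ I, C i) : ∃ i ∈ I, T ⊆ C i := by
  let := X.top
  obtain ⟨z, hz, hTz⟩ := (isIrreducible_iff_sUnion_isClosed.1 hT) (hI.image C).toFinset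
    (by
      intro z hz
      obtain ⟨i, hi, rfl⟩ := (Set.Finite.mem_toFinset _).1 hz
      exact hC i hi)
    (by
      intro x hx
      obtain ⟨i, hi, hxi⟩ := Set.mem_iUnion₂.1 (hTC hx)
      exact ⟨C i, by simpa using ⟨i, hi, rfl⟩, hxi⟩)
  obtain ⟨i, hi, rfl⟩ := (Set.Finite.mem_toFinset _).1 hz
  exact ⟨i, hi, hTz⟩

/-- If an irreducible subset of a set lies in one of the pieces of a partition, the components of
the set contained in a piece are the components of that piece. -/
theorem components_of_piece {ι : Type*} {A : Set X.Pt} {P : ι → Set X.Pt} (hPA : ∀ i, P i ⊆ A)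
    (hdisj : ∀ i j x, x ∈ P i → x ∈ P j → i = j)
    (hirr : ∀ T, T ⊆ A → @IsIrreducible X.Pt X.top T → ∃ i, T ⊆ P i) (i : ι) :
    X.components (P i) = {Y ∈ X.components A | Y ⊆ P i} := by
  ext Y
  constructor
  · intro hY
    have hYi := subset_of_mem_components hY
    have hYirr := isIrreducible_of_mem_components hY
    refine ⟨⟨⟨hYi.trans (hPA i), hYirr⟩, fun T hT hYT => ?_⟩, hYi⟩
    obtain ⟨j, hj⟩ := hirr T hT.1 hT.2
    obtain ⟨y, hy⟩ := hYirr.1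
    obtain rfl := hdisj i j y (hYi hy) (hj (hYT hy))
    exact subset_of_components_subset hY hj hT.2 hYT
  · rintro ⟨hY, hYi⟩
    exact ⟨⟨hYi, isIrreducible_of_mem_components hY⟩, fun T hT hYT =>
      subset_of_components_subset hY (hT.1.trans (hPA i)) hT.2 hYT⟩

/-- An irreducible subset of the union lies in one of the closed sets `C₁`, `C₂`, hence in `S₁` or
`S₂`. Closedness of `S₁` and `S₂` themselves is not needed. -/
theorem components_union {S₁ S₂ C₁ C₂ : Set X.Pt} (hC₁ : IsClosed[X.top] C₁)
    (hC₂ : IsClosed[X.top] C₂) (h₁ : S₁ ⊆ C₁) (h₂ : S₂ ⊆ C₂) (h₁₂ : ∀ x ∈ S₁, x ∉ C₂)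
    (h₂₁ : ∀ x ∈ S₂, x ∉ C₁) :
    X.components (S₁ ∪ S₂) = X.components S₁ ∪ X.components S₂ := by
  have hirr : ∀ T, T ⊆ S₁ ∪ S₂ → @IsIrreducible X.Pt X.top T →
      ∃ b : Bool, T ⊆ (fun b : Bool => cond b S₁ S₂) b := by
    intro T hT hTi
    obtain ⟨b, -, hb⟩ := exists_subset_of_isIrreducible (Set.toFinite (Set.univ : Set Bool))
      (C := fun b => cond b C₁ C₂) (by rintro (_ | _) - <;> assumption) hTi
      (by
        intro x hx
        rcases hT hx with h | h
        · exact Set.mem_iUnion₂.2 ⟨true, trivial, h₁ h⟩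
        · exact Set.mem_iUnion₂.2 ⟨false, trivial, h₂ h⟩)
    refine ⟨b, fun x hx => ?_⟩
    cases b
    · exact (hT hx).resolve_left fun h => h₁₂ x h (hb hx)
    · exact (hT hx).resolve_right fun h => h₂₁ x h (hb hx)
  have key := components_of_piece (X := X) (A := S₁ ∪ S₂) (P := fun b : Bool => cond b S₁ S₂)
    (by
      rintro (_ | _)
      · exact Set.subset_union_right
      · exact Set.subset_union_left)
    (by
      rintro (_ | _) (_ | _) x hx hx'
      · rfl
      · exact (h₂₁ x hx (h₁ hx')).elim
      · exact (h₁₂ x hx (h₂ hx')).elim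
      · rfl) hirr
  have k1 := key true
  have k2 := key false
  simp only [cond_true, cond_false] at k1 k2
  rw [k1, k2]
  ext Y
  constructor
  · intro hY
    obtain ⟨b, hb⟩ := hirr Y (subset_of_mem_components hY)
      (isIrreducible_of_mem_components hY)
    cases b
    · exact Or.inr ⟨hY, hb⟩
    · exact Or.inl ⟨hY, hb⟩
  · rintro (h | h) <;> exact h.1

end Components

/-! ### Closed linear subspaces and rational curves in projective space -/

section Curves

variable {E F K : Type} [AddCommGroup E] [Module ℂ E] [AddCommGroup F] [Module ℂ F]
  [AddCommGroup K] [Module ℂ K]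

/-- A vector outside `Y` is detected by a linear form vanishing on `Y`, which is a form of degree 1.
-/
theorem isClosed_le_submodule (Y : Submodule ℂ E) :
    IsClosed[(projSpace E).top] {p : ℙ ℂ E | p.submodule ≤ Y} := by
  let := (projSpace E).top
  refine ⟨((modelO E 1).isOpen_iff).2 fun p hp => ?_⟩
  have hp' : p.rep ∉ Y := by
    intro h
    apply hp
    change p.submodule ≤ Y
    rw [p.submodule_eq]
    exact (Submodule.span_singleton_le_iff_mem _ _).2 h
  obtain ⟨l, hl, hlY⟩ := Submodule.exists_le_ker_of_notMem hp'
  refine ⟨(1 : ℕ), _, ⟨l, IsForm.dual l, rfl⟩, hl, fun q hq hqY => hq ?_⟩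
  exact hlY (hqY (rep_mem_submodule q))

theorem isClosed_singleton (p : ℙ ℂ E) : IsClosed[(projSpace E).top] {p} := by
  have h := isClosed_le_submodule p.submodule
  have h2 : {q : ℙ ℂ E | q.submodule ≤ p.submodule} = {p} := by
    ext q
    constructor
    · intro hq
      exact Projectivization.submodule_injective (Submodule.eq_of_le_of_finrank_eq hq
        (by rw [Projectivization.finrank_submodule, Projectivization.finrank_submodule]))
    · rintro rfl
      exact le_refl q.submodule
  rwa [h2] at h

/-- Polynomial maps from the affine line to a vector space. -/
inductive IsPolyCurve : (ℂ → E) → Prop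
  | const (v : E) : IsPolyCurve fun _ => v
  | add {γ δ : ℂ → E} : IsPolyCurve γ → IsPolyCurve δ → IsPolyCurve fun t => γ t + δ t
  | shift {γ : ℂ → E} : IsPolyCurve γ → IsPolyCurve fun t => t • γ t

namespace IsPolyCurve

theorem linear {γ : ℂ → E} (h : IsPolyCurve γ) (l : E →ₗ[ℂ] F) :
    IsPolyCurve fun t => l (γ t) := by
  induction h with
  | const v => exact const _
  | add _ _ h1 h2 =>
    simp only [map_add]
    exact add h1 h2
  | shift _ h =>
    simp only [map_smul]
    exact shift h

theorem bilinear {γ : ℂ → E} {δ : ℂ → F} (h : IsPolyCurve γ) (h' : IsPolyCurve δ)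
    (B : E →ₗ[ℂ] F →ₗ[ℂ] K) : IsPolyCurve fun t => B (γ t) (δ t) := by
  induction h with
  | const v => exact h'.linear (B v)
  | add _ _ h1 h2 =>
    simp only [map_add, LinearMap.add_apply]
    exact add h1 h2
  | shift _ h =>
    simp only [map_smul, LinearMap.smul_apply]
    exact shift h

theorem smul {p : ℂ → ℂ} {γ : ℂ → E} (hp : IsPolyCurve p) (h : IsPolyCurve γ) :
    IsPolyCurve fun t => p t • γ t :=
  hp.bilinear h (LinearMap.lsmul ℂ E)

theorem mul {p q : ℂ → ℂ} (hp : IsPolyCurve p) (hq : IsPolyCurve q) :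
    IsPolyCurve fun t => p t * q t :=
  hp.smul hq

theorem id : IsPolyCurve fun t : ℂ => t := by
  simpa using shift (const (1 : ℂ))

theorem neg {γ : ℂ → E} (h : IsPolyCurve γ) : IsPolyCurve fun t => -γ t :=
  h.linear (-LinearMap.id)

theorem sub {γ δ : ℂ → E} (h : IsPolyCurve γ) (h' : IsPolyCurve δ) :
    IsPolyCurve fun t => γ t - δ t := by
  simpa only [sub_eq_add_neg] using add h h'.neg

theorem exists_polynomial {p : ℂ → ℂ} (h : IsPolyCurve p) :
    ∃ P : Polynomial ℂ, ∀ t, p t = P.eval t := by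
  induction h with
  | const v => exact ⟨Polynomial.C v, by simp⟩
  | add _ _ h1 h2 =>
    obtain ⟨P, hP⟩ := h1
    obtain ⟨Q, hQ⟩ := h2
    exact ⟨P + Q, by simp [hP, hQ]⟩
  | shift _ h =>
    obtain ⟨P, hP⟩ := h
    exact ⟨Polynomial.X * P, by simp [hP]⟩

theorem polyFun_comp {γ : ℂ → E} (h : IsPolyCurve γ) {f : E → ℂ} (hf : f ∈ polyFun E) :
    IsPolyCurve fun t => f (γ t) := by
  induction hf using Algebra.adjoin_induction with
  | mem x hx =>
    obtain ⟨l, rfl⟩ := hx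
    exact h.linear l
  | algebraMap r => exact const r
  | add x y _ _ hx hy => exact add hx hy
  | mul x y _ _ hx hy => exact mul hx hy

/-- This is the irreducibility of the affine line: a product of nonzero polynomials over an infinite
field has a point where it does not vanish. -/
theorem exists_ne_zero {p q : ℂ → ℂ} (hp : IsPolyCurve p) (hq : IsPolyCurve q) {a b : ℂ}
    (ha : p a ≠ 0) (hb : q b ≠ 0) : ∃ t, p t * q t ≠ 0 := by
  by_contra! h
  obtain ⟨P, hP⟩ := hp.exists_polynomial
  obtain ⟨Q, hQ⟩ := hq.exists_polynomial
  have : P * Q = 0 := Polynomial.funext fun t => by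
    rw [Polynomial.eval_mul, ← hP, ← hQ, h, Polynomial.eval_zero]
  rcases mul_eq_zero.1 this with h0 | h0
  · exact ha (by rw [hP, h0, Polynomial.eval_zero])
  · exact hb (by rw [hQ, h0, Polynomial.eval_zero])

end IsPolyCurve

/-- A subset of projective space is irreducible if any two of its points lie on a rational curve
contained in it. -/
theorem isIrreducible_of_curves {Z : Set (ℙ ℂ E)} (hne : Z.Nonempty)
    (h : ∀ p ∈ Z, ∀ q ∈ Z, ∃ γ : ℂ → E, IsPolyCurve γ ∧ γ 0 ≠ 0 ∧ γ 0 ∈ p.submodule ∧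
      γ 1 ≠ 0 ∧ γ 1 ∈ q.submodule ∧ ∀ t (ht : γ t ≠ 0), Projectivization.mk ℂ (γ t) ht ∈ Z) :
    @IsIrreducible (ℙ ℂ E) (projSpace E).top Z := by
  let := (projSpace E).top
  refine ⟨hne, ?_⟩
  rintro U W hU hW ⟨p, hpZ, hpU⟩ ⟨q, hqZ, hqW⟩
  obtain ⟨γ, hγ, h0, h0p, h1, h1q, hγZ⟩ := h p hpZ q hqZ
  obtain ⟨d, _, ⟨f, hf, rfl⟩, hfp, hfU⟩ := (modelO E 1).exists_form_of_isOpen hU hpU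
  obtain ⟨e, _, ⟨g, hg, rfl⟩, hgq, hgW⟩ := (modelO E 1).exists_form_of_isOpen hW hqW
  have hrep : ∀ {d : ℕ} {f : E → ℂ}, IsForm d f → ∀ {p : ℙ ℂ E} {v : E}, v ∈ p.submodule →
      v ≠ 0 → (f v ≠ 0 ↔ f p.rep ≠ 0) := by
    intro d f hf p v hv hv0
    obtain ⟨c, hc, rfl⟩ := exists_smul_rep_of_ne_zero hv hv0
    rw [hf.2, mul_ne_zero_iff, and_iff_right (pow_ne_zero _ hc)]
  -- A form of degree 0 does not vanish at the origin, so `f` and `g` alone do not force `γ t ≠ 0`;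
  -- the extra factor `l` does.
  obtain ⟨l, hl⟩ : ∃ l : Module.Dual ℂ E, l (γ 0) ≠ 0 := by
    by_contra! hl
    exact h0 ((Module.forall_dual_apply_eq_zero_iff ℂ _).1 hl)
  obtain ⟨t, ht⟩ := ((hγ.polyFun_comp hf.1).mul (hγ.linear l)).exists_ne_zero
    (hγ.polyFun_comp hg.1) (a := 0) (b := 1) (mul_ne_zero ((hrep hf h0p h0).2 hfp) hl)
    ((hrep hg h1q h1).2 hgq)
  have ht0 : γ t ≠ 0 := by
    intro h
    simp [h] at ht
  have hmem : γ t ∈ (Projectivization.mk ℂ (γ t) ht0).submodule := by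
    rw [Projectivization.submodule_mk]
    exact Submodule.mem_span_singleton_self _
  refine ⟨_, hγZ t ht0, hfU _ ?_, hgW _ ?_⟩
  · exact (hrep hf hmem ht0).1 (left_ne_zero_of_mul (left_ne_zero_of_mul ht))
  · exact (hrep hg hmem ht0).1 (right_ne_zero_of_mul ht)

end Curves

/-! ### The exterior square and lines on quadrics -/

section Wedge

variable {E F : Type} [AddCommGroup E] [Module ℂ E] [AddCommGroup F] [Module ℂ F]

theorem update_pair_zero {α : Type} (u v x : α) : Function.update ![u, v] 0 x = ![x, v] := by
  ext i
  fin_cases i <;> simp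

theorem update_pair_one {α : Type} (u v x : α) : Function.update ![u, v] 1 x = ![u, x] := by
  ext i
  fin_cases i <;> simp

variable (E) in
/-- The wedge product of two vectors, as a bilinear map. -/
def wedge : E →ₗ[ℂ] E →ₗ[ℂ] ⋀[ℂ]^2 E :=
  LinearMap.mk₂ ℂ (fun u v => exteriorPower.ιMulti ℂ 2 ![u, v])
    (fun u u' v => by
      simpa only [update_pair_zero] using
        (exteriorPower.ιMulti ℂ 2 (M := E)).map_update_add ![u, v] 0 u u')
    (fun c u v => by
      simpa only [update_pair_zero] using
        (exteriorPower.ιMulti ℂ 2 (M := E)).map_update_smul ![u, v] 0 c u)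
    (fun u v v' => by
      simpa only [update_pair_one] using
        (exteriorPower.ιMulti ℂ 2 (M := E)).map_update_add ![u, v] 1 v v')
    (fun c u v => by
      simpa only [update_pair_one] using
        (exteriorPower.ιMulti ℂ 2 (M := E)).map_update_smul ![u, v] 1 c v)

theorem wedge_apply (u v : E) : wedge E u v = exteriorPower.ιMulti ℂ 2 ![u, v] := rfl

theorem wedge_self (u : E) : wedge E u u = 0 :=
  (exteriorPower.ιMulti ℂ 2 (M := E)).map_eq_zero_of_eq ![u, u] (i := 0) (j := 1) rfl (by simp)

theorem wedge_swap (u v : E) : wedge E v u = -wedge E u v := by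
  have h := wedge_self (u + v)
  simp only [map_add, LinearMap.add_apply, wedge_self, zero_add, add_zero] at h
  exact eq_neg_of_add_eq_zero_left h

theorem wedge_combination (a b c d : ℂ) (u v : E) :
    wedge E (a • u + b • v) (c • u + d • v) = (a * d - b * c) • wedge E u v := by
  simp only [map_add, map_smul, LinearMap.add_apply, LinearMap.smul_apply, wedge_self,
    wedge_swap u v, smul_zero, zero_add, add_zero, smul_neg, smul_smul]
  module

theorem map_wedge (f : E →ₗ[ℂ] F) (u v : E) :
    exteriorPower.map 2 f (wedge E u v) = wedge F (f u) (f v) := by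
  rw [wedge_apply, wedge_apply, exteriorPower.map_apply_ιMulti]
  congr 1
  ext i
  fin_cases i <;> rfl

/-- The linear form `u ∧ v ↦ α u * β v - α v * β u`. -/
def wedgeDual (α β : Module.Dual ℂ E) : Module.Dual ℂ (⋀[ℂ]^2 E) :=
  exteriorPower.pairingDual ℂ E 2 (exteriorPower.ιMulti ℂ 2 ![α, β])

theorem wedgeDual_wedge (α β : Module.Dual ℂ E) (u v : E) :
    wedgeDual α β (wedge E u v) = α u * β v - α v * β u := by
  rw [wedgeDual, wedge_apply, exteriorPower.pairingDual_ιMulti_ιMulti, Matrix.det_fin_two]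
  simp [mul_comm]

theorem wedge_ne_zero_of_duals {u v : E} {α β : Module.Dual ℂ E}
    (h : α u * β v - α v * β u ≠ 0) : wedge E u v ≠ 0 := by
  intro h0
  rw [← wedgeDual_wedge, h0, map_zero] at h
  exact h rfl

theorem exists_duals_of_linearIndependent {u v : E} (h : LinearIndependent ℂ ![u, v]) :
    ∃ α : Module.Dual ℂ E, α u = 1 ∧ α v = 0 := by
  have hu : u ∉ Submodule.span ℂ {v} := by
    intro hu
    obtain ⟨c, rfl⟩ := Submodule.mem_span_singleton.1 hu
    have := LinearIndependent.pair_iff.1 h 1 (-c) (by simp)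
    exact one_ne_zero this.1
  obtain ⟨l, hl, hlv⟩ := Submodule.exists_le_ker_of_notMem hu
  refine ⟨(l u)⁻¹ • l, by simp [hl], ?_⟩
  have : l v = 0 := hlv (Submodule.mem_span_singleton_self v)
  simp [this]

theorem wedge_ne_zero_iff {u v : E} : wedge E u v ≠ 0 ↔ LinearIndependent ℂ ![u, v] := by
  constructor
  · intro h
    rw [LinearIndependent.pair_iff]
    intro s t hst
    by_contra hne
    rw [not_and_or] at hne
    have h1 : s • wedge E u v = 0 := by
      have := congrArg (fun x => wedge E x v) hst
      simpa [wedge_self] using this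
    have h2 : t • wedge E u v = 0 := by
      have := congrArg (wedge E u) hst
      simpa [wedge_self] using this
    rcases hne with hs | ht
    · exact h ((smul_eq_zero.1 h1).resolve_left hs)
    · exact h ((smul_eq_zero.1 h2).resolve_left ht)
  · intro h
    obtain ⟨α, h1, h2⟩ := exists_duals_of_linearIndependent h
    obtain ⟨β, h3, h4⟩ := exists_duals_of_linearIndependent
      (LinearIndependent.pair_symm_iff.1 h)
    exact wedge_ne_zero_of_duals (α := α) (β := β) (by simp [h1, h2, h3, h4])

/-- A nonzero decomposable bivector determines the plane it comes from. -/
theorem mem_span_pair_of_wedge {a b u v : E} (h0 : wedge E a b ≠ 0)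
    (h : wedge E a b ∈ Submodule.span ℂ {wedge E u v}) : a ∈ Submodule.span ℂ {u, v} := by
  by_contra ha
  obtain ⟨α, hα, hαuv⟩ := Submodule.exists_le_ker_of_notMem ha
  have hu : α u = 0 := hαuv (Submodule.subset_span (by simp))
  have hv : α v = 0 := hαuv (Submodule.subset_span (by simp))
  obtain ⟨c, hc⟩ := Submodule.mem_span_singleton.1 h
  have hind := wedge_ne_zero_iff.1 h0
  -- With `β b = 1` and `β a = 0`, the form `wedgeDual α β` takes the value `α a` on a ∧ b and
  -- vanishes on u ∧ v, since `α` kills both `u` and `v`.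
  obtain ⟨β, h3, h4⟩ := exists_duals_of_linearIndependent (LinearIndependent.pair_symm_iff.1 hind)
  have key := congrArg (wedgeDual α β) hc
  rw [map_smul, wedgeDual_wedge, wedgeDual_wedge, hu, hv, h3, h4] at key
  simp only [zero_mul, sub_zero, smul_zero, mul_one, mul_zero] at key
  exact hα key.symm

/-- ⋀²W is generated by wedges, and a wedge of two combinations of `u` and `v` is a 2×2 determinant
times u ∧ v. -/
theorem range_map_subtype {W : Submodule ℂ E} {u v : E} (h : W = Submodule.span ℂ {u, v}) :
    LinearMap.range (exteriorPower.map 2 W.subtype) = Submodule.span ℂ {wedge E u v} := by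
  apply le_antisymm
  · rw [LinearMap.range_eq_map, ← exteriorPower.ιMulti_span, Submodule.map_span_le]
    rintro _ ⟨a, rfl⟩
    have hW : ∀ x : W, ∃ p q : ℂ, p • u + q • v = x := fun x =>
      Submodule.mem_span_pair.1 (h.le x.2)
    obtain ⟨p, q, hpq⟩ := hW (a 0)
    obtain ⟨r, s, hrs⟩ := hW (a 1)
    have : exteriorPower.map 2 W.subtype (exteriorPower.ιMulti ℂ 2 a) =
        wedge E (a 0 : E) (a 1 : E) := by
      rw [exteriorPower.map_apply_ιMulti, wedge_apply]
      congr 1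
      ext i
      fin_cases i <;> rfl
    rw [this, ← hpq, ← hrs, wedge_combination]
    exact Submodule.smul_mem _ _ (Submodule.mem_span_singleton_self _)
  · rw [Submodule.span_singleton_le_iff_mem]
    have hu : u ∈ W := h ▸ Submodule.subset_span (by simp)
    have hv : v ∈ W := h ▸ Submodule.subset_span (by simp)
    exact ⟨wedge W ⟨u, hu⟩ ⟨v, hv⟩, map_wedge _ _ _⟩

/-- Replaces planes by spanning pairs, the form in which all later computations are done. The value
`q 0` matters because the zero combination is not a point of projective space. -/
theorem mem_linesIn_quadric {q : E → ℂ} (hq : q 0 = 0) {ω : ℙ ℂ (⋀[ℂ]^2 E)} :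
    ω ∈ linesIn (quadric q) ↔ ∃ u v, wedge E u v ≠ 0 ∧
      ω.submodule = Submodule.span ℂ {wedge E u v} ∧ ∀ a b : ℂ, q (a • u + b • v) = 0 := by
  constructor
  · rintro ⟨W, hW, hZ, hω⟩
    have : FiniteDimensional ℂ W := Module.finite_of_finrank_eq_succ hW
    let B := Module.finBasisOfFinrankEq ℂ W hW
    have hB : W = Submodule.span ℂ {(B 0 : E), (B 1 : E)} := by
      have h1 := congrArg (Submodule.map W.subtype) B.span_eq
      rw [Submodule.map_top, Submodule.range_subtype, Submodule.map_span] at h1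
      refine h1.symm.trans (congrArg _ ?_)
      ext x
      simp [Fin.exists_fin_two, eq_comm]
    refine ⟨B 0, B 1, ?_, hω.trans (range_map_subtype hB), fun a b => ?_⟩
    · rw [wedge_ne_zero_iff]
      have := B.linearIndependent.map' W.subtype (Submodule.ker_subtype W)
      have h2 : ![(B 0 : E), (B 1 : E)] = W.subtype ∘ B := by
        ext i
        fin_cases i <;> rfl
      rwa [h2]
    · by_cases h0 : a • (B 0 : E) + b • (B 1 : E) = 0
      · rw [h0, hq]
      · refine hZ (Projectivization.mk ℂ _ h0) ?_ _ ?_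
        · rw [Projectivization.submodule_mk, Submodule.span_singleton_le_iff_mem]
          exact W.add_mem (W.smul_mem _ (B 0).2) (W.smul_mem _ (B 1).2)
        · rw [Projectivization.submodule_mk]
          exact Submodule.mem_span_singleton_self _
  · rintro ⟨u, v, h0, hω, hq⟩
    refine ⟨Submodule.span ℂ {u, v}, ?_, fun p hp x hx => ?_, hω.trans (range_map_subtype rfl).symm⟩
    · have := finrank_span_eq_card (wedge_ne_zero_iff.1 h0)
      rwa [Matrix.range_cons_cons_empty, Fintype.card_fin] at this
    · obtain ⟨a, b, rfl⟩ := Submodule.mem_span_pair.1 (hp hx)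
      exact hq a b

end Wedge

/-! ### Irreducibility of quadrics and of their Grassmannians of lines -/

section Quadrics

variable {E : Type} [AddCommGroup E] [Module ℂ E]
  {B : LinearMap.BilinForm ℂ E}

/-- If `q` vanished on all of `U`^⊥, polarisation would give `U`^⊥ ≤ `U`^⊥⊥ = `U`. The intersection
of `U` and `U`^⊥ would then be `U`^⊥, of dimension dim `E` - dim `U`, against the hypothesis. -/
theorem exists_orthogonal_not_isotropic [FiniteDimensional ℂ E] (hB : B.Nondegenerate)
    (hs : ∀ x y, B x y = B y x)
    (U : Submodule ℂ E)
    (hU : Module.finrank ℂ (U ⊓ B.orthogonal U : Submodule ℂ E) + Module.finrank ℂ U <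
      Module.finrank ℂ E) : ∃ r, (∀ u ∈ U, B u r = 0) ∧ B r r ≠ 0 := by
  by_contra! h
  have hrefl : B.IsRefl := fun x y hxy => (hs y x).trans hxy
  have h1 : B.orthogonal U ≤ B.orthogonal (B.orthogonal U) := by
    intro x hx y hy
    have hxy := h (x + y) fun u hu => by
      rw [map_add, hx u hu, hy u hu, add_zero]
    have hx' := h x hx
    have hy' := h y hy
    simp only [map_add, LinearMap.add_apply, hx', hy', zero_add, add_zero, hs x y] at hxy
    change B y x = 0
    linear_combination hxy / 2
  rw [LinearMap.BilinForm.orthogonal_orthogonal hB hrefl] at h1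
  have h2 := LinearMap.BilinForm.finrank_orthogonal hB U
  rw [inf_eq_right.2 h1] at hU
  omega

theorem mem_quadric_iff_rep {p : ℙ ℂ E} :
    p ∈ quadric (fun v => B v v) ↔ B p.rep p.rep = 0 := by
  constructor
  · exact fun h => h _ (rep_mem_submodule p)
  · intro h v hv
    obtain ⟨c, rfl⟩ := exists_smul_rep hv
    simp [h]

theorem mk_mem_quadric_iff {v : E} (hv : v ≠ 0) :
    Projectivization.mk ℂ v hv ∈ quadric (fun v => B v v) ↔ B v v = 0 := by
  have hmem : v ∈ (Projectivization.mk ℂ v hv).submodule := by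
    rw [Projectivization.submodule_mk]
    exact Submodule.mem_span_singleton_self _
  constructor
  · exact fun h => h v hmem
  · intro h w hw
    rw [Projectivization.submodule_mk] at hw
    obtain ⟨c, rfl⟩ := Submodule.mem_span_singleton.1 hw
    simp [h]

theorem isPolyCurve_one_sub : IsPolyCurve fun t : ℂ => 1 - t :=
  (IsPolyCurve.const 1).sub IsPolyCurve.id

theorem IsPolyCurve.smul_const {p : ℂ → ℂ} (hp : IsPolyCurve p) (v : E) :
    IsPolyCurve fun t => p t • v :=
  hp.smul (.const v)

/-- A quadric of positive dimension is irreducible. -/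
theorem isIrreducible_quadric [FiniteDimensional ℂ E] (hB : B.Nondegenerate)
    (hs : ∀ x y, B x y = B y x)
    (hn : 3 ≤ Module.finrank ℂ E) (hne : (quadric fun v => B v v).Nonempty) :
    @IsIrreducible (ℙ ℂ E) (projSpace E).top (quadric fun v => B v v) := by
  refine isIrreducible_of_curves hne fun p hp q hq => ?_
  rw [mem_quadric_iff_rep] at hp hq
  have hp0 := p.rep_nonzero
  have hq0 := q.rep_nonzero
  have hpm := rep_mem_submodule p
  have hqm := rep_mem_submodule q
  generalize p.rep = u at *
  generalize q.rep = v at *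
  by_cases huv : B u v = 0
  -- Orthogonal isotropic vectors span an isotropic line, which joins the two points.
  · refine ⟨fun t => (1 - t) • u + t • v, (isPolyCurve_one_sub.smul_const _).add
      (IsPolyCurve.id.smul_const _), by simpa, by simpa, by simpa, by simpa, fun t ht => ?_⟩
    rw [mk_mem_quadric_iff]
    simp [hp, hq, huv, hs v u]
  · obtain ⟨r, hr, hrr⟩ := exists_orthogonal_not_isotropic hB hs (Submodule.span ℂ {u, v}) (by
      have h1 : Submodule.span ℂ {u, v} ⊓ B.orthogonal (Submodule.span ℂ {u, v}) = ⊥ := by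
        rw [eq_bot_iff]
        rintro x ⟨hx, hxo⟩
        obtain ⟨a, b, rfl⟩ := Submodule.mem_span_pair.1 hx
        have h1 : B u (a • u + b • v) = 0 := hxo u (Submodule.subset_span (by simp))
        have h2 : B v (a • u + b • v) = 0 := hxo v (Submodule.subset_span (by simp))
        simp only [map_add, map_smul, hp, hq, hs v u, smul_eq_mul, mul_zero, zero_add, add_zero,
          mul_eq_zero, huv, or_false] at h1 h2
        simp [h1, h2]
      have h2 : Module.finrank ℂ (Submodule.span ℂ {u, v}) ≤ 2 := by
        have := finrank_range_le_card (R := ℂ) ![u, v]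
        rwa [Set.finrank, Matrix.range_cons_cons_empty, Fintype.card_fin] at this
      rw [h1, finrank_bot]
      omega)
    have hur : B u r = 0 := hr u (Submodule.subset_span (by simp))
    have hvr : B v r = 0 := hr v (Submodule.subset_span (by simp))
    -- A parametrisation of the conic cut out by the plane of `u`, `r`, `v`. With coefficient -t²k
    -- at `v` the form takes the value t²(1 - t)²(B r r - 2k B u v), which determines k. The
    -- endpoint at t = 1 is a nonzero multiple of `v` because `r` is not isotropic.
    refine ⟨fun t => ((1 - t) * (1 - t)) • u + (t * (1 - t)) • r -
      (t * t) • (B r r / (2 * B u v)) • v, ?_, by simpa, by simpa, ?_, ?_, fun t ht => ?_⟩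
    · exact (((isPolyCurve_one_sub.mul isPolyCurve_one_sub).smul_const _).add
        ((IsPolyCurve.id.mul isPolyCurve_one_sub).smul_const _)).sub
        ((IsPolyCurve.id.mul IsPolyCurve.id).smul_const _)
    · simp [hrr, huv, hq0]
    · simpa using Submodule.smul_mem _ _ hqm
    · rw [mk_mem_quadric_iff]
      simp only [map_add, map_sub, map_smul, LinearMap.add_apply, LinearMap.sub_apply,
        LinearMap.smul_apply, smul_eq_mul, hp, hq, hur, hvr, hs v u, hs r u, hs r v]
      field_simp
      ring

theorem exists_complement {x y : ℂ} (h : ¬(x = 0 ∧ y = 0)) : ∃ z w : ℂ, x * w - y * z = 1 := by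
  by_cases hx : x = 0
  · have hy : y ≠ 0 := fun hy => h ⟨hx, hy⟩
    exact ⟨-y⁻¹, 0, by simp [hy]⟩
  · exact ⟨0, x⁻¹, by simp [hx]⟩

/-- Two isotropic planes whose pairing is degenerate are joined by a curve of isotropic planes. -/
theorem exists_curve_of_degenerate [FiniteDimensional ℂ E] (hB : B.Nondegenerate)
    (hs : ∀ x y, B x y = B y x)
    (hn : 5 ≤ Module.finrank ℂ E) {u₁ u₂ v₁ v₂ : E} (hu₁ : B u₁ u₁ = 0) (hu₁₂ : B u₁ u₂ = 0)
    (hu₂ : B u₂ u₂ = 0) (hv₁ : B v₁ v₁ = 0) (hv₁₂ : B v₁ v₂ = 0) (hv₂ : B v₂ v₂ = 0)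
    (h₁₁ : B u₁ v₁ = 0) (h₁₂ : B u₁ v₂ = 0) (h₂₁ : B u₂ v₁ = 0) (hv0 : v₁ ≠ 0) :
    ∃ a b : ℂ → E, ∃ c : ℂ, IsPolyCurve a ∧ IsPolyCurve b ∧ c ≠ 0 ∧
      wedge E (a 0) (b 0) = wedge E u₁ u₂ ∧ wedge E (a 1) (b 1) = c • wedge E v₁ v₂ ∧
      ∀ t, B (a t) (a t) = 0 ∧ B (a t) (b t) = 0 ∧ B (b t) (b t) = 0 := by
  have ha : IsPolyCurve fun t : ℂ => (1 - t) • u₁ + t • v₁ :=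
    (isPolyCurve_one_sub.smul_const _).add (IsPolyCurve.id.smul_const _)
  -- If all four vectors are mutually orthogonal, linear interpolation stays isotropic. Otherwise
  -- the first vector still moves linearly from `u₁` to `v₁`, while the second follows a conic from
  -- `u₂` to `v₂` that has to remain orthogonal to the first.
  by_cases h₂₂ : B u₂ v₂ = 0
  · refine ⟨fun t => (1 - t) • u₁ + t • v₁, fun t => (1 - t) • u₂ + t • v₂, 1, ha,
      (isPolyCurve_one_sub.smul_const _).add (IsPolyCurve.id.smul_const _), one_ne_zero,
      by simp, by simp, fun t => ?_⟩
    simp [hu₁, hu₂, hu₁₂, hv₁, hv₂, hv₁₂, h₁₁, h₁₂, h₂₁, h₂₂, hs v₁ u₁,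
      hs v₁ u₂, hs v₂ u₂]
  · set c := B u₂ v₂ with hc
    have hc' : B v₂ u₂ = c := hs _ _
    -- The radical of this span lies in the line of `v₁`, so the dimension count is 1 + 3 < 5; this
    -- is where dimension at least five is used.
    obtain ⟨r, hr, hrr⟩ := exists_orthogonal_not_isotropic hB hs (Submodule.span ℂ {u₂, v₂, v₁}) (by
      have h1 : Submodule.span ℂ {u₂, v₂, v₁} ⊓ B.orthogonal (Submodule.span ℂ {u₂, v₂, v₁}) ≤
          Submodule.span ℂ {v₁} := by
        rintro x ⟨hx, hxo⟩
        obtain ⟨α, β, γ, rfl⟩ := Submodule.mem_span_triple.1 hx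
        have h1 : B u₂ (α • u₂ + β • v₂ + γ • v₁) = 0 := hxo u₂ (Submodule.subset_span (by simp))
        have h2 : B v₂ (α • u₂ + β • v₂ + γ • v₁) = 0 := hxo v₂ (Submodule.subset_span (by simp))
        simp only [map_add, map_smul, hu₂, hv₂, hv₁₂, h₂₁, hs v₂ v₁, ← hc, hc', smul_eq_mul,
          mul_zero, zero_add, add_zero, mul_eq_zero, h₂₂, or_false] at h1 h2
        rw [h1, h2, zero_smul, zero_smul, zero_add, zero_add]
        exact Submodule.smul_mem _ _ (Submodule.mem_span_singleton_self _)
      have h2 : Module.finrank ℂ (Submodule.span ℂ {u₂, v₂, v₁}) ≤ 3 := by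
        have := finrank_range_le_card (R := ℂ) ![u₂, v₂, v₁]
        rwa [Set.finrank, Matrix.range_cons, Matrix.range_cons_cons_empty, Fintype.card_fin,
          Set.singleton_union] at this
      have h3 := Submodule.finrank_mono h1
      have h4 : Module.finrank ℂ (Submodule.span ℂ {v₁}) ≤ 1 := finrank_span_singleton hv0 |>.le
      omega)
    have hur : B u₂ r = 0 := hr u₂ (Submodule.subset_span (by simp))
    have hv₂r : B v₂ r = 0 := hr v₂ (Submodule.subset_span (by simp))
    have hv₁r : B v₁ r = 0 := hr v₁ (Submodule.subset_span (by simp))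
    obtain ⟨k, hk⟩ : ∃ k, B k v₁ ≠ 0 := by
      by_contra! hk
      exact hv0 (hB.2 v₁ hk)
    -- A vector pairing nontrivially with `v₁` is projected away from the hyperbolic plane of `u₂`
    -- and `v₂`; the pairing with `v₁` is unaffected because `v₁` is orthogonal to that plane.
    obtain ⟨κ, hκu, hκv, hκ⟩ : ∃ κ, B κ u₂ = 0 ∧ B κ v₂ = 0 ∧ B κ v₁ ≠ 0 := by
      refine ⟨k - (B k v₂ / c) • u₂ - (B k u₂ / c) • v₂, ?_, ?_, ?_⟩
      · simp [hu₂, hc', h₂₂]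
      · simp [hv₂, ← hc, h₂₂]
      · simpa [h₂₁, hs v₂ v₁, hv₁₂] using hk
    let a : ℂ → E := fun t => (1 - t) • u₁ + t • v₁
    -- The coefficients are chosen so that `ρ t` is orthogonal to `a t`; it is also orthogonal to
    -- `u₂` and `v₂`, since `r` and `κ` are. At t = 1 it is a nonzero multiple of the nonisotropic
    -- vector `r`.
    let ρ : ℂ → E := fun t => B κ (a t) • r - B r (a t) • κ
    have hρ : IsPolyCurve ρ := ((ha.linear (B κ)).smul_const _).sub ((ha.linear (B r)).smul_const _)
    have hρa : ∀ t, B (ρ t) (a t) = 0 := by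
      intro t
      simp only [ρ, map_sub, map_smul, LinearMap.sub_apply, LinearMap.smul_apply, smul_eq_mul]
      ring
    have hρu : ∀ t, B (ρ t) u₂ = 0 := by
      intro t
      simp [ρ, hκu, hs r u₂, hur]
    have hρv : ∀ t, B (ρ t) v₂ = 0 := by
      intro t
      simp [ρ, hκv, hs r v₂, hv₂r]
    have hau : ∀ t, B (a t) u₂ = 0 := by
      intro t
      simp [a, hu₁₂, hs v₁ u₂, h₂₁]
    have hav : ∀ t, B (a t) v₂ = 0 := by
      intro t
      simp [a, h₁₂, hv₁₂]
    have hρ1 : B (ρ 1) (ρ 1) ≠ 0 := by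
      have : ρ 1 = B κ v₁ • r := by simp [ρ, a, hs r v₁, hv₁r]
      rw [this]
      simp [hκ, hrr]
    -- The same conic as for points of a quadric, with the moving vector `ρ t` in the middle; the
    -- factor `(2 * c)⁻¹` cancels `B (ρ t) (ρ t)` against the pairing `c` of `u₂` with `v₂`.
    refine ⟨a, fun t => ((1 - t) * (1 - t)) • u₂ + (t * (1 - t)) • ρ t -
      (t * t * (B (ρ t) (ρ t) * (2 * c)⁻¹)) • v₂, -(B (ρ 1) (ρ 1) * (2 * c)⁻¹), ha, ?_, ?_, ?_, ?_,
      fun t => ⟨?_, ?_, ?_⟩⟩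
    · exact (((isPolyCurve_one_sub.mul isPolyCurve_one_sub).smul_const _).add
        ((IsPolyCurve.id.mul isPolyCurve_one_sub).smul hρ)).sub
        (((IsPolyCurve.id.mul IsPolyCurve.id).mul
          ((hρ.bilinear hρ B).mul (.const _))).smul_const _)
    · simp [hρ1, h₂₂]
    · simp [a]
    · simp only [sub_self, mul_zero, zero_smul, one_smul, zero_add, one_mul, zero_sub, a,
        map_neg, map_smul, mul_one]
      exact (neg_smul _ _).symm
    · simp [a, hu₁, hv₁, h₁₁, hs v₁ u₁]
    · simp [hau, hav, hs (a t) (ρ t), hρa]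
    · simp only [map_add, map_sub, map_smul, LinearMap.add_apply, LinearMap.sub_apply,
        LinearMap.smul_apply, smul_eq_mul, hu₂, hv₂, hρu, hρv, hs u₂ (ρ t), hs v₂ (ρ t), ← hc, hc']
      field_simp
      ring

/-- The argument depends on the 2×2 matrix of pairings `B uᵢ vⱼ`. If it is singular, a change of
basis in both planes leads to the degenerate case; if it is invertible, the planes are in duality
and a linear interpolation between suitable bases works. -/
theorem exists_curve_of_isotropic [FiniteDimensional ℂ E] (hB : B.Nondegenerate)
    (hs : ∀ x y, B x y = B y x)
    (hn : 5 ≤ Module.finrank ℂ E) {u₁ u₂ v₁ v₂ : E} (hu₁ : B u₁ u₁ = 0) (hu₁₂ : B u₁ u₂ = 0)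
    (hu₂ : B u₂ u₂ = 0) (hv₁ : B v₁ v₁ = 0) (hv₁₂ : B v₁ v₂ = 0) (hv₂ : B v₂ v₂ = 0)
    (hv0 : wedge E v₁ v₂ ≠ 0) :
    ∃ a b : ℂ → E, ∃ c : ℂ, IsPolyCurve a ∧ IsPolyCurve b ∧ c ≠ 0 ∧
      wedge E (a 0) (b 0) = wedge E u₁ u₂ ∧ wedge E (a 1) (b 1) = c • wedge E v₁ v₂ ∧
      ∀ t, B (a t) (a t) = 0 ∧ B (a t) (b t) = 0 ∧ B (b t) (b t) = 0 := by
  by_cases hdet : B u₁ v₁ * B u₂ v₂ - B u₁ v₂ * B u₂ v₁ = 0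
  -- A left kernel vector gives a vector of the first plane orthogonal to the second plane, and a
  -- right kernel vector gives the converse. Each is completed to a basis by a matrix of determinant
  -- 1, so the wedges do not change.
  · obtain ⟨x, hx0, hx⟩ := Matrix.exists_vecMul_eq_zero_iff.2
      (show (!![B u₁ v₁, B u₁ v₂; B u₂ v₁, B u₂ v₂]).det = 0 by rw [Matrix.det_fin_two_of, hdet])
    obtain ⟨y, hy0, hy⟩ := Matrix.exists_mulVec_eq_zero_iff.2
      (show (!![B u₁ v₁, B u₁ v₂; B u₂ v₁, B u₂ v₂]).det = 0 by rw [Matrix.det_fin_two_of, hdet])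
    have hx1 := congrFun hx 0
    have hx2 := congrFun hx 1
    have hy1 := congrFun hy 0
    have hy2 := congrFun hy 1
    simp [Matrix.vecMul, Matrix.mulVec, dotProduct, Fin.sum_univ_two] at hx1 hx2 hy1 hy2
    obtain ⟨z, w, hzw⟩ := exists_complement (x := x 0) (y := x 1) (fun h => hx0 (by
      ext i
      fin_cases i
      exacts [h.1, h.2]))
    obtain ⟨z', w', hzw'⟩ := exists_complement (x := y 0) (y := y 1) (fun h => hy0 (by
      ext i
      fin_cases i
      exacts [h.1, h.2]))
    have e1 := wedge_combination (x 0) (x 1) z w u₁ u₂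
    have e2 := wedge_combination (y 0) (y 1) z' w' v₁ v₂
    rw [hzw, one_smul] at e1
    rw [hzw', one_smul] at e2
    rw [← e1, ← e2]
    have su := hs u₂ u₁
    have sv := hs v₂ v₁
    refine exists_curve_of_degenerate hB hs hn ?_ ?_ ?_ ?_ ?_ ?_ ?_ ?_ ?_ ?_
    · simp [hu₁, hu₂, hu₁₂, su]
    · simp [hu₁, hu₂, hu₁₂, su]
    · simp [hu₁, hu₂, hu₁₂, su]
    · simp [hv₁, hv₂, hv₁₂, sv]
    · simp [hv₁, hv₂, hv₁₂, sv]
    · simp [hv₁, hv₂, hv₁₂, sv]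
    · simp
      linear_combination (x 0) * hy1 + (x 1) * hy2
    · simp
      linear_combination z' * hx1 + w' * hx2
    · simp
      linear_combination z * hy1 + w * hy2
    · intro h
      rw [h, map_zero, LinearMap.zero_apply] at e2
      exact hv0 e2.symm
  -- The target basis wᵢ = B uᵢ v₂ • v₁ - B uᵢ v₁ • v₂ makes the matrix `B uᵢ wⱼ` skew, so all cross
  -- terms cancel; its wedge is the determinant times v₁ ∧ v₂.
  · refine ⟨fun t => (1 - t) • u₁ + t • (B u₁ v₂ • v₁ + (-B u₁ v₁) • v₂),
      fun t => (1 - t) • u₂ + t • (B u₂ v₂ • v₁ + (-B u₂ v₁) • v₂),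
      B u₁ v₁ * B u₂ v₂ - B u₁ v₂ * B u₂ v₁,
      (isPolyCurve_one_sub.smul_const _).add (IsPolyCurve.id.smul_const _),
      (isPolyCurve_one_sub.smul_const _).add (IsPolyCurve.id.smul_const _), hdet, by simp, ?_,
      fun t => ⟨?_, ?_, ?_⟩⟩
    · have := wedge_combination (B u₁ v₂) (-B u₁ v₁) (B u₂ v₂) (-B u₂ v₁) v₁ v₂
      simp only [sub_self, zero_smul, one_smul, zero_add, this]
      congr 1
      ring
    all_goals
      simp only [map_add, map_smul, LinearMap.add_apply, LinearMap.smul_apply, smul_eq_mul,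
        hu₁, hu₁₂, hu₂, hv₁, hv₁₂, hv₂, hs v₂ v₁, hs v₁ u₁, hs v₁ u₂, hs v₂ u₁, hs v₂ u₂]
      ring

theorem isotropic_combination {u v : E} (hu : B u u = 0) (huv : B u v = 0)
    (hs : ∀ x y, B x y = B y x) (hv : B v v = 0) (a b : ℂ) :
    B (a • u + b • v) (a • u + b • v) = 0 := by
  simp [hu, huv, hv, hs v u]

theorem isotropic_of_combination {u v : E} (hs : ∀ x y, B x y = B y x)
    (h : ∀ a b : ℂ, B (a • u + b • v) (a • u + b • v) = 0) :
    B u u = 0 ∧ B u v = 0 ∧ B v v = 0 := by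
  have h1 := h 1 0
  have h2 := h 0 1
  have h3 := h 1 1
  simp only [one_smul, zero_smul, add_zero, zero_add] at h1 h2 h3
  simp only [map_add, LinearMap.add_apply, h1, h2, hs v u] at h3
  exact ⟨h1, by linear_combination h3 / 2, h2⟩

/-- The Grassmannian of lines in a quadric of dimension at least `3` is irreducible. -/
theorem isIrreducible_linesIn_quadric [FiniteDimensional ℂ E] (hB : B.Nondegenerate)
    (hs : ∀ x y, B x y = B y x)
    (hn : 5 ≤ Module.finrank ℂ E) (hne : (linesIn (quadric fun v => B v v)).Nonempty) :
    @IsIrreducible _ (projSpace (⋀[ℂ]^2 E)).top (linesIn (quadric fun v => B v v)) := by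
  have h0 : B (0 : E) 0 = 0 := by simp
  refine isIrreducible_of_curves hne fun p hp q hq => ?_
  obtain ⟨u₁, u₂, hu0, hpu, hu⟩ := (mem_linesIn_quadric (q := fun v => B v v) h0).1 hp
  obtain ⟨v₁, v₂, hv0, hqv, hv⟩ := (mem_linesIn_quadric (q := fun v => B v v) h0).1 hq
  obtain ⟨hu₁, hu₁₂, hu₂⟩ := isotropic_of_combination hs hu
  obtain ⟨hv₁, hv₁₂, hv₂⟩ := isotropic_of_combination hs hv
  obtain ⟨a, b, c, ha, hb, hc, h0', h1', hab⟩ :=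
    exists_curve_of_isotropic hB hs hn hu₁ hu₁₂ hu₂ hv₁ hv₁₂ hv₂ hv0
  refine ⟨fun t => wedge E (a t) (b t), ha.bilinear hb _, ?_, ?_, ?_, ?_, fun t ht => ?_⟩
  · beta_reduce
    rwa [h0']
  · beta_reduce
    rw [h0', hpu]
    exact Submodule.mem_span_singleton_self _
  · beta_reduce
    rw [h1']
    exact smul_ne_zero hc hv0
  · beta_reduce
    rw [h1', hqv]
    exact Submodule.smul_mem _ _ (Submodule.mem_span_singleton_self _)
  · obtain ⟨h1, h2, h3⟩ := hab t
    exact (mem_linesIn_quadric (q := fun v => B v v) h0).2 ⟨a t, b t, ht,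
      Projectivization.submodule_mk _ _, fun x y => isotropic_combination h1 h2 hs h3 x y⟩

end Quadrics

/-! ### Subvarieties as images of homogeneous parametrisations -/

section Images

variable {E E' F : Type} [AddCommGroup E] [Module ℂ E] [AddCommGroup E'] [Module ℂ E']
  [AddCommGroup F] [Module ℂ F]

theorem eq_of_rep_eq_smul {p q : ℙ ℂ E} {c : ℂ} (h : p.rep = c • q.rep) : p = q := by
  rw [← p.mk_rep, ← q.mk_rep, Projectivization.mk_eq_mk_iff']
  exact ⟨c, h.symm⟩

/-- A homogeneous polynomial map `ν` of degree `b + 1` that is inverted, locally on `Z`, by linear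
projections identifies its image `S` with `Z`. -/
theorem nonempty_iso_of_power (b : ℕ) (ν : E → F)
    (hpoly : ∀ l : Module.Dual ℂ F, (fun v => l (ν v)) ∈ polyFun E)
    (hhom : ∀ (c : ℂ) (v : E), ν (c • v) = c ^ (b + 1) • ν v) (Z : Set (ℙ ℂ E)) (S : Set (ℙ ℂ F))
    (hS : ∀ p, p ∈ S ↔ ∃ z ∈ Z, p.submodule = Submodule.span ℂ {ν z.rep})
    (inv : ∀ y ∈ Z, ∃ (σ : F →ₗ[ℂ] E) (l : E → ℂ) (u : F → ℂ), l y.rep ≠ 0 ∧ IsForm b u ∧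
      ∀ z ∈ Z, σ (ν z.rep) = l z.rep • z.rep ∧ u (ν z.rep) = l z.rep ^ (b + 1)) :
    Nonempty (((bundleO F 1).restrict S).Iso ((bundleO E (b + 1)).restrict Z)) := by
  have hν : ∀ z ∈ Z, ν z.rep ≠ 0 := by
    intro z hz h0
    obtain ⟨σ, l, u, hl, -, h⟩ := inv z hz
    have := (h z hz).1
    rw [h0, map_zero, eq_comm, smul_eq_zero] at this
    exact this.elim hl z.rep_nonzero
  let ψ : Z → S := fun z => ⟨Projectivization.mk ℂ (ν z.1.rep) (hν z.1 z.2),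
    (hS _).2 ⟨z.1, z.2, Projectivization.submodule_mk _ _⟩⟩
  have hψ : Function.Bijective ψ := by
    constructor
    · intro z z' h
      have h1 := congrArg Subtype.val h
      simp only [ψ, Projectivization.mk_eq_mk_iff'] at h1
      obtain ⟨c, hc⟩ := h1
      obtain ⟨σ, l, u, hl, -, h⟩ := inv z.1 z.2
      have h2 := congrArg σ hc
      rw [map_smul, (h _ z.2).1, (h _ z'.2).1] at h2
      refine Subtype.ext (eq_of_rep_eq_smul (c := (l z.1.rep)⁻¹ * c * l z'.1.rep) ?_)
      rw [mul_smul, mul_smul, h2, inv_smul_smul₀ hl]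
    · rintro ⟨p, hp⟩
      obtain ⟨z, hz, hpz⟩ := (hS p).1 hp
      exact ⟨⟨z, hz⟩, Subtype.ext ((mk_eq_iff_submodule _).2 hpz)⟩
  refine ⟨powerIso b ν hpoly hhom Z S (Equiv.ofBijective ψ hψ).symm (fun x => ?_) inv⟩
  obtain ⟨z, rfl⟩ := hψ.2 x
  rw [Equiv.ofBijective_symm_apply_apply]
  exact Projectivization.submodule_mk _ _

/-- A bihomogeneous map `ν` of bidegree `(1, 1)` that is inverted, locally, by linear
projections identifies its image `S` with the product of two projective spaces. -/
theorem nonempty_iso_of_segre (ν : E × E' → F)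
    (hpoly : ∀ l : Module.Dual ℂ F, (fun v => l (ν v)) ∈ polyFun (E × E'))
    (hhom : ∀ (c d : ℂ) (v : E) (w : E'), ν (c • v, d • w) = (c * d) • ν (v, w)) (S : Set (ℙ ℂ F))
    (hS : ∀ p, p ∈ S ↔ ∃ z : ℙ ℂ E × ℙ ℂ E',
      p.submodule = Submodule.span ℂ {ν (z.1.rep, z.2.rep)})
    (inv : ∀ y : ℙ ℂ E × ℙ ℂ E', ∃ (σ : F →ₗ[ℂ] E × E') (α : E → ℂ) (β : E' → ℂ)
      (u : Module.Dual ℂ F), α y.1.rep ≠ 0 ∧ β y.2.rep ≠ 0 ∧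
      ∀ v w, σ (ν (v, w)) = (β w • v, α v • w) ∧ u (ν (v, w)) = α v * β w) :
    Nonempty (((bundleO F 1).restrict S).Iso (bundleOO E E' 1 1)) := by
  have hν : ∀ z : ℙ ℂ E × ℙ ℂ E', ν (z.1.rep, z.2.rep) ≠ 0 := by
    intro z h0
    obtain ⟨σ, α, β, u, hα, hβ, h⟩ := inv z
    have := (h z.1.rep z.2.rep).2
    rw [h0, map_zero, eq_comm, mul_eq_zero] at this
    exact this.elim hα hβ
  let ψ : ℙ ℂ E × ℙ ℂ E' → S := fun z => ⟨Projectivization.mk ℂ (ν (z.1.rep, z.2.rep)) (hν z),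
    (hS _).2 ⟨z, Projectivization.submodule_mk _ _⟩⟩
  have hψ : Function.Bijective ψ := by
    constructor
    · intro z z' h
      have h1 := congrArg Subtype.val h
      simp only [ψ, Projectivization.mk_eq_mk_iff'] at h1
      obtain ⟨c, hc⟩ := h1
      obtain ⟨σ, α, β, u, hα, hβ, h⟩ := inv z
      have h2 := congrArg σ hc
      rw [map_smul, (h _ _).1, (h _ _).1, Prod.smul_mk, Prod.mk.injEq] at h2
      refine Prod.ext (eq_of_rep_eq_smul (c := (β z.2.rep)⁻¹ * c * β z'.2.rep) ?_)
        (eq_of_rep_eq_smul (c := (α z.1.rep)⁻¹ * c * α z'.1.rep) ?_)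
      · rw [mul_smul, mul_smul, h2.1, inv_smul_smul₀ hβ]
      · rw [mul_smul, mul_smul, h2.2, inv_smul_smul₀ hα]
    · rintro ⟨p, hp⟩
      obtain ⟨z, hpz⟩ := (hS p).1 hp
      exact ⟨z, Subtype.ext ((mk_eq_iff_submodule _).2 hpz)⟩
  refine ⟨segreIso ν hpoly hhom S (Equiv.ofBijective ψ hψ).symm (fun x => ?_) inv⟩
  obtain ⟨z, rfl⟩ := hψ.2 x
  rw [Equiv.ofBijective_symm_apply_apply]
  exact Projectivization.submodule_mk _ _

theorem nonempty_iso_of_power_univ (b : ℕ) (ν : E → F)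
    (hpoly : ∀ l : Module.Dual ℂ F, (fun v => l (ν v)) ∈ polyFun E)
    (hhom : ∀ (c : ℂ) (v : E), ν (c • v) = c ^ (b + 1) • ν v) (S : Set (ℙ ℂ F))
    (hS : ∀ p, p ∈ S ↔ ∃ z : ℙ ℂ E, p.submodule = Submodule.span ℂ {ν z.rep})
    (inv : ∀ y : ℙ ℂ E, ∃ (σ : F →ₗ[ℂ] E) (l : E → ℂ) (u : F → ℂ), l y.rep ≠ 0 ∧ IsForm b u ∧
      ∀ z, σ (ν z) = l z • z ∧ u (ν z) = l z ^ (b + 1)) :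
    Nonempty (((bundleO F 1).restrict S).Iso (bundleO E (b + 1))) := by
  obtain ⟨α⟩ := nonempty_iso_of_power b ν hpoly hhom Set.univ S (fun p => by simp [hS p])
    (fun y _ => by
      obtain ⟨σ, l, u, h1, h2, h3⟩ := inv y
      exact ⟨σ, l, u, h1, h2, fun z _ => h3 _⟩)
  exact ⟨α.trans (modelO E (b + 1)).restrictUniv⟩

/-- A linear map that is injective identifies a subset of projective space with its image. -/
theorem nonempty_iso_of_linear (ν : E →ₗ[ℂ] F) (σ : F →ₗ[ℂ] E) (hσ : ∀ v, σ (ν v) = v)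
    (Z : Set (ℙ ℂ E)) (S : Set (ℙ ℂ F))
    (hS : ∀ p, p ∈ S ↔ ∃ z ∈ Z, p.submodule = Submodule.span ℂ {ν z.rep}) :
    Nonempty (((bundleO F 1).restrict S).Iso ((bundleO E 1).restrict Z)) :=
  nonempty_iso_of_power 0 ν (fun l => dual_mem_polyFun (l ∘ₗ ν)) (by simp) Z S hS
    fun _ _ => ⟨σ, fun _ => 1, fun _ => 1, one_ne_zero, IsForm.one, fun z _ => by simp [hσ]⟩

theorem isIrreducible_of_iso {X Y : FunctionSpace} (φ : X.Iso Y)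
    (h : @IsIrreducible Y.Pt Y.top Set.univ) : @IsIrreducible X.Pt X.top Set.univ := by
  let := X.top
  let := Y.top
  have hc : Continuous φ.toEquiv.symm := by
    refine ⟨fun U hU => ?_⟩
    rw [φ.isOpen_iff, ← Set.preimage_comp, Equiv.symm_comp_self, Set.preimage_id]
    exact hU
  have := h.image _ hc.continuousOn
  rwa [Set.image_univ, φ.toEquiv.symm.surjective.range_eq] at this

theorem isIrreducible_univ_restrict {X : FunctionSpace} {S : Set X.Pt} :
    @IsIrreducible (X.restrict S).Pt (X.restrict S).top Set.univ ↔
      @IsIrreducible X.Pt X.top S := by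
  let := X.top
  constructor
  · intro h
    have := @IsIrreducible.image _ _ (X.restrict S).top X.top _ h (Subtype.val)
      (@Continuous.continuousOn _ _ (X.restrict S).top X.top _ _ continuous_subtype_val)
    rwa [Set.image_univ, Subtype.range_val] at this
  · intro h
    have h1 : PreirreducibleSpace S := Subtype.preirreducibleSpace h.2
    have h2 : Nonempty S := h.1.to_subtype
    exact ⟨Set.univ_nonempty, h1.1⟩

theorem isIrreducible_of_restrict_iso {X Y : FunctionSpace} {S : Set X.Pt} {Z : Set Y.Pt}
    (φ : (X.restrict S).Iso (Y.restrict Z)) (h : @IsIrreducible Y.Pt Y.top Z) :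
    @IsIrreducible X.Pt X.top S :=
  isIrreducible_univ_restrict.1 (isIrreducible_of_iso φ (isIrreducible_univ_restrict.2 h))

theorem isIrreducible_univ_projSpace [Nontrivial E] :
    @IsIrreducible (ℙ ℂ E) (projSpace E).top Set.univ := by
  refine isIrreducible_of_curves Set.univ_nonempty fun p _ q _ => ?_
  exact ⟨fun t => (1 - t) • p.rep + t • q.rep, (isPolyCurve_one_sub.smul_const _).add
    (IsPolyCurve.id.smul_const _), by simpa using p.rep_nonzero, by simpa using rep_mem_submodule p,
    by simpa using q.rep_nonzero, by simpa using rep_mem_submodule q, fun _ _ => trivial⟩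

end Images

/-! ### The torus action in coordinates -/

section Torus

theorem charVal_mk (a : Fin 3 → ℤ) (t : H2) :
    charVal (QuotientAddGroup.mk a) t = ∏ i, (t : Fin 3 → ℂˣ) i ^ a i := rfl

theorem charVal_add (w w' : M2) (t : H2) : charVal (w + w') t = charVal w t * charVal w' t := by
  rw [charVal, map_add]
  rfl

theorem charVal_zero (t : H2) : charVal 0 t = 1 := by
  rw [charVal, map_zero]
  rfl

theorem charVal_neg (w : M2) (t : H2) : charVal (-w) t = (charVal w t)⁻¹ := by
  rw [charVal, map_neg]
  rfl

theorem charVal_e (i : Fin 3) (t : H2) : charVal (e i) t = (t : Fin 3 → ℂˣ) i := by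
  rw [e, charVal_mk, Finset.prod_eq_single i]
  · simp
  · intro j _ hj
    simp [hj]
  · simp

/-- The coordinates `(a₁ - a₃, a₂ - a₃)` of the class of `a` in `M₂`. -/
def coordM2 : M2 →+ ℤ × ℤ :=
  QuotientAddGroup.lift _
    { toFun := fun a => (a 0 - a 2, a 1 - a 2)
      map_zero' := by simp
      map_add' := fun a b => by
        ext <;> simp <;> ring }
    (by
      intro x hx
      obtain ⟨n, rfl⟩ := AddSubgroup.mem_zmultiples_iff.1 hx
      simp)

theorem coordM2_mk (a : Fin 3 → ℤ) : coordM2 (QuotientAddGroup.mk a) = (a 0 - a 2, a 1 - a 2) :=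
  rfl

theorem coordM2_injective : Function.Injective coordM2 := by
  rw [injective_iff_map_eq_zero]
  intro w hw
  induction w using QuotientAddGroup.induction_on with
  | H a =>
    rw [coordM2_mk, Prod.mk_eq_zero] at hw
    rw [QuotientAddGroup.eq_zero_iff, AddSubgroup.mem_zmultiples_iff]
    refine ⟨a 2, ?_⟩
    ext i
    fin_cases i <;> simp <;> linarith [hw.1, hw.2]

/-- A generic element of `H₂`. -/
def genericElt : H2 :=
  -- The third entry makes the product 1; the multiplicative independence of 2 and 3 ensures that
  -- only the trivial character is trivial on this element.
  ⟨![Units.mk0 2 (by norm_num), Units.mk0 3 (by norm_num), Units.mk0 (1 / 6) (by norm_num)], by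
    change ∏ i, _ = _
    rw [Fin.prod_univ_three]
    ext
    simp
    norm_num⟩

/-- The equation descends to ℚ, where the 2-adic and 3-adic valuations read off the two exponents.
-/
theorem two_zpow_mul_three_zpow {k l : ℤ} (h : (2 : ℂ) ^ k * 3 ^ l = 1) : k = 0 ∧ l = 0 := by
  have h' : (2 : ℚ) ^ k * 3 ^ l = 1 := by
    apply Rat.cast_injective (α := ℂ)
    push_cast
    exact h
  have p2 : Fact (Nat.Prime 2) := ⟨Nat.prime_two⟩
  have p3 : Fact (Nat.Prime 3) := ⟨Nat.prime_three⟩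
  have a2 : padicValRat 2 (2 : ℚ) = 1 := by exact_mod_cast padicValRat.self (p := 2) (by norm_num)
  have a3 : padicValRat 3 (3 : ℚ) = 1 := by exact_mod_cast padicValRat.self (p := 3) (by norm_num)
  have b2 : padicValRat 2 (3 : ℚ) = 0 := by
    have : padicValNat 2 3 = 0 := padicValNat.eq_zero_of_not_dvd (by norm_num)
    exact_mod_cast congrArg Nat.cast this
  have b3 : padicValRat 3 (2 : ℚ) = 0 := by
    have : padicValNat 3 2 = 0 := padicValNat.eq_zero_of_not_dvd (by norm_num)
    exact_mod_cast congrArg Nat.cast this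
  have e2 := congrArg (padicValRat 2) h'
  have e3 := congrArg (padicValRat 3) h'
  rw [padicValRat.mul (zpow_ne_zero _ (by norm_num)) (zpow_ne_zero _ (by norm_num)),
    padicValRat.zpow, padicValRat.zpow, padicValRat.one] at e2 e3
  rw [a2, b2] at e2
  rw [a3, b3] at e3
  constructor <;> linarith

/-- One group element thus distinguishes all weights, so weight spaces become eigenspaces of a
single operator. -/
theorem charVal_genericElt_injective {w w' : M2}
    (h : (charVal w genericElt : ℂ) = charVal w' genericElt) : w = w' := by
  have key : ∀ w : M2, (charVal w genericElt : ℂ) = 1 → w = 0 := by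
    intro w hw
    induction w using QuotientAddGroup.induction_on with
    | H a =>
      rw [charVal_mk, Fin.prod_univ_three] at hw
      simp [genericElt] at hw
      have h6 : ((6 : ℂ) ^ a 2)⁻¹ = 2 ^ (-a 2) * 3 ^ (-a 2) := by
        rw [← mul_zpow, zpow_neg]
        norm_num
      have h0 : (2 : ℂ) ^ (a 0 - a 2) * 3 ^ (a 1 - a 2) = 1 := by
        rw [← hw, h6, sub_eq_add_neg, sub_eq_add_neg, zpow_add₀ (by norm_num),
          zpow_add₀ (by norm_num)]
        ring
      obtain ⟨h1, h2⟩ := two_zpow_mul_three_zpow h0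
      apply coordM2_injective
      rw [coordM2_mk, h1, h2, map_zero]
      rfl
  rw [← sub_eq_zero]
  apply key
  rw [sub_eq_add_neg, charVal_add, charVal_neg, Units.val_mul, h, ← Units.val_mul, mul_inv_cancel,
    Units.val_one]

variable (m : ℕ)

/-- The linear map by which an element of the torus acts on `V_m`. -/
def torusMap (t : H2) : V m →ₗ[ℂ] V m := Matrix.toLin' (SL3ToSO m (torusToSL3 t)).1.1

theorem torusAction_wedge (t : H2) (u v : V m) :
    torusAction m t (wedge _ u v) = wedge _ (torusMap m t u) (torusMap m t v) :=
  map_wedge _ _ _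

/-- The indices of the coordinates `xᵢ` and `yᵢ`. -/
def axisIdx : Fin 3 ⊕ Fin 3 → Idx m := Sum.elim Sum.inl (Sum.inr ∘ Sum.inl)

/-- The basis vectors belonging to the coordinates `xᵢ` and `yᵢ`. -/
def axis (α : Fin 3 ⊕ Fin 3) : V m := Pi.single (axisIdx m α) 1

/-- The weights of `H₂` on the basis vectors belonging to `xᵢ` and `yᵢ`. -/
def wt : Fin 3 ⊕ Fin 3 → M2 := Sum.elim e fun i => -e i

/-- The inclusion of the space with coordinates `zⱼ`. -/
def inclZ : (Fin (m - 6) → ℂ) →ₗ[ℂ] V m where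
  toFun z := Sum.elim 0 (Sum.elim 0 z)
  map_add' z z' := by
    ext (i | i | i) <;> simp
  map_smul' c z := by
    ext (i | i | i) <;> simp

/-- The projection to the space with coordinates `zⱼ`. -/
def projZ : V m →ₗ[ℂ] (Fin (m - 6) → ℂ) := LinearMap.funLeft ℂ ℂ fun j => Sum.inr (Sum.inr j)

variable {m}

theorem projZ_inclZ (z : Fin (m - 6) → ℂ) : projZ m (inclZ m z) = z := rfl

theorem projZ_axis (α : Fin 3 ⊕ Fin 3) : projZ m (axis m α) = 0 := by
  ext j
  rcases α with i | i <;> simp [projZ, axis, axisIdx, LinearMap.funLeft_apply]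

theorem inclZ_axisIdx (z : Fin (m - 6) → ℂ) (α : Fin 3 ⊕ Fin 3) :
    inclZ m z (axisIdx m α) = 0 := by
  rcases α with i | i <;> rfl

theorem axisIdx_injective : Function.Injective (axisIdx m) := by
  rintro (i | i) (j | j) h <;> simp_all [axisIdx]

theorem axis_axisIdx (α β : Fin 3 ⊕ Fin 3) :
    axis m α (axisIdx m β) = if β = α then 1 else 0 := by
  rw [axis, Pi.single_apply]
  simp only [axisIdx_injective.eq_iff]

theorem torusToSL3_apply (t : H2) :
    (torusToSL3 t).1 = Matrix.diagonal fun i => ((t : Fin 3 → ℂˣ) i : ℂ) := rfl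

theorem torusMap_apply (t : H2) (v : V m) :
    torusMap m t v = (Matrix.fromBlocks (Matrix.diagonal fun i => ((t : Fin 3 → ℂˣ) i : ℂ)) 0 0
      (Matrix.fromBlocks (Matrix.diagonal fun i => (((t : Fin 3 → ℂˣ) i)⁻¹ : ℂ)) 0 0 1)).mulVec
        v := by
  have h : (torusToSL3 t)⁻¹ = torusToSL3 t⁻¹ := (map_inv _ _).symm
  change (blockMatrix m (torusToSL3 t)).mulVec v = _
  rw [blockMatrix, h, torusToSL3_apply, torusToSL3_apply, Matrix.diagonal_transpose]
  simp

theorem torusMap_axisIdx (t : H2) (v : V m) (α : Fin 3 ⊕ Fin 3) :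
    torusMap m t v (axisIdx m α) = charVal (wt α) t * v (axisIdx m α) := by
  rw [torusMap_apply]
  rcases α with i | i
  · simp [axisIdx, wt, charVal_e, Matrix.mulVec, dotProduct, Matrix.diagonal_apply]
  · simp [axisIdx, wt, charVal_e, charVal_neg, Matrix.mulVec, dotProduct, Matrix.diagonal_apply]

theorem torusMap_inr_inr (t : H2) (v : V m) (j : Fin (m - 6)) :
    torusMap m t v (Sum.inr (Sum.inr j)) = v (Sum.inr (Sum.inr j)) := by
  rw [torusMap_apply]
  simp [Matrix.mulVec, dotProduct, Matrix.one_apply]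

theorem idx_cases (a : Idx m) : (∃ α, a = axisIdx m α) ∨ ∃ j, a = Sum.inr (Sum.inr j) := by
  rcases a with i | i | j
  · exact Or.inl ⟨Sum.inl i, rfl⟩
  · exact Or.inl ⟨Sum.inr i, rfl⟩
  · exact Or.inr ⟨j, rfl⟩

theorem V_ext {u v : V m} (h1 : ∀ α, u (axisIdx m α) = v (axisIdx m α)) (h2 : projZ m u = projZ m v) :
    u = v := by
  ext a
  obtain ⟨α, rfl⟩ | ⟨j, rfl⟩ := idx_cases a
  · exact h1 α
  · exact congrFun h2 j

theorem projZ_torusMap (t : H2) (v : V m) : projZ m (torusMap m t v) = projZ m v := by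
  ext j
  exact torusMap_inr_inr t v j

theorem torusMap_axis (t : H2) (α : Fin 3 ⊕ Fin 3) :
    torusMap m t (axis m α) = (charVal (wt α) t : ℂ) • axis m α := by
  refine V_ext (fun β => ?_) ?_
  · rw [torusMap_axisIdx, Pi.smul_apply, axis_axisIdx]
    split_ifs with h
    · rw [h]
      rfl
    · simp
  · rw [projZ_torusMap, map_smul, projZ_axis, smul_zero]

theorem torusMap_inclZ (t : H2) (z : Fin (m - 6) → ℂ) : torusMap m t (inclZ m z) = inclZ m z := by
  refine V_ext (fun β => ?_) ?_
  · rw [torusMap_axisIdx, inclZ_axisIdx, mul_zero]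
  · rw [projZ_torusMap]

/-- The coordinates of a weight of a basis vector. -/
def coordWt : Fin 3 ⊕ Fin 3 → ℤ × ℤ := Sum.elim ![(1, 0), (0, 1), (-1, -1)]
  ![(-1, 0), (0, -1), (1, 1)]

theorem coordM2_e (i : Fin 3) : coordM2 (e i) = ![(1, 0), (0, 1), (-1, -1)] i := by
  rw [e, coordM2_mk]
  fin_cases i <;> simp

/-- Carries questions about the six weights from the quotient `M2` to ℤ × ℤ, where they are finite
and decidable. -/
theorem coordM2_wt (α : Fin 3 ⊕ Fin 3) : coordM2 (wt α) = coordWt α := by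
  rcases α with i | i
  · exact coordM2_e i
  · change coordM2 (-e i) = _
    rw [map_neg, coordM2_e]
    fin_cases i <;> rfl

theorem wt_injective : Function.Injective wt := by
  intro α β h
  have := congrArg coordM2 h
  rw [coordM2_wt, coordM2_wt] at this
  clear h
  revert α β
  decide

theorem wt_ne_zero (α : Fin 3 ⊕ Fin 3) : wt α ≠ 0 := by
  intro h
  have := congrArg coordM2 h
  rw [coordM2_wt, map_zero] at this
  clear h
  revert α
  decide

/-- Eigenvectors of a generic element of the torus. -/
theorem eigenvector_cases {v : V m} {c : ℂ} (h : torusMap m genericElt v = c • v) :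
    (∃ (α : Fin 3 ⊕ Fin 3) (a : ℂ), v = a • axis m α) ∨ ∃ z, v = inclZ m z := by
  by_cases hv : ∃ α, v (axisIdx m α) ≠ 0
  · obtain ⟨α, hα⟩ := hv
    have hc : (charVal (wt α) genericElt : ℂ) = c := by
      have := congrFun h (axisIdx m α)
      rw [torusMap_axisIdx] at this
      exact mul_right_cancel₀ hα this
    refine Or.inl ⟨α, v (axisIdx m α), V_ext (fun β => ?_) ?_⟩
    · rw [Pi.smul_apply, axis_axisIdx]
      split_ifs with hβ
      · rw [hβ, smul_eq_mul, mul_one]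
      · have := congrFun h (axisIdx m β)
        rw [torusMap_axisIdx, Pi.smul_apply, smul_eq_mul, ← hc] at this
        rw [smul_zero]
        by_contra hne
        exact hβ (wt_injective (charVal_genericElt_injective (mul_right_cancel₀ hne this)))
    · rw [map_smul, projZ_axis, smul_zero]
      have h2 := congrArg (projZ m) h
      rw [projZ_torusMap, map_smul] at h2
      by_contra hne
      have h3 : (1 - c) • projZ m v = 0 := by rw [sub_smul, one_smul, ← h2, sub_self]
      have h4 := (smul_eq_zero.1 h3).resolve_right hne
      refine wt_ne_zero α (charVal_genericElt_injective (hc.trans ?_))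
      rw [charVal_zero, Units.val_one]
      exact (sub_eq_zero.1 h4).symm
  · push Not at hv
    exact Or.inr ⟨projZ m v, V_ext (fun α => by rw [hv, inclZ_axisIdx]) (projZ_inclZ _).symm⟩

end Torus

/-! ### The fixed locus -/

section EigenPair

variable {E : Type} [AddCommGroup E] [Module ℂ E]

theorem span_wedge_smul {a b : ℂ} (u v : E) (h : wedge E (a • u) (b • v) ≠ 0) :
    Submodule.span ℂ {wedge E (a • u) (b • v)} = Submodule.span ℂ {wedge E u v} := by
  have h1 : wedge E (a • u) (b • v) = (a * b) • wedge E u v := by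
    rw [map_smul, map_smul, LinearMap.smul_apply, smul_smul, mul_comm]
  rw [h1] at h ⊢
  exact Submodule.span_singleton_smul_eq (IsUnit.mk0 _ fun h0 => h (by rw [h0, zero_smul])) _

theorem span_wedge_swap (u v : E) :
    Submodule.span ℂ {wedge E u v} = Submodule.span ℂ {wedge E v u} := by
  rw [wedge_swap u v, ← Set.neg_singleton, Submodule.span_neg]

/-- A plane that is stable under a diagonalisable endomorphism is spanned by two eigenvectors. -/
theorem exists_eigen_pair [FiniteDimensional ℂ E] {T : Module.End ℂ E}
    (hT : ⨆ μ, T.eigenspace μ = ⊤) {u v : E} (h0 : wedge E u v ≠ 0)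
    (hu : T u ∈ Submodule.span ℂ {u, v}) (hv : T v ∈ Submodule.span ℂ {u, v}) :
    ∃ u' ∈ Submodule.span ℂ {u, v}, ∃ v' ∈ Submodule.span ℂ {u, v}, ∃ c d : ℂ,
      T u' = c • u' ∧ T v' = d • v' ∧ wedge E u' v' ≠ 0 := by
  set W := Submodule.span ℂ {u, v} with hW
  have hTW : ∀ x ∈ W, T x ∈ W := by
    intro x hx
    obtain ⟨a, b, rfl⟩ := Submodule.mem_span_pair.1 hx
    rw [map_add, map_smul, map_smul]
    exact W.add_mem (W.smul_mem _ hu) (W.smul_mem _ hv)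
  -- The restriction of a diagonalisable endomorphism to a stable subspace is diagonalisable.
  have key := Submodule.eq_iSup_inf_genEigenspace 1 hTW hT
  by_contra! hne
  -- If any two eigenvectors in `W` had zero wedge, linearity in one argument and then in the other
  -- would make the wedge vanish on all of `W`, contradicting `h0`.
  have h1 : ∀ x ∈ W, ∀ c : ℂ, T x = c • x → W ≤ LinearMap.ker (wedge E x) := by
    intro x hx c hc
    rw [key]
    refine iSup_le fun μ y hy => ?_
    exact hne x hx y hy.1 c μ hc (Module.End.mem_eigenspace_iff.1 hy.2)
  have h2 : ∀ y ∈ W, W ≤ LinearMap.ker (wedge E y) := by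
    intro y hy
    rw [key]
    refine iSup_le fun μ x hx => ?_
    have := h1 x hx.1 μ (Module.End.mem_eigenspace_iff.1 hx.2) hy
    rw [LinearMap.mem_ker] at this ⊢
    rw [wedge_swap, this, neg_zero]
  exact h0 (h2 u (Submodule.subset_span (by simp)) (Submodule.subset_span (by simp)))

end EigenPair

section FixedLocus

variable {m : ℕ}

theorem qForm_eq (v : V m) : qForm m v = ∑ i, v (axisIdx m (Sum.inl i)) * v (axisIdx m (Sum.inr i)) +
    sumSq (m - 6) (projZ m v) := rfl

theorem sumSq_zero (k : ℕ) : sumSq k 0 = 0 := by simp [sumSq]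

theorem sumSq_smul (k : ℕ) (c : ℂ) (z : Fin k → ℂ) : sumSq k (c • z) = c ^ 2 * sumSq k z := by
  simp [sumSq, mul_pow, Finset.mul_sum]

theorem qForm_zero : qForm m 0 = 0 := by simp [qForm]

theorem qForm_inclZ (z : Fin (m - 6) → ℂ) : qForm m (inclZ m z) = sumSq (m - 6) z := by
  rw [qForm_eq, projZ_inclZ]
  simp [inclZ_axisIdx]

theorem qForm_axis_add_inclZ (a : ℂ) (α : Fin 3 ⊕ Fin 3) (z : Fin (m - 6) → ℂ) :
    qForm m (a • axis m α + inclZ m z) = sumSq (m - 6) z := by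
  rw [qForm_eq, map_add, map_smul, projZ_axis, projZ_inclZ, smul_zero, zero_add,
    Finset.sum_eq_zero, zero_add]
  intro i _
  rcases α with j | j <;> simp [inclZ_axisIdx, axis_axisIdx]

theorem qForm_axis_add_axis (a b : ℂ) {α β : Fin 3 ⊕ Fin 3} (h : β ≠ α.swap) :
    qForm m (a • axis m α + b • axis m β) = 0 := by
  rw [qForm_eq, map_add, map_smul, map_smul, projZ_axis, projZ_axis, smul_zero, smul_zero,
    add_zero, sumSq_zero, add_zero]
  apply Finset.sum_eq_zero
  intro i _
  rcases α with j | j <;> rcases β with k | k <;> simp [axis_axisIdx]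
  · rintro rfl rfl
    exact (h rfl).elim
  · rintro rfl rfl
    exact (h rfl).elim

theorem qForm_axis_add_swap (α : Fin 3 ⊕ Fin 3) :
    qForm m (axis m α + axis m α.swap) = 1 := by
  rw [qForm_eq, map_add, projZ_axis, projZ_axis, add_zero, sumSq_zero, add_zero]
  rcases α with j | j <;> simp [axis_axisIdx]

theorem mem_G_iff {ω : ℙ ℂ (⋀[ℂ]^2 (V m))} : ω ∈ G m ↔ ∃ u v, wedge (V m) u v ≠ 0 ∧
    ω.submodule = Submodule.span ℂ {wedge (V m) u v} ∧
    ∀ a b : ℂ, qForm m (a • u + b • v) = 0 :=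
  mem_linesIn_quadric qForm_zero

theorem iSup_eigenspace_torusMap (t : H2) : ⨆ μ, Module.End.eigenspace (torusMap m t) μ = ⊤ := by
  rw [eq_top_iff]
  intro v _
  have hv : v = ∑ α, v (axisIdx m α) • axis m α + inclZ m (projZ m v) := by
    refine V_ext (fun β => ?_) ?_
    · simp [Finset.sum_apply, axis_axisIdx, inclZ_axisIdx, -Fintype.sum_sum_type]
    · simp [projZ_axis, projZ_inclZ, -Fintype.sum_sum_type]
  rw [hv]
  refine Submodule.add_mem _ (Submodule.sum_mem _ fun α _ => Submodule.smul_mem _ _ ?_) ?_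
  · exact Submodule.mem_iSup_of_mem _ (Module.End.mem_eigenspace_iff.2 (torusMap_axis t α))
  · exact Submodule.mem_iSup_of_mem 1
      (Module.End.mem_eigenspace_iff.2 ((torusMap_inclZ t _).trans (one_smul ℂ _).symm))

/-- The points of `ℙ(⋀² V_m)` given by a basis vector and an isotropic vector in the
coordinates `zⱼ`. -/
def axisQuadric (m : ℕ) (α : Fin 3 ⊕ Fin 3) : Set (ℙ ℂ (⋀[ℂ]^2 (V m))) :=
  {ω | ∃ z : Fin (m - 6) → ℂ, z ≠ 0 ∧ sumSq (m - 6) z = 0 ∧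
    ω.submodule = Submodule.span ℂ {wedge (V m) (axis m α) (inclZ m z)}}

/-- The points of `ℙ(⋀² V_m)` given by isotropic planes in the coordinates `zⱼ`. -/
def centralLines (m : ℕ) : Set (ℙ ℂ (⋀[ℂ]^2 (V m))) :=
  {ω | ∃ z z' : Fin (m - 6) → ℂ, wedge _ z z' ≠ 0 ∧
    (∀ a b : ℂ, sumSq (m - 6) (a • z + b • z') = 0) ∧
    ω.submodule = Submodule.span ℂ {wedge (V m) (inclZ m z) (inclZ m z')}}

/-- A plane stable under the generic element is spanned by two eigenvectors, each of which is a
multiple of a basis vector or lies in the zⱼ-space. Isotropy excludes the pairs xᵢ, yᵢ and forces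
the z-parts to be isotropic. -/
theorem fixedLocus_cases {ω : ℙ ℂ (⋀[ℂ]^2 (V m))} (hω : ω ∈ fixedLocus m) :
    (∃ α β, α ≠ β ∧ β ≠ α.swap ∧
      ω.submodule = Submodule.span ℂ {wedge (V m) (axis m α) (axis m β)}) ∨
    (∃ α, ω ∈ axisQuadric m α) ∨ ω ∈ centralLines m := by
  obtain ⟨u, v, h0, hsub, hq⟩ := mem_G_iff.1 hω.1
  have hfix := hω.2 genericElt
  rw [hsub, Submodule.map_span, Set.image_singleton, torusAction_wedge] at hfix
  have h1 : wedge (V m) (torusMap m genericElt u) (torusMap m genericElt v) ≠ 0 := by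
    intro h1
    rw [h1, Submodule.span_zero_singleton, eq_comm, Submodule.span_singleton_eq_bot] at hfix
    exact h0 hfix
  -- A fixed Plücker point means a stable plane: the images of `u` and `v` are recovered from their
  -- wedge.
  have hmem : wedge (V m) (torusMap m genericElt u) (torusMap m genericElt v) ∈
      Submodule.span ℂ {wedge (V m) u v} := hfix ▸ Submodule.mem_span_singleton_self _
  have hu := mem_span_pair_of_wedge h1 hmem
  have hv := mem_span_pair_of_wedge (a := torusMap m genericElt v) (b := torusMap m genericElt u)
    (u := u) (v := v) (by rwa [wedge_swap, neg_ne_zero]) (by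
      rw [wedge_swap (torusMap m genericElt u)]
      exact Submodule.neg_mem _ hmem)
  obtain ⟨u', hu', v', hv', c, d, hc, hd, h0'⟩ :=
    exists_eigen_pair (iSup_eigenspace_torusMap genericElt) h0 hu hv
  obtain ⟨p, q, hpq⟩ := Submodule.mem_span_pair.1 hu'
  obtain ⟨r, s, hrs⟩ := Submodule.mem_span_pair.1 hv'
  have hsub' : ω.submodule = Submodule.span ℂ {wedge (V m) u' v'} := by
    have h2 : wedge (V m) u' v' = (p * s - q * r) • wedge (V m) u v := by
      rw [← hpq, ← hrs, wedge_combination]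
    rw [h2] at h0' ⊢
    rw [hsub, Submodule.span_singleton_smul_eq
      (IsUnit.mk0 _ fun h => h0' (by rw [h, zero_smul]))]
  have hq' : ∀ a b : ℂ, qForm m (a • u' + b • v') = 0 := by
    intro a b
    have : a • u' + b • v' = (a * p + b * r) • u + (a * q + b * s) • v := by
      rw [← hpq, ← hrs]
      module
    rw [this, hq]
  clear hu hv hu' hv' hpq hrs hmem h1 hfix hsub h0 hq
  have mixed : ∀ (α : Fin 3 ⊕ Fin 3) (a : ℂ) (z : Fin (m - 6) → ℂ),
      wedge (V m) (a • axis m α) (inclZ m z) ≠ 0 → qForm m (inclZ m z) = 0 →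
      ω.submodule = Submodule.span ℂ {wedge (V m) (a • axis m α) (inclZ m z)} →
      ω ∈ axisQuadric m α := by
    intro α a z hne hz hs
    refine ⟨z, ?_, by rwa [qForm_inclZ] at hz, hs.trans ?_⟩
    · rintro rfl
      simp at hne
    · have := span_wedge_smul (a := a) (b := 1) (axis m α) (inclZ m z) (by rwa [one_smul])
      rwa [one_smul] at this
  rcases eigenvector_cases hc with ⟨α, a, rfl⟩ | ⟨z, rfl⟩ <;>
    rcases eigenvector_cases hd with ⟨β, b, rfl⟩ | ⟨z', rfl⟩
  · refine Or.inl ⟨α, β, ?_, ?_, hsub'.trans (span_wedge_smul _ _ h0')⟩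
    · rintro rfl
      apply h0'
      simp [wedge_self]
    · rintro rfl
      have ha : a ≠ 0 := by
        rintro rfl
        simp at h0'
      have hb : b ≠ 0 := by
        rintro rfl
        simp at h0'
      -- The sum of the basis vectors of xᵢ and yᵢ has value 1 under the form, so this pair does not
      -- span an isotropic plane.
      have := hq' a⁻¹ b⁻¹
      rw [inv_smul_smul₀ ha, inv_smul_smul₀ hb, qForm_axis_add_swap] at this
      exact one_ne_zero this
  · exact Or.inr (Or.inl ⟨α, mixed α a z' h0' (by simpa using hq' 0 1) hsub'⟩)
  · exact Or.inr (Or.inl ⟨β, mixed β b z (by rwa [wedge_swap, neg_ne_zero])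
      (by simpa using hq' 1 0) (hsub'.trans (span_wedge_swap _ _))⟩)
  · refine Or.inr (Or.inr ⟨z, z', ?_, fun a b => ?_, hsub'⟩)
    · intro h
      apply h0'
      rw [← map_wedge, h, map_zero]
    · rw [← qForm_inclZ, map_add, map_smul, map_smul, hq']

/-- A fixed point has weight `w` if and only if the torus acts on the corresponding line of
`⋀² V_m` by the character `-w`. -/
theorem mem_weightLocus_iff {w : M2} {ω : ℙ ℂ (⋀[ℂ]^2 (V m))} : ω ∈ weightLocus m w ↔
    ω ∈ G m ∧ ∀ t, ∀ v ∈ ω.submodule, torusAction m t v = (charVal (-w) t : ℂ) • v := by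
  constructor
  · rintro ⟨⟨hG, hfix⟩, hw⟩
    refine ⟨hG, fun t v hv => ?_⟩
    have hmem : torusAction m t ω.rep ∈ ω.submodule := by
      have := Submodule.mem_map_of_mem (f := torusAction m t) (rep_mem_submodule ω)
      rwa [hfix t] at this
    obtain ⟨c, hc⟩ := exists_smul_rep hmem
    -- Tested on the functional with value 1 at the representative, the weight condition reads 1 =
    -- w(t) c, where c is the eigenvalue on the line; hence the character on the line is -w.
    have h1 := hw t ((evO _ 1 ω).symm 1) ⟨_, hmem⟩ ⟨_, rep_mem_submodule ω⟩ rfl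
    have h2 : (⟨_, hmem⟩ : ω.submodule) = c • ⟨_, rep_mem_submodule ω⟩ := Subtype.ext hc.symm
    have h3 : ((evO _ 1 ω).symm 1).1 ⟨_, rep_mem_submodule ω⟩ = 1 :=
      (evO _ 1 ω).apply_symm_apply 1
    rw [h2, ((evO _ 1 ω).symm 1).2, h3, pow_one, mul_one] at h1
    have h4 : c = (charVal (-w) t : ℂ) := by
      rw [charVal_neg, Units.val_inv_eq_inv_val]
      exact eq_inv_of_mul_eq_one_right h1.symm
    obtain ⟨b, rfl⟩ := exists_smul_rep hv
    rw [map_smul, ← hc, h4, smul_comm]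
  · rintro ⟨hG, h⟩
    refine ⟨⟨hG, fun t => le_antisymm ?_ ?_⟩, fun t k v v' hv => ?_⟩
    · rintro _ ⟨v, hv, rfl⟩
      rw [h t v hv]
      exact Submodule.smul_mem _ _ hv
    · intro v hv
      refine ⟨(charVal (-w) t : ℂ)⁻¹ • v, Submodule.smul_mem _ _ hv, ?_⟩
      rw [map_smul, h t v hv, inv_smul_smul₀ (Units.ne_zero _)]
    · rw [h t _ v'.2] at hv
      have h2 : v = (charVal (-w) t : ℂ) • v' := Subtype.ext hv.symm
      rw [h2, k.2, pow_one, ← mul_assoc, ← Units.val_mul, ← charVal_add, add_neg_cancel,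
        charVal_zero, Units.val_one, one_mul]

theorem mem_weightLocus_of_wedge {ω : ℙ ℂ (⋀[ℂ]^2 (V m))} {u v : V m} {w w' : M2}
    (h0 : wedge (V m) u v ≠ 0) (hω : ω.submodule = Submodule.span ℂ {wedge (V m) u v})
    (hq : ∀ a b : ℂ, qForm m (a • u + b • v) = 0)
    (hu : ∀ t, torusMap m t u = (charVal w t : ℂ) • u)
    (hv : ∀ t, torusMap m t v = (charVal w' t : ℂ) • v) : ω ∈ weightLocus m (-(w + w')) := by
  refine mem_weightLocus_iff.2 ⟨mem_G_iff.2 ⟨u, v, h0, hω, hq⟩, fun t x hx => ?_⟩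
  rw [hω] at hx
  obtain ⟨c, rfl⟩ := Submodule.mem_span_singleton.1 hx
  rw [map_smul, torusAction_wedge, hu, hv, neg_neg, charVal_add, Units.val_mul, map_smul, map_smul,
    LinearMap.smul_apply, smul_smul (charVal w' t : ℂ), mul_comm (charVal w' t : ℂ),
    smul_comm]

theorem weightLocus_disjoint {w w' : M2} {ω : ℙ ℂ (⋀[ℂ]^2 (V m))} (h : ω ∈ weightLocus m w)
    (h' : ω ∈ weightLocus m w') : w = w' := by
  have h1 := (mem_weightLocus_iff.1 h).2 genericElt _ (rep_mem_submodule ω)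
  have h2 := (mem_weightLocus_iff.1 h').2 genericElt _ (rep_mem_submodule ω)
  rw [h1] at h2
  exact neg_injective (charVal_genericElt_injective (smul_left_injective ℂ ω.rep_nonzero h2))

theorem weightLocus_subset_fixedLocus (w : M2) : weightLocus m w ⊆ fixedLocus m :=
  fun _ h => h.1

end FixedLocus

/-! ### The weights of the fixed points -/

section Weights

variable {m : ℕ}

theorem wedge_axis_ne_zero {α β : Fin 3 ⊕ Fin 3} (h : α ≠ β) :
    wedge (V m) (axis m α) (axis m β) ≠ 0 := by
  refine wedge_ne_zero_of_duals (α := LinearMap.proj (axisIdx m α))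
    (β := LinearMap.proj (axisIdx m β)) ?_
  simp [axis_axisIdx, h]

theorem wedge_axis_inclZ_ne_zero (α : Fin 3 ⊕ Fin 3) {z : Fin (m - 6) → ℂ} (hz : z ≠ 0) :
    wedge (V m) (axis m α) (inclZ m z) ≠ 0 := by
  obtain ⟨j, hj⟩ := Function.ne_iff.1 hz
  refine wedge_ne_zero_of_duals (α := LinearMap.proj (axisIdx m α))
    (β := LinearMap.proj j ∘ₗ projZ m) ?_
  simpa [axis_axisIdx, inclZ_axisIdx, projZ_inclZ, projZ_axis] using hj

theorem wedge_inclZ_ne_zero {z z' : Fin (m - 6) → ℂ} (h : wedge _ z z' ≠ 0) :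
    wedge (V m) (inclZ m z) (inclZ m z') ≠ 0 := by
  intro h0
  apply h
  have := congrArg (exteriorPower.map 2 (projZ m)) h0
  rwa [map_wedge, map_zero] at this

/-- The point of `ℙ(⋀² V_m)` given by two basis vectors. -/
def axisPoint (m : ℕ) (α β : Fin 3 ⊕ Fin 3) (h : α ≠ β) : ℙ ℂ (⋀[ℂ]^2 (V m)) :=
  Projectivization.mk ℂ _ (wedge_axis_ne_zero h)

theorem axisPoint_submodule {α β : Fin 3 ⊕ Fin 3} (h : α ≠ β) :
    (axisPoint m α β h).submodule = Submodule.span ℂ {wedge (V m) (axis m α) (axis m β)} :=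
  Projectivization.submodule_mk _ _

theorem axisPoint_mem {α β : Fin 3 ⊕ Fin 3} (h : α ≠ β) (h' : β ≠ α.swap) :
    axisPoint m α β h ∈ weightLocus m (-(wt α + wt β)) :=
  mem_weightLocus_of_wedge (wedge_axis_ne_zero h) (axisPoint_submodule h)
    (fun a b => qForm_axis_add_axis a b h') (fun t => torusMap_axis t α)
    (fun t => torusMap_axis t β)

theorem axisQuadric_subset (α : Fin 3 ⊕ Fin 3) : axisQuadric m α ⊆ weightLocus m (-wt α) := by
  rintro ω ⟨z, hz0, hz, hω⟩
  have := mem_weightLocus_of_wedge (w := wt α) (w' := 0) (wedge_axis_inclZ_ne_zero α hz0) hω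
    (fun a b => by
      rw [← map_smul, qForm_axis_add_inclZ, sumSq_smul, hz, mul_zero])
    (fun t => torusMap_axis t α)
    (fun t => by rw [torusMap_inclZ, charVal_zero, Units.val_one, one_smul])
  rwa [add_zero] at this

theorem centralLines_subset : centralLines m ⊆ weightLocus m 0 := by
  rintro ω ⟨z, z', h0, hz, hω⟩
  have := mem_weightLocus_of_wedge (w := 0) (w' := 0) (wedge_inclZ_ne_zero h0) hω
    (fun a b => by rw [← map_smul, ← map_smul, ← map_add, qForm_inclZ, hz])
    (fun t => by rw [torusMap_inclZ, charVal_zero, Units.val_one, one_smul])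
    (fun t => by rw [torusMap_inclZ, charVal_zero, Units.val_one, one_smul])
  rwa [add_zero, neg_zero] at this

theorem weightLocus_cases {w : M2} {ω : ℙ ℂ (⋀[ℂ]^2 (V m))} (hω : ω ∈ weightLocus m w) :
    (∃ α β, ∃ h : α ≠ β, β ≠ α.swap ∧ w = -(wt α + wt β) ∧ ω = axisPoint m α β h) ∨
    (∃ α, w = -wt α ∧ ω ∈ axisQuadric m α) ∨ (w = 0 ∧ ω ∈ centralLines m) := by
  rcases fixedLocus_cases (weightLocus_subset_fixedLocus w hω) with
    ⟨α, β, h, h', hs⟩ | ⟨α, h⟩ | h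
  · have he : axisPoint m α β h = ω := (mk_eq_iff_submodule _).2 hs
    exact Or.inl ⟨α, β, h, h', weightLocus_disjoint hω (he ▸ axisPoint_mem h h'), he.symm⟩
  · exact Or.inr (Or.inl ⟨α, weightLocus_disjoint hω (axisQuadric_subset α h), h⟩)
  · exact Or.inr (Or.inr ⟨weightLocus_disjoint hω (centralLines_subset h), h⟩)

/-- The twelve admissible pairs have twelve different weight sums, so each weight carries at most
one point of this kind. -/
theorem wt_pair_unique {α β α' β' : Fin 3 ⊕ Fin 3} (h : α ≠ β) (h' : β ≠ α.swap) (k : α' ≠ β')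
    (k' : β' ≠ α'.swap) (he : wt α + wt β = wt α' + wt β') :
    (α' = α ∧ β' = β) ∨ (α' = β ∧ β' = α) := by
  have := congrArg coordM2 he
  rw [map_add, map_add, coordM2_wt, coordM2_wt, coordM2_wt, coordM2_wt] at this
  clear he
  revert α β α' β'
  decide

theorem wt_pair_ne_zero {α β : Fin 3 ⊕ Fin 3} (h' : β ≠ α.swap) : wt α + wt β ≠ 0 := by
  intro he
  have := congrArg coordM2 he
  rw [map_add, map_zero, coordM2_wt, coordM2_wt] at this
  clear he
  revert α β
  decide

/-- For {i, j, k} = {1, 2, 3} one has eₖ = -(eᵢ + eⱼ); this is the origin of the isolated points of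
weight ±eₖ. -/
theorem exists_pair_of_wt (γ : Fin 3 ⊕ Fin 3) :
    ∃ α β, α ≠ β ∧ β ≠ α.swap ∧ wt γ = -(wt α + wt β) := by
  have : ∃ α β, α ≠ β ∧ β ≠ α.swap ∧ coordWt γ = -(coordWt α + coordWt β) := by
    revert γ
    decide
  obtain ⟨α, β, h, h', he⟩ := this
  refine ⟨α, β, h, h', coordM2_injective ?_⟩
  rw [map_neg, map_add, coordM2_wt, coordM2_wt, coordM2_wt, he]

theorem wt_swap (α : Fin 3 ⊕ Fin 3) : wt α.swap = -wt α := by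
  rcases α with i | i <;> simp [wt]

theorem coordM2_e_sub (i j : Fin 3) :
    coordM2 (e i - e j) = coordWt (Sum.inl i) + coordWt (Sum.inr j) := by
  rw [← coordM2_wt, ← coordM2_wt, ← map_add, sub_eq_add_neg]
  rfl

theorem e_sub_ne_wt {i j : Fin 3} (h : i ≠ j) (γ : Fin 3 ⊕ Fin 3) : e i - e j ≠ wt γ := by
  intro he
  have := congrArg coordM2 he
  rw [coordM2_e_sub, coordM2_wt] at this
  clear he
  revert i j γ
  decide

theorem e_sub_ne_zero {i j : Fin 3} (h : i ≠ j) : e i - e j ≠ 0 := by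
  intro he
  have := congrArg coordM2 he
  rw [coordM2_e_sub, map_zero] at this
  clear he
  revert i j
  decide

/-- One basis vector of each kind gives a root; two of the same kind give ±(eᵢ + eⱼ), which is ∓eₖ.
-/
theorem wt_pair_cases {α β : Fin 3 ⊕ Fin 3} (h : α ≠ β) (h' : β ≠ α.swap) :
    (∃ i j, i ≠ j ∧ -(wt α + wt β) = e i - e j) ∨ ∃ γ, -(wt α + wt β) = wt γ := by
  have : (∃ i j : Fin 3, i ≠ j ∧
      -(coordWt α + coordWt β) = coordWt (Sum.inl i) + coordWt (Sum.inr j)) ∨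
      ∃ γ, -(coordWt α + coordWt β) = coordWt γ := by
    revert α β
    decide
  rcases this with ⟨i, j, hij, he⟩ | ⟨γ, he⟩
  · refine Or.inl ⟨i, j, hij, coordM2_injective ?_⟩
    rw [map_neg, map_add, coordM2_wt, coordM2_wt, coordM2_e_sub, he]
  · refine Or.inr ⟨γ, coordM2_injective ?_⟩
    rw [map_neg, map_add, coordM2_wt, coordM2_wt, coordM2_wt, he]

theorem exists_wt_iff {w : M2} : (∃ i, w = e i ∨ w = -e i) ↔ ∃ γ, w = wt γ := by
  constructor
  · rintro ⟨i, rfl | rfl⟩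
    · exact ⟨Sum.inl i, rfl⟩
    · exact ⟨Sum.inr i, rfl⟩
  · rintro ⟨i | i, rfl⟩
    · exact ⟨i, Or.inl rfl⟩
    · exact ⟨i, Or.inr rfl⟩

theorem axisPoint_eq_of_wt {α β α' β' : Fin 3 ⊕ Fin 3} (h : α ≠ β) (h' : β ≠ α.swap) (k : α' ≠ β')
    (k' : β' ≠ α'.swap) (he : wt α + wt β = wt α' + wt β') :
    axisPoint m α' β' k = axisPoint m α β h := by
  rcases wt_pair_unique h h' k k' he with ⟨rfl, rfl⟩ | ⟨rfl, rfl⟩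
  · rfl
  · rw [axisPoint, mk_eq_iff_submodule, axisPoint_submodule, span_wedge_swap]

theorem weightLocus_e_sub {i j : Fin 3} (h : i ≠ j) :
    ∃ ω, weightLocus m (e i - e j) = {ω} := by
  have h1 : (Sum.inr i : Fin 3 ⊕ Fin 3) ≠ Sum.inl j := by simp
  have h2 : (Sum.inl j : Fin 3 ⊕ Fin 3) ≠ Sum.swap (Sum.inr i) := by
    intro he
    exact h (Sum.inl_injective he).symm
  have hw : e i - e j = -(wt (Sum.inr i) + wt (Sum.inl j)) := by
    simp [wt, sub_eq_add_neg, add_comm]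
  refine ⟨axisPoint m _ _ h1, Set.Subset.antisymm (fun ω hω => ?_) ?_⟩
  · rcases weightLocus_cases hω with ⟨α, β, k, k', he, rfl⟩ | ⟨α, he, -⟩ | ⟨he, -⟩
    · rw [hw, neg_inj] at he
      exact axisPoint_eq_of_wt h1 h2 k k' he
    · rw [← wt_swap] at he
      exact (e_sub_ne_wt h _ he).elim
    · exact (e_sub_ne_zero h he).elim
  · rintro _ rfl
    rw [hw]
    exact axisPoint_mem h1 h2

/-- The swap comes from the duality between L and ⋀²: the planes through the basis vector of index δ
and an isotropic z-vector have weight `-wt δ`. -/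
theorem weightLocus_wt (γ : Fin 3 ⊕ Fin 3) : ∃ α β, ∃ h : α ≠ β,
    weightLocus m (wt γ) = {axisPoint m α β h} ∪ axisQuadric m γ.swap := by
  obtain ⟨α, β, h, h', hw⟩ := exists_pair_of_wt γ
  refine ⟨α, β, h, Set.Subset.antisymm (fun ω hω => ?_) ?_⟩
  · rcases weightLocus_cases hω with ⟨α', β', k, k', he, rfl⟩ | ⟨α', he, hq⟩ | ⟨he, -⟩
    · rw [hw, neg_inj] at he
      exact Or.inl (axisPoint_eq_of_wt h h' k k' he)
    · rw [← wt_swap] at he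
      rw [wt_injective he, Sum.swap_swap]
      exact Or.inr hq
    · exact (wt_ne_zero γ he).elim
  · rintro _ (rfl | hq)
    · rw [hw]
      exact axisPoint_mem h h'
    · have := axisQuadric_subset _ hq
      rwa [wt_swap, neg_neg] at this

theorem weightLocus_zero : weightLocus m 0 = centralLines m := by
  refine Set.Subset.antisymm (fun ω hω => ?_) centralLines_subset
  rcases weightLocus_cases hω with ⟨α, β, k, k', he, rfl⟩ | ⟨α, he, hq⟩ | ⟨-, hq⟩
  · exact (wt_pair_ne_zero k' (neg_eq_zero.1 he.symm)).elim
  · exact (wt_ne_zero α (neg_eq_zero.1 he.symm)).elim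
  · exact hq

theorem weight_cases {w : M2} (hw : (weightLocus m w).Nonempty) :
    (∃ i j, i ≠ j ∧ w = e i - e j) ∨ (∃ γ, w = wt γ) ∨ w = 0 := by
  obtain ⟨ω, hω⟩ := hw
  rcases weightLocus_cases hω with ⟨α, β, k, k', rfl, -⟩ | ⟨α, rfl, -⟩ | ⟨rfl, -⟩
  · rcases wt_pair_cases k k' with h | h
    · exact Or.inl h
    · exact Or.inr (Or.inl h)
  · exact Or.inr (Or.inl ⟨α.swap, (wt_swap α).symm⟩)
  · exact Or.inr (Or.inr rfl)

theorem fixedLocus_eq_iUnion : fixedLocus m = ⋃ w, weightLocus m w := by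
  refine Set.Subset.antisymm (fun ω hω => ?_)
    (Set.iUnion_subset fun w => weightLocus_subset_fixedLocus w)
  rcases fixedLocus_cases hω with ⟨α, β, h, h', hs⟩ | ⟨α, h⟩ | h
  · have he : axisPoint m α β h = ω := (mk_eq_iff_submodule _).2 hs
    exact Set.mem_iUnion.2 ⟨_, he ▸ axisPoint_mem h h'⟩
  · exact Set.mem_iUnion.2 ⟨_, axisQuadric_subset α h⟩
  · exact Set.mem_iUnion.2 ⟨_, centralLines_subset h⟩

theorem finite_weights : {w : M2 | (weightLocus m w).Nonempty}.Finite := by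
  refine Set.Finite.subset (((Set.finite_range fun p : Fin 3 × Fin 3 => e p.1 - e p.2).union
    (Set.finite_range wt)).union (Set.finite_singleton 0)) fun w hw => ?_
  rcases weight_cases hw with ⟨i, j, -, rfl⟩ | ⟨γ, rfl⟩ | rfl
  · exact Or.inl (Or.inl ⟨(i, j), rfl⟩)
  · exact Or.inl (Or.inr ⟨γ, rfl⟩)
  · exact Or.inr rfl

/-- The points of `ℙ(⋀² V_m)` in the eigenspace of a generic element that belongs to a weight. -/
def eigenLocus (m : ℕ) (w : M2) : Set (ℙ ℂ (⋀[ℂ]^2 (V m))) :=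
  {ω | ω.submodule ≤ Module.End.eigenspace (torusAction m genericElt)
    (charVal (-w) genericElt : ℂ)}

theorem isClosed_eigenLocus (w : M2) : IsClosed[(pluckerSpace m).top] (eigenLocus m w) :=
  isClosed_le_submodule _

theorem weightLocus_subset_eigenLocus (w : M2) : weightLocus m w ⊆ eigenLocus m w :=
  fun _ h v hv => Module.End.mem_eigenspace_iff.2 ((mem_weightLocus_iff.1 h).2 genericElt v hv)

theorem eigenLocus_unique {w w' : M2} {ω : ℙ ℂ (⋀[ℂ]^2 (V m))} (h : ω ∈ eigenLocus m w)
    (h' : ω ∈ eigenLocus m w') : w = w' := by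
  have h1 := Module.End.mem_eigenspace_iff.1 (h (rep_mem_submodule ω))
  have h2 := Module.End.mem_eigenspace_iff.1 (h' (rep_mem_submodule ω))
  rw [h1] at h2
  exact neg_injective (charVal_genericElt_injective (smul_left_injective ℂ ω.rep_nonzero h2))

/-- The fixed locus is covered by finitely many closed eigenloci, so an irreducible subset lies in
one of them; as eigenloci of different weights are disjoint, all its points have that weight. -/
theorem exists_weight_of_isIrreducible {T : Set (ℙ ℂ (⋀[ℂ]^2 (V m)))} (hT : T ⊆ fixedLocus m)
    (hTi : @IsIrreducible (pluckerSpace m).Pt (pluckerSpace m).top T) :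
    ∃ w, T ⊆ weightLocus m w := by
  obtain ⟨w, -, hw⟩ := exists_subset_of_isIrreducible finite_weights (C := eigenLocus m)
    (fun w _ => isClosed_eigenLocus w) hTi (by
      intro ω hω
      have := hT hω
      rw [fixedLocus_eq_iUnion] at this
      obtain ⟨w, hw⟩ := Set.mem_iUnion.1 this
      exact Set.mem_iUnion₂.2 ⟨w, ⟨ω, hw⟩, weightLocus_subset_eigenLocus w hw⟩)
  refine ⟨w, fun ω hω => ?_⟩
  have := hT hω
  rw [fixedLocus_eq_iUnion] at this
  obtain ⟨w', hw'⟩ := Set.mem_iUnion.1 this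
  rwa [eigenLocus_unique (hw hω) (weightLocus_subset_eigenLocus w' hw')]

/-- Reduces the determination of the components to one weight locus at a time. -/
theorem componentsOfWeight_eq (w : M2) :
    componentsOfWeight m w = (pluckerSpace m).components (weightLocus m w) :=
  (components_of_piece (X := pluckerSpace m) weightLocus_subset_fixedLocus
    (fun _ _ _ => weightLocus_disjoint) (fun _ => exists_weight_of_isIrreducible) w).symm

theorem existsUnique_weight {Y : Set (ℙ ℂ (⋀[ℂ]^2 (V m)))} (hY : Y ∈ fixedComponents m) :
    ∃! w : M2, Y ∈ componentsOfWeight m w := by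
  obtain ⟨w, hw⟩ := exists_weight_of_isIrreducible (subset_of_mem_components hY)
    (isIrreducible_of_mem_components hY)
  obtain ⟨y, hy⟩ := (isIrreducible_of_mem_components hY).1
  exact ⟨w, ⟨hY, hw⟩, fun w' hw' => weightLocus_disjoint (hw'.2 hy) (hw hy)⟩

end Weights

/-! ### The pieces of the fixed locus and their irreducibility -/

section Pieces

/-- The symmetric bilinear form `∑ xⱼ yⱼ`. -/
def dotForm (k : ℕ) : LinearMap.BilinForm ℂ (Fin k → ℂ) :=
  LinearMap.mk₂ ℂ (· ⬝ᵥ ·) add_dotProduct smul_dotProduct dotProduct_add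
    fun c x y => dotProduct_smul c x y

theorem dotForm_apply (k : ℕ) (x y : Fin k → ℂ) : dotForm k x y = x ⬝ᵥ y := rfl

theorem dotForm_symm (k : ℕ) (x y : Fin k → ℂ) : dotForm k x y = dotForm k y x :=
  dotProduct_comm x y

theorem dotForm_nondegenerate (k : ℕ) : (dotForm k).Nondegenerate := by
  constructor
  · intro x h
    ext j
    simpa [dotForm_apply] using h (Pi.single j 1)
  · intro x h
    ext j
    simpa [dotForm_apply] using h (Pi.single j 1)

theorem sumSq_eq (k : ℕ) : sumSq k = fun z => dotForm k z z := by
  funext z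
  simp [sumSq, dotForm_apply, dotProduct, sq]

theorem mk_mem_quadric_sumSq {k : ℕ} {z : Fin k → ℂ} (hz : z ≠ 0) :
    Projectivization.mk ℂ z hz ∈ quadric (sumSq k) ↔ sumSq k z = 0 := by
  rw [sumSq_eq]
  exact mk_mem_quadric_iff hz

theorem mem_quadric_sumSq {k : ℕ} {p : ℙ ℂ (Fin k → ℂ)} :
    p ∈ quadric (sumSq k) ↔ sumSq k p.rep = 0 := by
  rw [sumSq_eq]
  exact mem_quadric_iff_rep

/-- The isotropic vector `eₐ + i e_b`. -/
theorem sumSq_single_add {k : ℕ} {a b : Fin k} (h : a ≠ b) (c : ℂ) :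
    sumSq k (c • (Pi.single a 1 + Complex.I • Pi.single b 1)) = 0 := by
  rw [sumSq_smul, sumSq_eq]
  simp [dotForm_apply, dotProduct_add, h, h.symm]

theorem isIrreducible_quadric_sumSq {k : ℕ} (hk : 3 ≤ k) :
    @IsIrreducible _ (projSpace (Fin k → ℂ)).top (quadric (sumSq k)) := by
  have hne : (quadric (sumSq k)).Nonempty := by
    let a : Fin k := ⟨0, by omega⟩
    let b : Fin k := ⟨1, by omega⟩
    have hab : a ≠ b := by simp [a, b]
    have h0 : (Pi.single a 1 + Complex.I • Pi.single b 1 : Fin k → ℂ) ≠ 0 := by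
      intro h
      have := congrFun h a
      simp [hab] at this
    refine ⟨_, (mk_mem_quadric_sumSq h0).2 ?_⟩
    simpa using sumSq_single_add hab 1
  rw [sumSq_eq] at hne ⊢
  exact isIrreducible_quadric (dotForm_nondegenerate k) (dotForm_symm k) (by simpa using hk) hne

theorem isIrreducible_linesIn_sumSq {k : ℕ} (hk : 5 ≤ k) :
    @IsIrreducible _ (projSpace (⋀[ℂ]^2 (Fin k → ℂ))).top (linesIn (quadric (sumSq k))) := by
  have hne : (linesIn (quadric (sumSq k))).Nonempty := by
    let a : Fin k := ⟨0, by omega⟩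
    let b : Fin k := ⟨1, by omega⟩
    let c : Fin k := ⟨2, by omega⟩
    let d : Fin k := ⟨3, by omega⟩
    have hab : a ≠ b := by simp [a, b]
    have hac : a ≠ c := by simp [a, c]
    have had : a ≠ d := by simp [a, d]
    have hbc : b ≠ c := by simp [b, c]
    have hbd : b ≠ d := by simp [b, d]
    have hcd : c ≠ d := by simp [c, d]
    have h0 : wedge (Fin k → ℂ) (Pi.single a 1 + Complex.I • Pi.single b 1)
        (Pi.single c 1 + Complex.I • Pi.single d 1) ≠ 0 := by
      refine wedge_ne_zero_of_duals (α := LinearMap.proj a) (β := LinearMap.proj c) ?_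
      simp [hab, hac, had, hcd, hbc.symm, hac.symm]
    refine ⟨Projectivization.mk ℂ _ h0, (mem_linesIn_quadric (sumSq_zero k)).2
      ⟨_, _, h0, Projectivization.submodule_mk _ _, fun x y => ?_⟩⟩
    rw [sumSq_eq]
    simp [dotForm_apply, dotProduct_add, hab, hac, had, hbc, hbd, hcd, hab.symm,
      hac.symm, had.symm, hbc.symm, hbd.symm, hcd.symm]
    linear_combination (x * x + y * y) * Complex.I_mul_I
  rw [sumSq_eq] at hne ⊢
  exact isIrreducible_linesIn_quadric (dotForm_nondegenerate k) (dotForm_symm k)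
    (by simpa using hk) hne

/-- There are no isotropic planes in dimension less than four. -/
theorem four_le_of_isotropic {k : ℕ} {z z' : Fin k → ℂ} (h0 : wedge _ z z' ≠ 0)
    (h : ∀ a b : ℂ, sumSq k (a • z + b • z') = 0) : 4 ≤ k := by
  rw [sumSq_eq] at h
  obtain ⟨h1, h2, h3⟩ := isotropic_of_combination (dotForm_symm k) h
  have hle : Submodule.span ℂ {z, z'} ≤ (dotForm k).orthogonal (Submodule.span ℂ {z, z'}) := by
    intro x hx y hy
    obtain ⟨a, b, rfl⟩ := Submodule.mem_span_pair.1 hx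
    obtain ⟨c, d, rfl⟩ := Submodule.mem_span_pair.1 hy
    simp [h1, h2, h3, dotForm_symm k z' z]
  have hrank : Module.finrank ℂ (Submodule.span ℂ {z, z'}) = 2 := by
    have := finrank_span_eq_card (wedge_ne_zero_iff.1 h0)
    rwa [Matrix.range_cons_cons_empty, Fintype.card_fin] at this
  -- An isotropic plane lies in its own orthogonal complement, so 2 ≤ k - 2.
  have h4 := Submodule.finrank_mono hle
  rw [LinearMap.BilinForm.finrank_orthogonal (dotForm_nondegenerate k), hrank,
    Module.finrank_fin_fun] at h4
  omega

section Spans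

variable {E F : Type} [AddCommGroup E] [Module ℂ E] [AddCommGroup F] [Module ℂ F]

theorem span_linear_rep (ν : E →ₗ[ℂ] F) {p : ℙ ℂ E} {v : E}
    (h : p.submodule = Submodule.span ℂ {v}) :
    Submodule.span ℂ {ν p.rep} = Submodule.span ℂ {ν v} := by
  have h1 := congrArg (Submodule.map ν) (p.submodule_eq.symm.trans h)
  rwa [Submodule.map_span, Submodule.map_span, Set.image_singleton, Set.image_singleton] at h1

theorem span_power_rep {b : ℕ} (ν : E → F) (hhom : ∀ (c : ℂ) (v : E), ν (c • v) = c ^ b • ν v)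
    {v : E} (hv : v ≠ 0) :
    Submodule.span ℂ {ν (Projectivization.mk ℂ v hv).rep} = Submodule.span ℂ {ν v} := by
  obtain ⟨a, ha⟩ := Projectivization.exists_smul_eq_mk_rep ℂ v hv
  rw [← ha, Units.smul_def, hhom, Submodule.span_singleton_smul_eq
    (IsUnit.mk0 _ (pow_ne_zero _ a.ne_zero))]

end Spans

variable {m : ℕ}

/-- The embedding of the space of coordinates `zⱼ` in `⋀² V_m` given by a basis vector. -/
def axisWedge (m : ℕ) (α : Fin 3 ⊕ Fin 3) : (Fin (m - 6) → ℂ) →ₗ[ℂ] ⋀[ℂ]^2 (V m) :=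
  wedge (V m) (axis m α) ∘ₗ inclZ m

theorem mem_axisQuadric_iff {α : Fin 3 ⊕ Fin 3} {p : ℙ ℂ (⋀[ℂ]^2 (V m))} :
    p ∈ axisQuadric m α ↔
      ∃ z ∈ smallQuadric m, p.submodule = Submodule.span ℂ {axisWedge m α z.rep} := by
  constructor
  · rintro ⟨z, hz0, hz, hp⟩
    refine ⟨Projectivization.mk ℂ z hz0, (mk_mem_quadric_sumSq hz0).2 hz, ?_⟩
    rw [span_linear_rep (axisWedge m α) (Projectivization.submodule_mk z hz0)]
    exact hp
  · rintro ⟨z, hz, hp⟩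
    exact ⟨z.rep, z.rep_nonzero, mem_quadric_sumSq.1 hz, hp⟩

/-- Wedging with a fixed basis vector is an injective linear map on the zⱼ-space, so it embeds the
quadric linearly and matches 𝒪(1) with 𝒪(1). -/
theorem nonempty_axisQuadric_iso (α : Fin 3 ⊕ Fin 3) :
    Nonempty ((restrictL m (axisQuadric m α)).Iso (smallQuadricO1 m)) := by
  have hinj : LinearMap.ker (axisWedge m α) = ⊥ := by
    rw [eq_bot_iff]
    intro z hz
    by_contra h
    exact wedge_axis_inclZ_ne_zero α h hz
  obtain ⟨σ, hσ⟩ := (axisWedge m α).exists_leftInverse_of_injective hinj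
  exact nonempty_iso_of_linear (axisWedge m α) σ (fun v => LinearMap.congr_fun hσ v)
    (smallQuadric m) (axisQuadric m α) fun p => mem_axisQuadric_iff

theorem isIrreducible_axisQuadric (hm : 9 ≤ m) (α : Fin 3 ⊕ Fin 3) :
    @IsIrreducible _ (pluckerSpace m).top (axisQuadric m α) := by
  obtain ⟨φ⟩ := nonempty_axisQuadric_iso (m := m) α
  exact isIrreducible_of_restrict_iso φ.base (isIrreducible_quadric_sumSq (by omega))

theorem mem_centralLines_iff {p : ℙ ℂ (⋀[ℂ]^2 (V m))} : p ∈ centralLines m ↔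
    ∃ z ∈ linesIn (smallQuadric m),
      p.submodule = Submodule.span ℂ {exteriorPower.map 2 (inclZ m) z.rep} := by
  constructor
  · rintro ⟨z, z', h0, hz, hp⟩
    refine ⟨Projectivization.mk ℂ _ h0, (mem_linesIn_quadric (sumSq_zero _)).2
      ⟨z, z', h0, Projectivization.submodule_mk _ _, hz⟩, ?_⟩
    rw [span_linear_rep (exteriorPower.map 2 (inclZ m)) (Projectivization.submodule_mk _ h0),
      map_wedge]
    exact hp
  · rintro ⟨ω, hω, hp⟩
    obtain ⟨z, z', h0, hs, hz⟩ := (mem_linesIn_quadric (sumSq_zero _)).1 hω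
    refine ⟨z, z', h0, hz, ?_⟩
    rw [hp, span_linear_rep (exteriorPower.map 2 (inclZ m)) hs, map_wedge]

theorem map_projZ_map_inclZ (x : ⋀[ℂ]^2 (Fin (m - 6) → ℂ)) :
    exteriorPower.map 2 (projZ m) (exteriorPower.map 2 (inclZ m) x) = x := by
  have h : projZ m ∘ₗ inclZ m = LinearMap.id := rfl
  rw [← LinearMap.comp_apply, ← exteriorPower.map_comp, h, exteriorPower.map_id,
    LinearMap.id_apply]

theorem nonempty_centralLines_iso : Nonempty ((subvar m (centralLines m)).Iso (smallG m)) := by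
  obtain ⟨φ⟩ := nonempty_iso_of_linear (exteriorPower.map 2 (inclZ m))
    (exteriorPower.map 2 (projZ m)) map_projZ_map_inclZ (linesIn (smallQuadric m))
    (centralLines m) fun p => mem_centralLines_iff
  exact ⟨φ.base⟩

theorem isIrreducible_centralLines (hm : 11 ≤ m) :
    @IsIrreducible _ (pluckerSpace m).top (centralLines m) := by
  obtain ⟨φ⟩ := nonempty_centralLines_iso (m := m)
  exact isIrreducible_of_restrict_iso φ (isIrreducible_linesIn_sumSq (by omega))

theorem centralLines_eq_empty (hm : m < 10) : centralLines m = ∅ := by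
  rw [Set.eq_empty_iff_forall_notMem]
  rintro ω ⟨z, z', h0, hz, -⟩
  have := four_le_of_isotropic h0 hz
  omega

theorem axisQuadric_eq_empty (hm : m < 8) (α : Fin 3 ⊕ Fin 3) : axisQuadric m α = ∅ := by
  rw [Set.eq_empty_iff_forall_notMem]
  rintro ω ⟨z, hz0, hz, -⟩
  obtain ⟨j, hj⟩ := Function.ne_iff.1 hz0
  -- For m < 8 there is at most one coordinate zⱼ, and a single square vanishes only at 0.
  have : ∀ i, i = j := fun i => by omega
  rw [sumSq, Finset.sum_eq_single j (fun i _ hi => (hi (this i)).elim) (by simp)] at hz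
  exact hj (pow_eq_zero_iff two_ne_zero |>.1 hz)

/-- The Plücker coordinate of the pair `α`, `β` is nonzero here but vanishes on every `axisQuadric`;
its zero locus is the closed set that separates the isolated point from the quadric. -/
theorem axisPoint_notMem (α β : Fin 3 ⊕ Fin 3) (h : α ≠ β) :
    axisPoint m α β h ∉ {ω : ℙ ℂ (⋀[ℂ]^2 (V m)) | ω.submodule ≤ LinearMap.ker
      (wedgeDual (LinearMap.proj (axisIdx m α)) (LinearMap.proj (axisIdx m β)))} := by
  intro hle
  have hm := hle ((axisPoint_submodule h).ge (Submodule.mem_span_singleton_self _))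
  rw [LinearMap.mem_ker, wedgeDual_wedge] at hm
  simp [axis_axisIdx, h] at hm

theorem axisQuadric_subset_ker (α β γ : Fin 3 ⊕ Fin 3) :
    axisQuadric m γ ⊆ {ω : ℙ ℂ (⋀[ℂ]^2 (V m)) | ω.submodule ≤ LinearMap.ker
      (wedgeDual (LinearMap.proj (axisIdx m α)) (LinearMap.proj (axisIdx m β)))} := by
  rintro ω ⟨z, -, -, hω⟩
  change ω.submodule ≤ _
  rw [hω, Submodule.span_singleton_le_iff_mem, LinearMap.mem_ker, wedgeDual_wedge]
  simp [inclZ_axisIdx]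

theorem componentsOfWeight_wt (γ : Fin 3 ⊕ Fin 3) : ∃ ω, ω ∉ axisQuadric m γ.swap ∧
    componentsOfWeight m (wt γ) =
      insert {ω} ((pluckerSpace m).components (axisQuadric m γ.swap)) := by
  obtain ⟨α, β, h, hw⟩ := weightLocus_wt (m := m) γ
  have hnot := axisPoint_notMem (m := m) α β h
  have hsub := axisQuadric_subset_ker (m := m) α β γ.swap
  refine ⟨axisPoint m α β h, fun hmem => hnot (hsub hmem), ?_⟩
  rw [componentsOfWeight_eq, hw, components_union (X := pluckerSpace m) (isClosed_singleton _)
    (isClosed_le_submodule _) subset_rfl hsub (by rintro _ rfl; exact hnot)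
    (by rintro x hx rfl; exact hnot (hsub hx)), components_singleton, Set.singleton_union]

theorem componentsOfWeight_e_sub {i j : Fin 3} (h : i ≠ j) :
    ∃ ω, componentsOfWeight m (e i - e j) = {{ω}} := by
  obtain ⟨ω, hω⟩ := weightLocus_e_sub (m := m) h
  exact ⟨ω, by rw [componentsOfWeight_eq, hω, components_singleton]⟩

end Pieces

/-! ### Quadrics in two, three and four variables -/

section LowDimension

variable {E F : Type} [AddCommGroup E] [Module ℂ E] [AddCommGroup F] [Module ℂ F]

/-- Expanding the first argument in the standard basis gives a sum of products of two linear forms.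
-/
theorem bilinear_mem_polyFun {k : ℕ} (B : (Fin k → ℂ) →ₗ[ℂ] E →ₗ[ℂ] F) (l : Module.Dual ℂ F) :
    (fun z : (Fin k → ℂ) × E => l (B z.1 z.2)) ∈ polyFun ((Fin k → ℂ) × E) := by
  have h : (fun z : (Fin k → ℂ) × E => l (B z.1 z.2)) = ∑ i,
      (fun z => (LinearMap.proj i ∘ₗ LinearMap.fst ℂ (Fin k → ℂ) E) z) *
        (fun z => (l ∘ₗ B (Pi.single i 1) ∘ₗ LinearMap.snd ℂ (Fin k → ℂ) E) z) := by
    funext z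
    conv_lhs => rw [pi_eq_sum_univ' z.1]
    simp
  rw [h]
  exact sum_mem fun i _ => mul_mem (dual_mem_polyFun _) (dual_mem_polyFun _)

theorem bilinear_diag_mem_polyFun {k : ℕ} (B : (Fin k → ℂ) →ₗ[ℂ] (Fin k → ℂ) →ₗ[ℂ] F)
    (l : Module.Dual ℂ F) : (fun v => l (B v v)) ∈ polyFun (Fin k → ℂ) :=
  linear_comp_mem_polyFun (LinearMap.prod LinearMap.id LinearMap.id) (bilinear_mem_polyFun B l)

theorem ne_zero_fin_two {v : Fin 2 → ℂ} (hv : v ≠ 0) : ∃ i, v i ≠ 0 := Function.ne_iff.1 hv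

/-! ### Dimension two and three -/

theorem isotropic_fin_two {z : Fin 2 → ℂ} (h : sumSq 2 z = 0) :
    z = z 0 • ![1, Complex.I] ∨ z = z 0 • ![1, -Complex.I] := by
  rw [sumSq, Fin.sum_univ_two] at h
  have h1 : (z 1 - z 0 * Complex.I) * (z 1 + z 0 * Complex.I) = 0 := by
    linear_combination h - z 0 ^ 2 * Complex.I_mul_I
  rcases mul_eq_zero.1 h1 with h2 | h2
  · left
    ext i
    fin_cases i
    · simp
    · simpa using sub_eq_zero.1 h2
  · right
    ext i
    fin_cases i
    · simp
    · simpa using eq_neg_of_add_eq_zero_left h2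

theorem axisQuadric_eight (α : Fin 3 ⊕ Fin 3) : ∃ a b, a ≠ b ∧ axisQuadric 8 α = {a, b} := by
  have hp : (![1, Complex.I] : Fin 2 → ℂ) ≠ 0 := fun h => one_ne_zero (congrFun h 0)
  have hn : (![1, -Complex.I] : Fin 2 → ℂ) ≠ 0 := fun h => one_ne_zero (congrFun h 0)
  have hp' := wedge_axis_inclZ_ne_zero (m := 8) α hp
  have hn' := wedge_axis_inclZ_ne_zero (m := 8) α hn
  refine ⟨Projectivization.mk ℂ _ hp', Projectivization.mk ℂ _ hn', fun h => ?_, ?_⟩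
  · obtain ⟨c, hc⟩ := (Projectivization.mk_eq_mk_iff' ..).1 h
    rw [← map_smul, ← map_smul, ← sub_eq_zero, ← map_sub, ← map_sub] at hc
    have h0 := of_not_not fun h0 => wedge_axis_inclZ_ne_zero (m := 8) α h0 hc
    have h1 : c - 1 = 0 := by simpa using congrFun h0 (0 : Fin 2)
    have h2 : c * -Complex.I - Complex.I = 0 := by simpa using congrFun h0 (1 : Fin 2)
    exact Complex.I_ne_zero (by linear_combination -(1 / 2) * (h2 + Complex.I * h1))
  · ext ω
    rw [Set.mem_insert_iff, Set.mem_singleton_iff, eq_comm (a := ω), eq_comm (a := ω),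
      mk_eq_iff_submodule, mk_eq_iff_submodule]
    constructor
    · rintro ⟨z, hz0, hz, hω⟩
      have key : ∀ x : Fin (8 - 6) → ℂ, z = z (0 : Fin 2) • x →
          ω.submodule = Submodule.span ℂ {wedge (V 8) (axis 8 α) (inclZ 8 x)} := by
        intro x hx
        have h0 : z (0 : Fin 2) ≠ 0 := by
          intro h0
          rw [h0, zero_smul] at hx
          exact hz0 hx
        have h1 := Submodule.span_singleton_smul_eq (IsUnit.mk0 _ h0)
          (wedge (V 8) (axis 8 α) (inclZ 8 x))
        rw [← map_smul, ← map_smul, ← hx] at h1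
        rw [hω, h1]
      rcases isotropic_fin_two hz with h | h
      · exact Or.inl (key _ h)
      · exact Or.inr (key _ h)
    · rintro (h | h)
      · exact ⟨_, hp, by simp [sumSq], h⟩
      · exact ⟨_, hn, by simp [sumSq], h⟩

/-- The bilinear form of the parametrisation of the conic `z₁² + z₂² + z₃² = 0`. -/
def conicMap : (Fin 2 → ℂ) →ₗ[ℂ] (Fin 2 → ℂ) →ₗ[ℂ] (Fin 3 → ℂ) :=
  LinearMap.mk₂ ℂ (fun v w => ![v 0 * w 0 - v 1 * w 1, v 0 * w 1 + v 1 * w 0,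
      Complex.I * (v 0 * w 0 + v 1 * w 1)])
    (by intro a b c; ext i; fin_cases i <;> simp <;> ring)
    (by intro a b c; ext i; fin_cases i <;> simp <;> ring)
    (by intro a b c; ext i; fin_cases i <;> simp <;> ring)
    (by intro a b c; ext i; fin_cases i <;> simp <;> ring)

theorem conicMap_apply (v w : Fin 2 → ℂ) : conicMap v w =
    ![v 0 * w 0 - v 1 * w 1, v 0 * w 1 + v 1 * w 0, Complex.I * (v 0 * w 0 + v 1 * w 1)] := rfl

theorem isotropic_fin_three {z : Fin 3 → ℂ} : sumSq 3 z = 0 ↔ ∃ v, z = conicMap v v := by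
  constructor
  · intro h
    rw [sumSq, Fin.sum_univ_three] at h
    -- On the parametrised conic z₀ - i z₂ = 2s² and z₀ + i z₂ = -2t². The equation of the conic
    -- then gives z₁² = 4s²t², and the sign in z₁ = ±2st is absorbed into t.
    obtain ⟨s, hs⟩ := IsAlgClosed.exists_pow_nat_eq ((z 0 - Complex.I * z 2) / 2) two_pos
    obtain ⟨t, ht⟩ := IsAlgClosed.exists_pow_nat_eq (-(z 0 + Complex.I * z 2) / 2) two_pos
    have h1 : (z 1 - 2 * s * t) * (z 1 + 2 * s * t) = 0 := by
      linear_combination h - 4 * t ^ 2 * hs - 2 * (z 0 - Complex.I * z 2) * ht -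
        z 2 ^ 2 * Complex.I_mul_I
    rcases mul_eq_zero.1 h1 with h2 | h2
    · refine ⟨![s, t], ?_⟩
      rw [conicMap_apply]
      ext i
      fin_cases i <;> simp
      · linear_combination -hs + ht
      · linear_combination h2
      · linear_combination -Complex.I * (hs + ht) + z 2 * Complex.I_mul_I
    · refine ⟨![s, -t], ?_⟩
      rw [conicMap_apply]
      ext i
      fin_cases i <;> simp
      · linear_combination -hs + ht
      · linear_combination h2
      · linear_combination -Complex.I * (hs + ht) + z 2 * Complex.I_mul_I
  · rintro ⟨v, rfl⟩
    rw [sumSq, Fin.sum_univ_three, conicMap_apply]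
    simp
    linear_combination (v 0 ^ 2 + v 1 ^ 2) ^ 2 * Complex.I_mul_I

theorem nonempty_conic_iso : Nonempty
    (((bundleO (Fin 3 → ℂ) 1).restrict (quadric (sumSq 3))).Iso (bundleO (Fin 2 → ℂ) 2)) := by
  have hhom : ∀ (c : ℂ) (v : Fin 2 → ℂ), conicMap (c • v) (c • v) = c ^ 2 • conicMap v v := by
    intro c v
    rw [LinearMap.map_smul₂, map_smul, smul_smul, sq]
  refine nonempty_iso_of_power_univ 1 (fun v => conicMap v v) (bilinear_diag_mem_polyFun conicMap)
    hhom _ (fun p => ⟨fun hp => ?_, ?_⟩) fun y => ?_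
  · obtain ⟨v, hv⟩ := isotropic_fin_three.1 (mem_quadric_sumSq.1 hp)
    have hv0 : v ≠ 0 := by
      rintro rfl
      exact p.rep_nonzero (by simpa using hv)
    refine ⟨Projectivization.mk ℂ v hv0, ?_⟩
    rw [span_power_rep (fun v => conicMap v v) hhom, ← hv, p.submodule_eq]
  · rintro ⟨z, hz⟩ x hx
    obtain ⟨c, rfl⟩ := Submodule.mem_span_singleton.1 (hz ▸ hx)
    rw [sumSq_smul, isotropic_fin_three.2 ⟨_, rfl⟩, mul_zero]
  · obtain ⟨i, hi⟩ := ne_zero_fin_two y.rep_nonzero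
    fin_cases i
    -- Where v₀ ≠ 0, the linear forms (z₀ - i z₂)/2 = v₀² and z₁/2 = v₀v₁ recover v₀ · v, which is a
    -- local inverse; in the other chart (z₀ + i z₂)/2 = -v₁² is used in the same way.
    · let u : Module.Dual ℂ (Fin 3 → ℂ) :=
        (2⁻¹ : ℂ) • (LinearMap.proj 0 - Complex.I • LinearMap.proj 2)
      have hu : ∀ z : Fin 2 → ℂ, u (conicMap z z) = z 0 ^ 2 := by
        intro z
        simp [u, conicMap_apply]
        linear_combination -(2⁻¹ : ℂ) * (z 0 * z 0 + z 1 * z 1) * Complex.I_mul_I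
      refine ⟨LinearMap.pi ![u, (2⁻¹ : ℂ) • LinearMap.proj 1], fun z => z 0, u, hi, IsForm.dual u,
        fun z => ⟨?_, hu z⟩⟩
      ext i
      fin_cases i
      · simpa [sq] using hu z
      · simp [conicMap_apply]
        ring
    · let u : Module.Dual ℂ (Fin 3 → ℂ) :=
        -(2⁻¹ : ℂ) • (LinearMap.proj 0 + Complex.I • LinearMap.proj 2)
      have hu : ∀ z : Fin 2 → ℂ, u (conicMap z z) = z 1 ^ 2 := by
        intro z
        simp [u, conicMap_apply]
        linear_combination -(2⁻¹ : ℂ) * (z 0 * z 0 + z 1 * z 1) * Complex.I_mul_I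
      refine ⟨LinearMap.pi ![(2⁻¹ : ℂ) • LinearMap.proj 1, u], fun z => z 1, u, hi, IsForm.dual u,
        fun z => ⟨?_, hu z⟩⟩
      ext i
      fin_cases i
      · simp [conicMap_apply]
        ring
      · simpa [sq] using hu z

/-! ### Dimension four -/

/-- The Segre map onto the cone `z₁² + z₂² + z₃² + z₄² = 0`. -/
def segreMap : (Fin 2 → ℂ) →ₗ[ℂ] (Fin 2 → ℂ) →ₗ[ℂ] (Fin 4 → ℂ) :=
  LinearMap.mk₂ ℂ (fun v w => ![v 0 * w 0 + v 1 * w 1, -Complex.I * (v 0 * w 0 - v 1 * w 1),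
      v 0 * w 1 - v 1 * w 0, -Complex.I * (v 0 * w 1 + v 1 * w 0)])
    (by intro a b c; ext i; fin_cases i <;> simp <;> ring)
    (by intro a b c; ext i; fin_cases i <;> simp <;> ring)
    (by intro a b c; ext i; fin_cases i <;> simp <;> ring)
    (by intro a b c; ext i; fin_cases i <;> simp <;> ring)

theorem segreMap_apply (v w : Fin 2 → ℂ) : segreMap v w =
    ![v 0 * w 0 + v 1 * w 1, -Complex.I * (v 0 * w 0 - v 1 * w 1),
      v 0 * w 1 - v 1 * w 0, -Complex.I * (v 0 * w 1 + v 1 * w 0)] := rfl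

/-- The linear forms on `ℂ⁴` that pull back to `vᵢ wⱼ` under the Segre map. -/
def segreDual : Fin 2 → Fin 2 → Module.Dual ℂ (Fin 4 → ℂ) :=
  ![![(2⁻¹ : ℂ) • (LinearMap.proj 0 + Complex.I • LinearMap.proj 1),
      (2⁻¹ : ℂ) • (LinearMap.proj 2 + Complex.I • LinearMap.proj 3)],
    ![-(2⁻¹ : ℂ) • (LinearMap.proj 2 - Complex.I • LinearMap.proj 3),
      (2⁻¹ : ℂ) • (LinearMap.proj 0 - Complex.I • LinearMap.proj 1)]]

theorem segreDual_segreMap (i j : Fin 2) (v w : Fin 2 → ℂ) :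
    segreDual i j (segreMap v w) = v i * w j := by
  fin_cases i <;> fin_cases j <;> simp [segreDual, segreMap_apply]
  · linear_combination -(2⁻¹ : ℂ) * (v 0 * w 0 - v 1 * w 1) * Complex.I_mul_I
  · linear_combination -(2⁻¹ : ℂ) * (v 0 * w 1 + v 1 * w 0) * Complex.I_mul_I
  · linear_combination -(2⁻¹ : ℂ) * (v 0 * w 1 + v 1 * w 0) * Complex.I_mul_I
  · linear_combination (2⁻¹ : ℂ) * (v 0 * w 0 - v 1 * w 1) * Complex.I_mul_I

theorem segreDual_injective {z z' : Fin 4 → ℂ} (h : ∀ i j, segreDual i j z = segreDual i j z') :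
    z = z' := by
  have h00 := h 0 0
  have h01 := h 0 1
  have h10 := h 1 0
  have h11 := h 1 1
  simp [segreDual] at h00 h01 h10 h11
  ext i
  fin_cases i <;> simp
  · linear_combination h00 + (2⁻¹ : ℂ) * h11
  · linear_combination -Complex.I * (h00 - (2⁻¹ : ℂ) * h11) + (z 1 - z' 1) * Complex.I_mul_I
  · linear_combination h01 + (2⁻¹ : ℂ) * h10
  · linear_combination -Complex.I * (h01 - (2⁻¹ : ℂ) * h10) + (z 3 - z' 3) * Complex.I_mul_I

/-- In suitable linear coordinates the quadratic form is four times the determinant of a 2×2 matrix,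
so isotropic vectors are matrices of rank at most one. -/
theorem sumSq_four (z : Fin 4 → ℂ) : sumSq 4 z =
    4 * (segreDual 0 0 z * segreDual 1 1 z - segreDual 0 1 z * segreDual 1 0 z) := by
  rw [sumSq, Fin.sum_univ_four]
  simp [segreDual]
  linear_combination (z 1 ^ 2 + z 3 ^ 2) * Complex.I_mul_I

theorem exists_rank_one {a b c d : ℂ} (h : a * d = b * c) : ∃ v w : Fin 2 → ℂ,
    v 0 * w 0 = a ∧ v 0 * w 1 = b ∧ v 1 * w 0 = c ∧ v 1 * w 1 = d := by
  by_cases ha : a = 0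
  · subst ha
    rcases mul_eq_zero.1 (h.symm.trans (zero_mul d)) with rfl | rfl
    · exact ⟨![0, 1], ![c, d], by simp⟩
    · exact ⟨![b, d], ![0, 1], by simp⟩
  · refine ⟨![a, c], ![1, b / a], by simp, ?_, by simp, ?_⟩
    · simp
      field_simp
    · simp
      field_simp
      linear_combination -h

theorem isotropic_fin_four {z : Fin 4 → ℂ} : sumSq 4 z = 0 ↔ ∃ v w, z = segreMap v w := by
  constructor
  · intro h
    rw [sumSq_four, mul_eq_zero, or_iff_right (by norm_num), sub_eq_zero] at h
    obtain ⟨v, w, h1, h2, h3, h4⟩ := exists_rank_one h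
    refine ⟨v, w, segreDual_injective fun i j => ?_⟩
    rw [segreDual_segreMap]
    fin_cases i <;> fin_cases j
    exacts [h1.symm, h2.symm, h3.symm, h4.symm]
  · rintro ⟨v, w, rfl⟩
    simp only [sumSq_four, segreDual_segreMap]
    ring

theorem segreMap_ne_zero {v w : Fin 2 → ℂ} (h : segreMap v w ≠ 0) : v ≠ 0 ∧ w ≠ 0 := by
  constructor <;> rintro rfl <;> simp at h

theorem nonempty_segre_iso : Nonempty (((bundleO (Fin 4 → ℂ) 1).restrict (quadric (sumSq 4))).Iso
    (bundleOO (Fin 2 → ℂ) (Fin 2 → ℂ) 1 1)) := by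
  have hhom : ∀ (c d : ℂ) (v w : Fin 2 → ℂ),
      segreMap (c • v) (d • w) = (c * d) • segreMap v w := by
    intro c d v w
    rw [LinearMap.map_smul₂, map_smul, smul_smul]
  refine nonempty_iso_of_segre (fun z => segreMap z.1 z.2) (bilinear_mem_polyFun segreMap)
    hhom _ (fun p => ⟨fun hp => ?_, ?_⟩) fun y => ?_
  · obtain ⟨v, w, h⟩ := isotropic_fin_four.1 (mem_quadric_sumSq.1 hp)
    obtain ⟨hv, hw⟩ := segreMap_ne_zero (h ▸ p.rep_nonzero)
    refine ⟨(Projectivization.mk ℂ v hv, Projectivization.mk ℂ w hw), ?_⟩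
    obtain ⟨a, ha⟩ := Projectivization.exists_smul_eq_mk_rep ℂ v hv
    obtain ⟨b, hb⟩ := Projectivization.exists_smul_eq_mk_rep ℂ w hw
    rw [← ha, ← hb, Units.smul_def, Units.smul_def, hhom, ← h, Submodule.span_singleton_smul_eq
      (IsUnit.mk0 _ (mul_ne_zero a.ne_zero b.ne_zero)), p.submodule_eq]
  · rintro ⟨z, hz⟩ x hx
    obtain ⟨c, rfl⟩ := Submodule.mem_span_singleton.1 (hz ▸ hx)
    rw [sumSq_smul, isotropic_fin_four.2 ⟨_, _, rfl⟩, mul_zero]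
  · obtain ⟨i, hi⟩ := ne_zero_fin_two y.1.rep_nonzero
    obtain ⟨j, hj⟩ := ne_zero_fin_two y.2.rep_nonzero
    -- Column `j` of the matrix (vₐ w_b) is a multiple of `v` and row `i` is a multiple of `w`, so
    -- reading them off inverts the Segre map where `v i` and `w j` are nonzero.
    refine ⟨(LinearMap.pi fun a => segreDual a j).prod (LinearMap.pi fun b => segreDual i b),
      fun v => v i, fun w => w j, segreDual i j, hi, hj, fun v w => ⟨?_, segreDual_segreMap ..⟩⟩
    refine Prod.ext ?_ ?_
    · ext a
      simp [segreDual_segreMap, mul_comm]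
    · ext b
      simp [segreDual_segreMap]

end LowDimension

/-! ### The two rulings of a Segre surface -/

section Rulings

variable {F : Type} [AddCommGroup F] [Module ℂ F]

/-- The family of lines `{v} × ℙ¹` on the image of a Segre map `N`, as points of `ℙ(⋀² F)`. -/
def ruling (N : (Fin 2 → ℂ) →ₗ[ℂ] (Fin 2 → ℂ) →ₗ[ℂ] F) : Set (ℙ ℂ (⋀[ℂ]^2 F)) :=
  {ω | ∃ v, v ≠ 0 ∧ ω.submodule =
    Submodule.span ℂ {wedge F (N v (Pi.single 0 1)) (N v (Pi.single 1 1))}}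

variable {N : (Fin 2 → ℂ) →ₗ[ℂ] (Fin 2 → ℂ) →ₗ[ℂ] F} {Y : Fin 2 → Fin 2 → Module.Dual ℂ F}

theorem wedge_bilinear_eq (v w w' : Fin 2 → ℂ) : wedge F (N v w) (N v w') =
    (w 0 * w' 1 - w 1 * w' 0) • wedge F (N v (Pi.single 0 1)) (N v (Pi.single 1 1)) := by
  have h : ∀ x : Fin 2 → ℂ, N v x = x 0 • N v (Pi.single 0 1) + x 1 • N v (Pi.single 1 1) := by
    intro x
    conv_lhs => rw [pi_eq_sum_univ' x]
    simp
  rw [h w, h w', wedge_combination]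

/-- The Plücker vector of the line belonging to `v` is quadratic in `v`, and linear forms on ⋀²
recover all products vₐv_b. So the ruling is a conic, and fixing one index gives vᵢ · v as a local
inverse. -/
theorem nonempty_ruling_iso (hY : ∀ i j v w, Y i j (N v w) = v i * w j) :
    Nonempty (((projSpace (⋀[ℂ]^2 F)).restrict (ruling N)).Iso P1) := by
  let B : (Fin 2 → ℂ) →ₗ[ℂ] (Fin 2 → ℂ) →ₗ[ℂ] ⋀[ℂ]^2 F :=
    (wedge F).compl₁₂ (N.flip (Pi.single 0 1)) (N.flip (Pi.single 1 1))
  have hB : ∀ v, B v v = wedge F (N v (Pi.single 0 1)) (N v (Pi.single 1 1)) := fun v => rfl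
  have hhom : ∀ (c : ℂ) (v : Fin 2 → ℂ), B (c • v) (c • v) = c ^ 2 • B v v := by
    intro c v
    rw [LinearMap.map_smul₂, map_smul, smul_smul, sq]
  have hφ : ∀ a b v, wedgeDual (Y a 0) (Y b 1) (B v v) = v a * v b := by
    intro a b v
    rw [hB, wedgeDual_wedge]
    simp [hY]
  refine (nonempty_iso_of_power_univ 1 (fun v => B v v) (bilinear_diag_mem_polyFun B) hhom
    (ruling N) (fun p => ⟨?_, ?_⟩) fun y => ?_).map LineBundle.Iso.base
  · rintro ⟨v, hv, hp⟩
    refine ⟨Projectivization.mk ℂ v hv, ?_⟩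
    rw [span_power_rep (fun v => B v v) hhom, hp, hB]
  · rintro ⟨z, hz⟩
    exact ⟨z.rep, z.rep_nonzero, hz⟩
  · obtain ⟨i, hi⟩ := ne_zero_fin_two y.rep_nonzero
    refine ⟨LinearMap.pi fun a => wedgeDual (Y i 0) (Y a 1), fun v => v i,
      wedgeDual (Y i 0) (Y i 1), hi, IsForm.dual _, fun v => ⟨?_, ?_⟩⟩
    · ext a
      exact hφ i a v
    · rw [hφ, ← sq]

theorem isIrreducible_ruling (hY : ∀ i j v w, Y i j (N v w) = v i * w j) :
    @IsIrreducible _ (projSpace (⋀[ℂ]^2 F)).top (ruling N) := by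
  obtain ⟨φ⟩ := nonempty_ruling_iso hY
  exact isIrreducible_univ_restrict.1 (isIrreducible_of_iso φ isIrreducible_univ_projSpace)

/-- The common kernel of the quadratic Plücker forms that vanish on the first ruling. -/
def rulingKer (Y : Fin 2 → Fin 2 → Module.Dual ℂ F) : Submodule ℂ (⋀[ℂ]^2 F) :=
  ⨅ i, LinearMap.ker (wedgeDual (Y 0 i) (Y 1 i))

theorem ruling_le_rulingKer (hY : ∀ i j v w, Y i j (N v w) = v i * w j) {ω : ℙ ℂ (⋀[ℂ]^2 F)}
    (hω : ω ∈ ruling N) : ω.submodule ≤ rulingKer Y := by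
  obtain ⟨v, -, hω⟩ := hω
  rw [hω, Submodule.span_singleton_le_iff_mem, rulingKer, Submodule.mem_iInf]
  intro i
  rw [LinearMap.mem_ker, wedgeDual_wedge]
  simp only [hY]
  fin_cases i <;> simp

/-- On the line of the opposite ruling belonging to `w` the `i`-th form takes the value wᵢ², and not
both of these vanish. -/
theorem ruling_flip_not_le_rulingKer (hY : ∀ i j v w, Y i j (N v w) = v i * w j)
    {ω : ℙ ℂ (⋀[ℂ]^2 F)} (hω : ω ∈ ruling N.flip) : ¬ ω.submodule ≤ rulingKer Y := by
  obtain ⟨w, hw, hω⟩ := hω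
  obtain ⟨i, hi⟩ := ne_zero_fin_two hw
  rw [hω, Submodule.span_singleton_le_iff_mem, rulingKer, Submodule.mem_iInf]
  intro h
  have := h i
  rw [LinearMap.mem_ker, wedgeDual_wedge] at this
  simp [hY, hi] at this

theorem components_rulings (hY : ∀ i j v w, Y i j (N v w) = v i * w j) :
    Disjoint (ruling N) (ruling N.flip) ∧
      (projSpace (⋀[ℂ]^2 F)).components (ruling N ∪ ruling N.flip) =
        {ruling N, ruling N.flip} := by
  have hY' : ∀ i j v w, (fun a b => Y b a) i j (N.flip v w) = v i * w j := by
    intro i j v w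
    rw [LinearMap.flip_apply, hY, mul_comm]
  have h1 : ∀ ω ∈ ruling N, ¬ ω.submodule ≤ rulingKer fun a b => Y b a :=
    fun ω hω => ruling_flip_not_le_rulingKer hY' (by rwa [LinearMap.flip_flip])
  refine ⟨Set.disjoint_left.2 fun ω h h' =>
    ruling_flip_not_le_rulingKer hY h' (ruling_le_rulingKer hY h), ?_⟩
  rw [components_union (X := projSpace (⋀[ℂ]^2 F)) (isClosed_le_submodule (rulingKer Y))
    (isClosed_le_submodule (rulingKer fun a b => Y b a)) (fun ω => ruling_le_rulingKer hY)
    (fun ω => ruling_le_rulingKer hY') h1 (fun ω => ruling_flip_not_le_rulingKer hY),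
    components_of_isIrreducible (isIrreducible_ruling hY),
    components_of_isIrreducible (isIrreducible_ruling hY')]
  rfl

end Rulings

/-! ### Isotropic planes in four variables: the central components for m = 10 -/

section DimensionTen

/-- The Segre map into the coordinates `zⱼ` of `V₁₀`. -/
def segreTen : (Fin 2 → ℂ) →ₗ[ℂ] (Fin 2 → ℂ) →ₗ[ℂ] V 10 :=
  segreMap.compr₂ (inclZ 10)

theorem segreTen_apply (v w : Fin 2 → ℂ) : segreTen v w = inclZ 10 (segreMap v w) := rfl

theorem segreDual_segreTen (i j : Fin 2) (v w : Fin 2 → ℂ) :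
    (segreDual i j ∘ₗ projZ 10) (segreTen v w) = v i * w j :=
  segreDual_segreMap i j v w

/-- Turns a vanishing bracket into the equality of two points of ℙ¹. -/
theorem exists_smul_of_det_eq_zero {v v' : Fin 2 → ℂ} (hv : v ≠ 0)
    (h : v 0 * v' 1 - v 1 * v' 0 = 0) : ∃ c : ℂ, v' = c • v := by
  obtain ⟨i, hi⟩ := ne_zero_fin_two hv
  refine ⟨v' i / v i, ?_⟩
  ext j
  fin_cases i <;> fin_cases j <;> simp at hi ⊢ <;> field_simp
  · linear_combination h
  · linear_combination -h

theorem mem_ruling_of_wedge {F : Type} [AddCommGroup F] [Module ℂ F]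
    {N : (Fin 2 → ℂ) →ₗ[ℂ] (Fin 2 → ℂ) →ₗ[ℂ] F} {v w w' : Fin 2 → ℂ}
    {ω : ℙ ℂ (⋀[ℂ]^2 F)} (h0 : wedge F (N v w) (N v w') ≠ 0)
    (hω : ω.submodule = Submodule.span ℂ {wedge F (N v w) (N v w')}) : ω ∈ ruling N := by
  refine ⟨v, ?_, ?_⟩
  · rintro rfl
    simp at h0
  · rw [wedge_bilinear_eq] at h0
    rw [hω, wedge_bilinear_eq,
      Submodule.span_singleton_smul_eq (IsUnit.mk0 _ (left_ne_zero_of_smul h0))]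

theorem centralLines_ten : centralLines 10 = ruling segreTen ∪ ruling segreTen.flip := by
  ext ω
  constructor
  · rintro ⟨z, z', h0, hz, hω⟩
    have hz1 : sumSq 4 z = 0 := by simpa using hz 1 0
    have hz2 : sumSq 4 z' = 0 := by simpa using hz 0 1
    have hz3 : sumSq 4 (z + z') = 0 := by simpa using hz 1 1
    obtain ⟨v, w, rfl⟩ := isotropic_fin_four.1 hz1
    obtain ⟨v', w', rfl⟩ := isotropic_fin_four.1 hz2
    rw [sumSq_four] at hz3
    simp only [map_add, segreDual_segreMap] at hz3
    -- The determinant of the sum of two rank-one matrices is the product of the brackets of `v`,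
    -- `v'` and of `w`, `w'`. As the sum is isotropic, the two spanning vectors share a factor, and
    -- the line lies in one of the rulings.
    have hdet : (v 0 * v' 1 - v 1 * v' 0) * (w 0 * w' 1 - w 1 * w' 0) = 0 := by
      linear_combination (1 / 4) * hz3
    have h1 : wedge (V 10) (segreTen v w) (segreTen v' w') ≠ 0 := wedge_inclZ_ne_zero h0
    obtain ⟨hv, hw⟩ := segreMap_ne_zero (v := v) (w := w) (by
      intro h
      rw [segreTen_apply, h] at h1
      simp at h1)
    rcases mul_eq_zero.1 hdet with h | h
    · obtain ⟨c, rfl⟩ := exists_smul_of_det_eq_zero hv h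
      have hc : segreTen (c • v) w' = segreTen v (c • w') := by
        rw [LinearMap.map_smul₂, map_smul]
      refine Or.inl (mem_ruling_of_wedge (hc ▸ h1) ?_)
      rw [← hc]
      exact hω
    · obtain ⟨c, rfl⟩ := exists_smul_of_det_eq_zero hw h
      have hc : segreTen v' (c • w) = segreTen.flip w (c • v') := by
        rw [LinearMap.flip_apply, LinearMap.map_smul₂, map_smul]
      refine Or.inr (mem_ruling_of_wedge (v := w) (w := v) (w' := c • v') (hc ▸ h1) ?_)
      rw [← hc]
      exact hω
  · have key : ∀ x x' : Fin 4 → ℂ, wedge _ x x' ≠ 0 →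
        (∀ a b : ℂ, ∃ v w, a • x + b • x' = segreMap v w) →
        ω.submodule = Submodule.span ℂ {wedge (V 10) (inclZ 10 x) (inclZ 10 x')} →
        ω ∈ centralLines 10 := fun x x' h0 h hω =>
      ⟨x, x', h0, fun a b => isotropic_fin_four.2 (h a b), hω⟩
    rintro (⟨v, hv, hω⟩ | ⟨w, hw, hω⟩)
    · obtain ⟨i, hi⟩ := ne_zero_fin_two hv
      refine key (segreMap v (Pi.single 0 1)) (segreMap v (Pi.single 1 1)) ?_ ?_ hω
      · refine wedge_ne_zero_of_duals (α := segreDual i 0) (β := segreDual i 1) ?_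
        simp [segreDual_segreMap, hi]
      · intro a b
        exact ⟨v, a • Pi.single 0 1 + b • Pi.single 1 1, by simp⟩
    · obtain ⟨i, hi⟩ := ne_zero_fin_two hw
      refine key (segreMap (Pi.single 0 1) w) (segreMap (Pi.single 1 1) w) ?_ ?_ hω
      · refine wedge_ne_zero_of_duals (α := segreDual 0 i) (β := segreDual 1 i) ?_
        simp [segreDual_segreMap, hi]
      · intro a b
        exact ⟨a • Pi.single 0 1 + b • Pi.single 1 1, w, by simp⟩

theorem centralLines_ten_components : ∃ S T, Disjoint S T ∧ centralLines 10 = S ∪ T ∧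
    (pluckerSpace 10).components (centralLines 10) = {S, T} ∧
    Nonempty ((subvar 10 S).Iso P1) ∧ Nonempty ((subvar 10 T).Iso P1) := by
  obtain ⟨h1, h2⟩ := components_rulings segreDual_segreTen
  exact ⟨ruling segreTen, ruling segreTen.flip, h1, centralLines_ten, by rw [centralLines_ten, h2],
    nonempty_ruling_iso segreDual_segreTen,
    nonempty_ruling_iso (Y := fun i j => segreDual j i ∘ₗ projZ 10) fun i j v w => by
      rw [LinearMap.flip_apply, segreDual_segreTen, mul_comm]⟩

end DimensionTen

/-! ### The vertices of the weight polytope -/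

section Extremal

variable {E : Type*} [AddCommGroup E] [Module ℝ E]

/-- A point of `A` where a linear form attains its maximum over `A` only at this point is a vertex
of the convex hull of `A`. -/
theorem mem_extremePoints_convexHull {A : Set E} {x : E} (hx : x ∈ A) (f : E →ₗ[ℝ] ℝ)
    (hf : ∀ y ∈ A, y ≠ x → f y < f x) : x ∈ (convexHull ℝ A).extremePoints ℝ := by
  -- The open half-space f < f x together with `x` is convex, so the strict maximum at `x` passes
  -- from `A` to its convex hull.
  have hK : Convex ℝ {y | y ≠ x → f y < f x} := by
    intro y hy z hz a b ha hb hab hne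
    have hle : ∀ u, (u ≠ x → f u < f x) → f u ≤ f x := fun u hu => by
      by_cases h : u = x
      · rw [h]
      · exact (hu h).le
    have hy' := hle y hy
    have hz' := hle z hz
    rw [map_add, map_smul, map_smul, smul_eq_mul, smul_eq_mul]
    rcases ha.eq_or_lt with rfl | ha
    · obtain rfl : b = 1 := by simpa using hab
      simpa using hz (by simpa using hne)
    rcases hb.eq_or_lt with rfl | hb
    · obtain rfl : a = 1 := by simpa using hab
      simpa using hy (by simpa using hne)
    by_cases h : y = x
    · have hzx : z ≠ x := by
        rintro rfl
        exact hne (by rw [h, ← add_smul, hab, one_smul])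
      have := hz hzx
      rw [show a = 1 - b by linarith]
      nlinarith
    · have := hy h
      rw [show b = 1 - a by linarith]
      nlinarith
  have hA : convexHull ℝ A ⊆ {y | y ≠ x → f y < f x} := convexHull_min hf hK
  refine ⟨subset_convexHull ℝ A hx, fun y hy z hz hxyz => ?_⟩
  by_contra hne
  obtain ⟨a, b, ha, hb, hab, rfl⟩ := hxyz
  have h1 := hA hy hne
  have h2 : f z ≤ f (a • y + b • z) := by
    by_cases h : z = a • y + b • z
    · rw [← h]
    · exact (hA hz h).le
  rw [map_add, map_smul, map_smul, smul_eq_mul, smul_eq_mul] at h1 h2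
  have h3 : a = 1 - b := by linarith
  rw [h3] at h1 h2
  nlinarith

/-- The difference of two coordinates on `M₂`. -/
def coordDiff (i j : Fin 3) : ℤ × ℤ →+ ℤ :=
  -- The third entry is 0 because `coordM2` normalises the third coordinate to 0.
  (![AddMonoidHom.fst ℤ ℤ, AddMonoidHom.snd ℤ ℤ, 0] : Fin 3 → ℤ × ℤ →+ ℤ) i -
    (![AddMonoidHom.fst ℤ ℤ, AddMonoidHom.snd ℤ ℤ, 0] : Fin 3 → ℤ × ℤ →+ ℤ) j

/-- The real linear form on `M₂ ⊗ ℝ` given by a difference of coordinates. -/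
def realDiff (i j : Fin 3) : ℝ ⊗[ℤ] M2 →ₗ[ℝ] ℝ :=
  (TensorProduct.AlgebraTensorModule.rid ℤ ℝ ℝ).toLinearMap ∘ₗ
    ((coordDiff i j).comp coordM2).toIntLinearMap.baseChange ℝ

theorem realDiff_tmul (i j : Fin 3) (w : M2) :
    realDiff i j ((1 : ℝ) ⊗ₜ[ℤ] w) = (coordDiff i j (coordM2 w) : ℝ) := by
  simp [realDiff]

/-- `M2` is free, so nothing is lost in `M₂ ⊗ ℝ`: the integral coordinates are still read off by
real linear forms. -/
theorem one_tmul_injective : Function.Injective fun w : M2 => (1 : ℝ) ⊗ₜ[ℤ] w := by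
  intro w w' h
  have key : ∀ i j, coordDiff i j (coordM2 w) = coordDiff i j (coordM2 w') := by
    intro i j
    have := congrArg (realDiff i j) h
    simpa [realDiff_tmul] using this
  refine coordM2_injective (Prod.ext ?_ ?_)
  · simpa [coordDiff] using key 0 2
  · simpa [coordDiff] using key 1 2

theorem coordDiff_self {i j : Fin 3} (h : i ≠ j) :
    coordDiff i j (coordWt (Sum.inl i) + coordWt (Sum.inr j)) = 2 := by
  revert i j
  decide

theorem coordDiff_root_lt {i j k l : Fin 3} (h : i ≠ j) (h' : k ≠ l) (hne : (k, l) ≠ (i, j)) :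
    coordDiff i j (coordWt (Sum.inl k) + coordWt (Sum.inr l)) < 2 := by
  revert i j k l
  decide

theorem coordDiff_wt_lt (i j : Fin 3) (γ : Fin 3 ⊕ Fin 3) : coordDiff i j (coordWt γ) < 2 := by
  revert i j γ
  decide

variable {m : ℕ}

theorem weightLocus_e_sub_nonempty {i j : Fin 3} (h : i ≠ j) :
    (weightLocus m (e i - e j)).Nonempty := by
  obtain ⟨ω, hω⟩ := weightLocus_e_sub (m := m) h
  exact hω ▸ Set.singleton_nonempty ω

theorem weightLocus_wt_nonempty (γ : Fin 3 ⊕ Fin 3) : (weightLocus m (wt γ)).Nonempty := by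
  obtain ⟨α, β, h, hω⟩ := weightLocus_wt (m := m) γ
  exact hω ▸ (Set.singleton_nonempty _).inl

/-- The form aᵢ - aⱼ has value 2 at eᵢ - eⱼ and smaller values at every other weight. -/
theorem isExtremalWeight_e_sub {i j : Fin 3} (h : i ≠ j) : IsExtremalWeight m (e i - e j) := by
  refine mem_extremePoints_convexHull ⟨_, weightLocus_e_sub_nonempty h, rfl⟩ (realDiff i j) ?_
  rintro _ ⟨w, hw, rfl⟩ hne
  rw [realDiff_tmul, realDiff_tmul, Int.cast_lt, coordM2_e_sub i j, coordDiff_self h]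
  rcases weight_cases hw with ⟨k, l, hkl, rfl⟩ | ⟨γ, rfl⟩ | rfl
  · rw [coordM2_e_sub]
    refine coordDiff_root_lt h hkl fun he => hne ?_
    rw [Prod.mk.injEq] at he
    rw [he.1, he.2]
  · rw [coordM2_wt]
    exact coordDiff_wt_lt i j γ
  · simp

theorem not_isExtremalWeight_of_add {w w₁ w₂ : M2} (h : w + w = w₁ + w₂)
    (h₁ : (weightLocus m w₁).Nonempty) (h₂ : (weightLocus m w₂).Nonempty) (hne : w₁ ≠ w) :
    ¬ IsExtremalWeight m w := by
  intro hw
  refine hne (one_tmul_injective (hw.2 (subset_convexHull ℝ _ ⟨w₁, h₁, rfl⟩)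
    (subset_convexHull ℝ _ ⟨w₂, h₂, rfl⟩)
    ⟨1 / 2, 1 / 2, by norm_num, by norm_num, by norm_num, ?_⟩))
  rw [← smul_add, ← TensorProduct.tmul_add, ← h, TensorProduct.tmul_add, ← two_smul ℝ, smul_smul]
  norm_num

/-- From 2eᵢ = (eᵢ - eⱼ) + (eᵢ + eⱼ) and eᵢ + eⱼ = -eₖ, the weight eᵢ is the midpoint of a root and
-eₖ; the case of -eᵢ is symmetric. -/
theorem exists_wt_add_wt (γ : Fin 3 ⊕ Fin 3) :
    ∃ i j, i ≠ j ∧ ∃ δ, wt γ + wt γ = (e i - e j) + wt δ := by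
  have : ∃ i j : Fin 3, i ≠ j ∧ ∃ δ, coordWt γ + coordWt γ =
      (coordWt (Sum.inl i) + coordWt (Sum.inr j)) + coordWt δ := by
    revert γ
    decide
  obtain ⟨i, j, h, δ, he⟩ := this
  refine ⟨i, j, h, δ, coordM2_injective ?_⟩
  rw [map_add, map_add, coordM2_e_sub, coordM2_wt, coordM2_wt, he]

theorem isExtremalWeight_iff (w : M2) : IsExtremalWeight m w ↔ ∃ i j, i ≠ j ∧ w = e i - e j := by
  constructor
  · intro hw
    obtain ⟨w', hw', he⟩ := extremePoints_convexHull_subset hw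
    obtain rfl := one_tmul_injective he
    rcases weight_cases hw' with h | ⟨γ, rfl⟩ | rfl
    · exact h
    · obtain ⟨i, j, hij, δ, h⟩ := exists_wt_add_wt γ
      exact (not_isExtremalWeight_of_add h (weightLocus_e_sub_nonempty hij)
        (weightLocus_wt_nonempty δ) (e_sub_ne_wt hij γ) hw).elim
    -- The weight 0 is the midpoint of e₁ and -e₁, which always occur.
    · refine (not_isExtremalWeight_of_add (w₁ := wt (Sum.inl 0)) (w₂ := wt (Sum.inr 0)) ?_
        (weightLocus_wt_nonempty _) (weightLocus_wt_nonempty _) (wt_ne_zero _) hw).elim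
      simp [wt]
  · rintro ⟨i, j, h, rfl⟩
    exact isExtremalWeight_e_sub h

end Extremal

/-! ### The components of each weight and their disjointness -/

section Components

variable {m : ℕ}

theorem components_pair {E : Type} [AddCommGroup E] [Module ℂ E] {a b : ℙ ℂ E} (h : a ≠ b) :
    (projSpace E).components {a, b} = {{a}, {b}} := by
  rw [Set.insert_eq a {b}, components_union (X := projSpace E) (isClosed_singleton a)
    (isClosed_singleton b) subset_rfl subset_rfl (by rintro _ rfl; exact h)
    (by rintro _ rfl; exact h.symm), components_singleton, components_singleton]
  rfl

theorem components_axisQuadric (hm : 9 ≤ m) (α : Fin 3 ⊕ Fin 3) :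
    (pluckerSpace m).components (axisQuadric m α) = {axisQuadric m α} :=
  components_of_isIrreducible (isIrreducible_axisQuadric hm α)

theorem components_axisQuadric_of_lt (hm : m < 8) (α : Fin 3 ⊕ Fin 3) :
    (pluckerSpace m).components (axisQuadric m α) = ∅ := by
  rw [axisQuadric_eq_empty hm]
  exact components_empty

theorem componentsOfWeight_zero_of_lt (hm : m < 10) : componentsOfWeight m 0 = ∅ := by
  rw [componentsOfWeight_eq, weightLocus_zero, centralLines_eq_empty hm]
  exact components_empty

theorem componentsOfWeight_zero (hm : 11 ≤ m) : componentsOfWeight m 0 = {weightLocus m 0} := by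
  rw [componentsOfWeight_eq, weightLocus_zero]
  exact components_of_isIrreducible (isIrreducible_centralLines hm)

theorem weightLocus_zero_ten : ∃ S T, Disjoint S T ∧ weightLocus 10 0 = S ∪ T ∧
    componentsOfWeight 10 0 = {S, T} ∧
    Nonempty ((subvar 10 S).Iso P1) ∧ Nonempty ((subvar 10 T).Iso P1) := by
  rw [componentsOfWeight_eq, weightLocus_zero]
  exact centralLines_ten_components

theorem pairwiseDisjoint_axisQuadric (α : Fin 3 ⊕ Fin 3) :
    ((pluckerSpace m).components (axisQuadric m α)).PairwiseDisjoint id := by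
  rcases lt_trichotomy m 8 with hm | rfl | hm
  · rw [components_axisQuadric_of_lt hm]
    exact Set.pairwiseDisjoint_empty
  · obtain ⟨a, b, hab, h⟩ := axisQuadric_eight α
    rw [h, components_pair hab]
    have hd : Disjoint ({a} : Set (ℙ ℂ (⋀[ℂ]^2 (V 8)))) {b} := by simpa using hab
    exact Set.pairwise_pair.2 fun _ => ⟨hd, hd.symm⟩
  · rw [components_axisQuadric hm]
    exact Set.pairwiseDisjoint_singleton _ _

theorem pairwiseDisjoint_componentsOfWeight (w : M2) :
    (componentsOfWeight m w).PairwiseDisjoint id := by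
  by_cases hw : (weightLocus m w).Nonempty
  · rcases weight_cases hw with ⟨i, j, h, rfl⟩ | ⟨γ, rfl⟩ | rfl
    · obtain ⟨ω, hω⟩ := componentsOfWeight_e_sub (m := m) h
      rw [hω]
      exact Set.pairwiseDisjoint_singleton _ _
    · obtain ⟨ω, hω, h⟩ := componentsOfWeight_wt (m := m) γ
      rw [h, Set.pairwiseDisjoint_insert]
      exact ⟨pairwiseDisjoint_axisQuadric _, fun Y hY _ => Set.disjoint_singleton_left.2
        fun hmem => hω (subset_of_mem_components hY hmem)⟩
    · rcases lt_trichotomy m 10 with hm | rfl | hm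
      · rw [componentsOfWeight_zero_of_lt hm]
        exact Set.pairwiseDisjoint_empty
      · obtain ⟨S, T, hST, -, h, -⟩ := weightLocus_zero_ten
        rw [h]
        exact Set.pairwise_pair.2 fun _ => ⟨hST, hST.symm⟩
      · rw [componentsOfWeight_zero hm]
        exact Set.pairwiseDisjoint_singleton _ _
  · rw [componentsOfWeight_eq, Set.not_nonempty_iff_eq_empty.1 hw]
    exact (components_empty (X := pluckerSpace m)) ▸ Set.pairwiseDisjoint_empty

/-- Components of different weights are disjoint since a point has only one weight; within one
weight the explicit list is inspected. -/
theorem pairwiseDisjoint_fixedComponents : (fixedComponents m).PairwiseDisjoint id := by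
  intro Y hY Y' hY' hne
  obtain ⟨w, hw, -⟩ := existsUnique_weight hY
  obtain ⟨w', hw', -⟩ := existsUnique_weight hY'
  by_cases h : w = w'
  · exact pairwiseDisjoint_componentsOfWeight w hw (h ▸ hw') hne
  · exact Set.disjoint_left.2 fun ω h1 h2 => h (weightLocus_disjoint (hw.2 h1) (hw'.2 h2))

theorem componentsOfWeight_nonempty_cases {w : M2} (hw : (componentsOfWeight m w).Nonempty) :
    (∃ i j, i ≠ j ∧ w = e i - e j) ∨ (∃ i, w = e i ∨ w = -e i) ∨ w = 0 := by
  obtain ⟨Y, hY, hYw⟩ := hw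
  rw [exists_wt_iff]
  exact weight_cases ((isIrreducible_of_mem_components hY).1.mono hYw)

end Components

end LinesOnQuadric

end

/-! ### The classification of the fixed components -/

theorem propositionA1 (m : ℕ) (hm : 6 ≤ m) :
    -- every fixed component has exactly one weight, and distinct components are disjoint
    (∀ Y ∈ fixedComponents m, ∃! w : M2, Y ∈ componentsOfWeight m w) ∧
    (fixedComponents m).PairwiseDisjoint id ∧
    -- the list is complete: no other weights occur
    (∀ w : M2, (componentsOfWeight m w).Nonempty →
      (∃ i j, i ≠ j ∧ w = e i - e j) ∨ (∃ i, w = e i ∨ w = -e i) ∨ w = 0) ∧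
    -- one-point extremal components
    (∀ w : M2, IsExtremalWeight m w ↔ ∃ i j, i ≠ j ∧ w = e i - e j) ∧
    (∀ i j, i ≠ j → ∃ ω, componentsOfWeight m (e i - e j) = {{ω}}) ∧
    -- components of weight `± eᵢ`
    (∀ w : M2, (∃ i, w = e i ∨ w = -e i) →
      (m < 8 → ∃ ω, componentsOfWeight m w = {{ω}}) ∧
      (8 ≤ m → ∃ ω S, ω ∉ S ∧
        componentsOfWeight m w = insert {ω} ((pluckerSpace m).components S) ∧
        Nonempty ((restrictL m S).Iso (smallQuadricO1 m)) ∧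
        (m = 8 → ∃ a b, a ≠ b ∧ S = {a, b} ∧
          componentsOfWeight m w = {{ω}, {a}, {b}}) ∧
        (9 ≤ m → componentsOfWeight m w = {{ω}, S}) ∧
        (m = 9 → Nonempty ((restrictL m S).Iso (bundleO (Fin 2 → ℂ) 2))) ∧
        (m = 10 → Nonempty ((restrictL m S).Iso (bundleOO (Fin 2 → ℂ) (Fin 2 → ℂ) 1 1))))) ∧
    -- central components
    (m < 10 → componentsOfWeight m 0 = ∅) ∧
    (10 ≤ m →
      componentsOfWeight m 0 = (pluckerSpace m).components (weightLocus m 0) ∧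
      Nonempty ((subvar m (weightLocus m 0)).Iso (smallG m)) ∧
      (m = 10 → ∃ S T, Disjoint S T ∧ weightLocus m 0 = S ∪ T ∧
        componentsOfWeight m 0 = {S, T} ∧
        Nonempty ((subvar m S).Iso P1) ∧ Nonempty ((subvar m T).Iso P1)) ∧
      (11 ≤ m → componentsOfWeight m 0 = {weightLocus m 0})) := by
  refine ⟨fun Y hY => existsUnique_weight hY, pairwiseDisjoint_fixedComponents,
    fun w hw => componentsOfWeight_nonempty_cases hw, isExtremalWeight_iff,
    fun i j h => componentsOfWeight_e_sub h, fun w hw => ?_, componentsOfWeight_zero_of_lt,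
    fun _ => ⟨componentsOfWeight_eq 0, ?_, ?_, componentsOfWeight_zero⟩⟩
  · obtain ⟨γ, rfl⟩ := exists_wt_iff.1 hw
    obtain ⟨ω, hω, h⟩ := componentsOfWeight_wt (m := m) γ
    refine ⟨fun h8 => ⟨ω, ?_⟩, fun h8 => ⟨ω, axisQuadric m γ.swap, hω, h,
      nonempty_axisQuadric_iso _, ?_, fun h9 => ?_, ?_, ?_⟩⟩
    · rw [h, components_axisQuadric_of_lt h8, insert_empty_eq]
    · rintro rfl
      obtain ⟨a, b, hab, hS⟩ := axisQuadric_eight γ.swap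
      exact ⟨a, b, hab, hS, by rw [h, hS, components_pair hab]⟩
    · rw [h, components_axisQuadric h9]
    · rintro rfl
      obtain ⟨φ⟩ := nonempty_axisQuadric_iso (m := 9) γ.swap
      obtain ⟨ψ⟩ := nonempty_conic_iso
      exact ⟨φ.trans ψ⟩
    · rintro rfl
      obtain ⟨φ⟩ := nonempty_axisQuadric_iso (m := 10) γ.swap
      obtain ⟨ψ⟩ := nonempty_segre_iso
      exact ⟨φ.trans ψ⟩
  · rw [weightLocus_zero]
    exact nonempty_centralLines_iso
  · rintro rfl
    exact weightLocus_zero_ten
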